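/- **Setting.** All maps are finite, lie on the oriented sphere, may have loops and multiple edges, and are considered up to orientation-preserving isomorphism. A *rooted* planar map is a connected planar map with one distinguished corner (equivalently, one distinguished oriented edge). Let $1\le n$ and $0\le m\le n$. Let $(M,s,t)$ be a random rooted planar map $M$ with $n$ edges, $m+1$ vertices and $n-m+1$ faces, together with two vertices, a *seed* $s$ and a *target* $t$, such that the probability of each such decorated map is proportional to the number of spanning trees of $M$. (Seed and target may either be allowed to coincide, or be required to be different, in which case $m\ge1$; the statement holds in both versions.) *LERW.* Given $(M,s,t)$, let $L=(e_1,\dots,e_{|L|})$ be the sequence of oriented edges of the chronological loop erasure of simple random walk on $M$ from $s$, stopped when it first reaches $t$ (at each step the walk traverses a uniformly chosen half-edge at its current vertex). *Edge-based DLA.* Given $(M,s,t)$, start with the cluster $\{s\}$. As long as the cluster does not contain $t$, run an independent simple random walk from $t$ until it first visits a vertex of the cluster, and add the last edge traversed by it, with its other endpoint, to the cluster. The added edges, oriented away from the previous cluster and in the order in which they are added, form a random sequence $D=(e_1,\dots,e_{|D|})$; these are the edges of a tree that contains $s$ and $t$. *Unzipping.* To unzip an oriented edge $e$ from $w$ to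 $u$, split it into two parallel edges that bound a grey 2-gon. If $w$ already is a vertex of the grey polygon, merge the 2-gon with the grey polygon at $w$, so that $w$ is split into two vertices, one on each side. In either case the new *tip* is $u$. (Before any edge has been unzipped there is no grey polygon, and the tip is $s$.) Unzipping the edges of $L$ or of $D$ one after the other, one obtains after $j$ steps a planar map with a grey $2j$-gon, a tip vertex on it (for $j\ge1$), a target vertex, and a root corner outside the grey polygon, namely the root corner inherited from $M$ (unzipping changes no old corner). For $k\ge0$ let $U_k(L)$ and $U_k(D)$ be the decorated maps obtained by unzipping the first $k$ edges of $L$ and $D$, respectively (all edges, if there are fewer than $k$), and let $U_\infty(L)$ and $U_\infty(D)$ be the maps obtained by unzipping all edges. **Proposition.** The walks above hit almost surely and the growth process terminates almost surely, so that $L$ and $D$ are well defined, and 1. $|D|$ and $|L|$ have the same law; 2. for each $k\ge 0$, the decorated maps $U_k(L)$ and $U_k(D)$ have the same law; the same is true if the tip of $U_k(D)$ is first resampled from harmonic measure viewed from the target, i.e. replaced by the first vertex of the grey polygon (of $\{s\}$, if $k=0$ or $s=t$) that is visited by an independent simple random walk on $U_k(D)$ from the target; 3. the decorated maps $U_\infty(L)$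 and $U_\infty(D)$ have the same law. -/

import Mathlib

open Equiv (Perm)
open scoped ENNReal

/-- Data of a (finite, oriented) map on a surface, together with its decorations.

The map is given by its darts (half-edges) as a combinatorial map: `rot d` is the dart following `d`
counterclockwise around the origin of `d`, and `rev d` is the other half of the edge of `d`.
Vertices are the cycles of `rot`, edges the cycles of `rev`, and faces the cycles of `faceRot`.
The corner between `d` and `rot d` is called the corner of `d`.

* `root` : the dart of the root corner (a rooted map is a map with a distinguished corner);
* `grey` : the darts of the corners of the grey polygon (empty if there is no grey polygon);
* `tip` : a dart of the tip vertex; as long as there is no grey polygon this is the seed;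
* `target` : a dart of the target vertex.

The laws of a planar map are imposed by `IsRootedPlanarMap`. -/
structure MarkedMap : Type 1 where
  Dart : Type
  rot : Perm Dart
  rev : Perm Dart
  root : Dart
  grey : Set Dart
  tip : Dart
  target : Dart

namespace MarkedMap

/-- The darts `a` and `b` have the same origin. -/
def SameVertex (S : MarkedMap) (a b : S.Dart) : Prop := S.rot.SameCycle a b

/-- The next dart along the boundary of the face to the left of a dart. -/
def faceRot (S : MarkedMap) : Perm S.Dart := S.rot⁻¹ * S.rev

/-- The number of cycles of a permutation, fixed points included. -/
noncomputable def numCycles {α : Type} (f : Perm α) : ℕ :=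
  Nat.card (Quotient (Perm.SameCycle.setoid f))

/-- The degree of the origin of a dart (a loop counts twice). -/
noncomputable def deg (S : MarkedMap) (d : S.Dart) : ℕ :=
  Nat.card {d' : S.Dart // S.SameVertex d d'}

/-- Two darts are joined by a path which uses only edges of `T`. -/
def Joined (S : MarkedMap) (T : Set S.Dart) : S.Dart → S.Dart → Prop :=
  Relation.ReflTransGen fun a b => S.SameVertex a b ∨ (a ∈ T ∧ b = S.rev a)

/-- A rooted planar map with `n` edges, `m + 1` vertices and `n - m + 1` faces, without grey
polygon. It is planar by Euler's formula. -/
structure IsRootedPlanarMap (n m : ℕ) (S : MarkedMap) : Prop where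
  finite : Finite S.Dart
  rev_rev : ∀ d, S.rev (S.rev d) = d
  rev_ne : ∀ d, S.rev d ≠ d
  connected : ∀ a b, S.Joined Set.univ a b
  edges : Nat.card S.Dart = 2 * n
  vertices : numCycles S.rot = m + 1
  faces : numCycles S.faceRot + m = n + 1
  grey : S.grey = ∅

/-- The set `T` of darts consists of the edges of a spanning tree: a connected spanning subgraph with
one edge less than the map has vertices. -/
structure IsSpanningTree (S : MarkedMap) (T : Set S.Dart) : Prop where
  rev_mem : ∀ d ∈ T, S.rev d ∈ T
  connected : ∀ a b, S.Joined T a b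
  card : Nat.card T + 2 = 2 * numCycles S.rot

/-- The number of spanning trees. -/
noncomputable def numSpanningTrees (S : MarkedMap) : ℕ :=
  Nat.card {T : Set S.Dart // S.IsSpanningTree T}

/-! ### Isomorphism classes -/

/-- `φ` is an (orientation-preserving) isomorphism of decorated maps. The tip and the target are
vertices, so only the origins of the darts `tip` and `target` have to be preserved. -/
structure IsIso (S S' : MarkedMap) (φ : S.Dart ≃ S'.Dart) : Prop where
  rot : ∀ d, φ (S.rot d) = S'.rot (φ d)
  rev : ∀ d, φ (S.rev d) = S'.rev (φ d)
  root : φ S.root = S'.root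
  grey : ∀ d, φ d ∈ S'.grey ↔ d ∈ S.grey
  tip : S'.SameVertex (φ S.tip) S'.tip
  target : S'.SameVertex (φ S.target) S'.target

theorem sameVertex_of_conj {S S' : MarkedMap} (φ : S.Dart ≃ S'.Dart)
    (h : ∀ d, φ (S.rot d) = S'.rot (φ d)) {a b : S.Dart} (hab : S.SameVertex a b) :
    S'.SameVertex (φ a) (φ b) := by
  have hc : S'.rot = φ.permCongr S.rot := by
    ext x
    simp [Equiv.permCongr_apply, h]
  obtain ⟨i, hi⟩ := hab
  refine ⟨i, ?_⟩
  have hp : S'.rot ^ i = φ.permCongr (S.rot ^ i) := by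
    rw [hc]
    exact (map_zpow (φ.permCongrHom) S.rot i).symm
  rw [hp, Equiv.permCongr_apply, Equiv.symm_apply_apply, hi]

theorem IsIso.refl (S : MarkedMap) : IsIso S S (Equiv.refl _) where
  rot _ := by rfl
  rev _ := by rfl
  root := by rfl
  grey _ := Iff.rfl
  tip := Perm.SameCycle.refl _ _
  target := Perm.SameCycle.refl _ _

theorem IsIso.symm {S S' : MarkedMap} {φ : S.Dart ≃ S'.Dart} (h : IsIso S S' φ) :
    IsIso S' S φ.symm := by
  have hrot : ∀ d, φ.symm (S'.rot d) = S.rot (φ.symm d) := fun d => by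
    rw [Equiv.symm_apply_eq, h.rot, Equiv.apply_symm_apply]
  refine ⟨hrot, fun d => ?_, ?_, fun d => ?_, ?_, ?_⟩
  · rw [Equiv.symm_apply_eq, h.rev, Equiv.apply_symm_apply]
  · rw [Equiv.symm_apply_eq, h.root]
  · rw [← h.grey, Equiv.apply_symm_apply]
  · simpa using sameVertex_of_conj φ.symm hrot (Perm.SameCycle.symm h.tip)
  · simpa using sameVertex_of_conj φ.symm hrot (Perm.SameCycle.symm h.target)

theorem IsIso.trans {S S' S'' : MarkedMap} {φ : S.Dart ≃ S'.Dart} {ψ : S'.Dart ≃ S''.Dart}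
    (h : IsIso S S' φ) (k : IsIso S' S'' ψ) : IsIso S S'' (φ.trans ψ) where
  rot d := by simp [h.rot, k.rot]
  rev d := by simp [h.rev, k.rev]
  root := by simp [h.root, k.root]
  grey d := by simp [h.grey, k.grey]
  tip := (sameVertex_of_conj ψ k.rot h.tip).trans k.tip
  target := (sameVertex_of_conj ψ k.rot h.target).trans k.target

instance isoSetoid : Setoid MarkedMap where
  r S S' := ∃ φ : S.Dart ≃ S'.Dart, IsIso S S' φ
  iseqv :=
    { refl := fun S => ⟨_, IsIso.refl S⟩
      symm := fun ⟨_, h⟩ => ⟨_, h.symm⟩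
      trans := fun ⟨_, h⟩ ⟨_, k⟩ => ⟨_, h.trans k⟩ }

/-- Isomorphism classes of decorated maps. -/
abbrev IsoClass : Type 1 := Quotient isoSetoid

/-! ### Unzipping -/

open Classical in
/-- Unzip the edge of the dart `e`, which goes from the tip `w` (the origin of `e`) to `u`.

The edge is split into two parallel edges, with grey inside. The left one has the darts `e` (at `w`)
and a new dart `x'` (at `u`), the right one a new dart `x` (at `w`) and `rev e` (at `u`). If `w` is on
the boundary of the grey polygon, with grey corner `g`, then the corner `g` of the polygon is merged
with the new 2-gon, so that `w` is split into a left vertex containing `e` and `g`, and a right vertex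
containing `x`. The new tip is `u`. The corners of the old darts stay what they were, and the
grey polygon gets the two new corners `x` and `x'`. -/
noncomputable def unzip (S : MarkedMap) (e : S.Dart) : MarkedMap :=
  let x : S.Dart ⊕ Bool := Sum.inr false
  let x' : S.Dart ⊕ Bool := Sum.inr true
  let doubled : Perm (S.Dart ⊕ Bool) :=
    Equiv.swap (Sum.inl (S.rev e)) x' * Equiv.swap (Sum.inl e) x * Perm.sumCongr S.rot 1
  { Dart := S.Dart ⊕ Bool
    rot :=
      if h : ∃ g ∈ S.grey, S.SameVertex e g then doubled * Equiv.swap x (Sum.inl h.choose)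
      else doubled
    rev :=
      Equiv.swap (Sum.inl (S.rev e)) x' * Perm.sumCongr S.rev (Equiv.swap false true) *
        Equiv.swap (Sum.inl (S.rev e)) x'
    root := Sum.inl S.root
    grey := Sum.inl '' S.grey ∪ {x, x'}
    tip := x'
    target := Sum.inl S.target }

/-- Unzip the edges in a list of darts one after the other; `ι` says where the darts are found in
the map that has been reached so far. -/
noncomputable def unzipAux {D : Type} : List D → (S : MarkedMap) → (D → S.Dart) → MarkedMap
  | [], S, _ => S
  | e :: γ, S, ι => unzipAux γ (S.unzip (ι e)) fun d => Sum.inl (ι d)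

/-- The map obtained from `S` by unzipping the edges of the list `γ` in this order. -/
noncomputable def unzipList (S : MarkedMap) (γ : List S.Dart) : MarkedMap := unzipAux γ S id

/-! ### Random walk, loop-erased random walk, harmonic measure, DLA -/

/-- The walk that starts at the origin of the given dart and traverses the darts of the list is a walk
on the map that stops when it first visits a vertex of `A`. (Here and below a set of vertices is
given as the set of darts which start at these vertices.) -/
def IsStoppedWalk (S : MarkedMap) (A : Set S.Dart) : S.Dart → List S.Dart → Prop
  | a, [] => a ∈ A
  | a, d :: ω => a ∉ A ∧ S.SameVertex a d ∧ IsStoppedWalk S A (S.rev d) ω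

/-- The probability that simple random walk, which traverses at each step a uniformly random dart at
its current vertex, follows the list of darts `ω`. -/
noncomputable def walkWeight (S : MarkedMap) (ω : List S.Dart) : ℝ≥0∞ :=
  (ω.map fun d => (S.deg d : ℝ≥0∞)⁻¹).prod

open Classical in
/-- Chronological loop erasure: after each step, if the vertex just reached has been visited before by
the current path, the loop that has been closed is erased. -/
noncomputable def loopErase (S : MarkedMap) (ω : List S.Dart) : List S.Dart :=
  ω.foldl (fun γ d => (γ ++ [d]).takeWhile fun e => ¬ S.SameVertex e (S.rev d)) []

/-- The darts at the tip (the seed, as long as there is no grey polygon). -/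
def tipVertex (S : MarkedMap) : Set S.Dart := {d | S.SameVertex S.tip d}

/-- The darts at the target. -/
def targetVertex (S : MarkedMap) : Set S.Dart := {d | S.SameVertex S.target d}

/-- The darts at the vertices of the grey polygon (at the seed, if there is no grey polygon). -/
def cluster (S : MarkedMap) : Set S.Dart := S.tipVertex ∪ {d | ∃ g ∈ S.grey, S.SameVertex g d}

open Classical in
/-- The probability that the loop erasure of simple random walk from the seed to the target
(stopped when it reaches the target) is the path `γ`. -/
noncomputable def lerwProb (S : MarkedMap) (γ : List S.Dart) : ℝ≥0∞ :=
  ∑' ω : List S.Dart,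
    if S.IsStoppedWalk S.targetVertex S.tip ω ∧ S.loopErase ω = γ then S.walkWeight ω else 0

open Classical in
/-- Harmonic measure viewed from the target: the probability that simple random walk from the target,
stopped when it first visits `C`, arrives there through the edge of the dart `e`, where `e` points
away from `C`. -/
noncomputable def harmonicMeasure (S : MarkedMap) (C : Set S.Dart) (e : S.Dart) : ℝ≥0∞ :=
  ∑' ω : List S.Dart,
    if S.IsStoppedWalk C S.target ω ∧ ω.getLast?.map S.rev = some e then S.walkWeight ω else 0

open Classical in
/-- The probability that edge-based DLA, started from the cluster `C`, adds precisely the edges of the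
list, in this order and directed away from the cluster, until it contains the target. Each new edge
is sampled from harmonic measure viewed from the target. -/
noncomputable def dlaAux (S : MarkedMap) : Set S.Dart → List S.Dart → ℝ≥0∞
  | C, [] => if S.target ∈ C then 1 else 0
  | C, e :: γ =>
    if S.target ∈ C then 0
    else S.harmonicMeasure C e * dlaAux S (C ∪ {d | S.SameVertex (S.rev e) d}) γ

/-- The probability that edge-based DLA from the seed to the target adds precisely the edges of the list
`γ`, in this order. -/
noncomputable def dlaProb (S : MarkedMap) (γ : List S.Dart) : ℝ≥0∞ := S.dlaAux S.tipVertex γ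

/-- The same map, with the tip moved to the origin of `d`. -/
def withTip (S : MarkedMap) (d : S.Dart) : MarkedMap := { S with tip := d }

open Classical in
/-- The law of the map (up to isomorphism) after its tip has been resampled from harmonic measure
viewed from the target, i.e. as the first vertex of the grey polygon visited by simple random walk
from the target. -/
noncomputable def resampleTip (S : MarkedMap) (z : IsoClass) : ℝ≥0∞ :=
  ∑' ω : List S.Dart,
    if S.IsStoppedWalk S.cluster S.target ω ∧
        (⟦S.withTip ((ω.getLast?.map S.rev).getD S.target)⟧ : IsoClass) = z
    then S.walkWeight ω else 0

/-! ### The random planar map -/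

open Classical in
/-- The weight of a decorated map: its number of spanning trees if it is a rooted planar map with `n`
edges, `m + 1` vertices and `n - m + 1` faces (with a seed and a target), and `0` otherwise. If
`distinct` holds, seed and target are required to be different. -/
noncomputable def mapWeight (n m : ℕ) (distinct : Prop) (c : IsoClass) : ℝ≥0∞ :=
  if c.out.IsRootedPlanarMap n m ∧ (distinct → ¬ c.out.SameVertex c.out.tip c.out.target) then
    (c.out.numSpanningTrees : ℝ≥0∞)
  else 0

/-- The law of the random rooted planar map with seed and target, with probabilities proportional to
the number of spanning trees. -/
noncomputable def mapLaw (n m : ℕ) (distinct : Prop) (c : IsoClass) : ℝ≥0∞ :=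
  mapWeight n m distinct c / ∑' c' : IsoClass, mapWeight n m distinct c'

/-- The law of a random variable that depends on the random map and on a random list of its darts. The
list has conditional law `P` given the map, and `K S γ` is the law of the random variable given
the map `S` and the list `γ`. -/
noncomputable def jointLaw (n m : ℕ) (distinct : Prop) (P : (S : MarkedMap) → List S.Dart → ℝ≥0∞)
    {β : Type*} (K : (S : MarkedMap) → List S.Dart → β → ℝ≥0∞) (b : β) : ℝ≥0∞ :=
  ∑' c : IsoClass, mapLaw n m distinct c * ∑' γ : List c.out.Dart, P c.out γ * K c.out γ b

open Classical in
/-- The law of a random variable which is a function `f` of the map and of the random list. -/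
noncomputable def lawOf (n m : ℕ) (distinct : Prop) (P : (S : MarkedMap) → List S.Dart → ℝ≥0∞)
    {β : Type*} (f : (S : MarkedMap) → List S.Dart → β) (b : β) : ℝ≥0∞ :=
  jointLaw n m distinct P (fun S γ b' => if f S γ = b' then 1 else 0) b

end MarkedMap

/-! ### Cycles of permutations -/

/-! For a set C of vertices let τ(C) be the number of spanning forests rooted at C (`forestCount`).
By the matrix-tree theorem (`det_lap`) this is the determinant of the Laplacian with identity rows
at C, so Cramer's rule turns ratios of such numbers into hitting probabilities. A partially unzipped
map whose polygon has vertex set C and whose tip is w receives the weight W = τ(C) · P(walk from the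
target t first hits C at w), called `tipWeight`. The theorem holds because both U_k(L) and U_k(D)
take each possible map with probability proportional to its weight W.

Loop-erased walk. Decomposing at the last visit to the starting point gives τ(A ∪ t) · P(a walk from
w, killed at A, reaches t with loop erasure eγ) = τ(A ∪ t ∪ w) · P(a walk from the end of e, killed
at A ∪ w, reaches t with loop erasure γ); see `forestCount_mul_lerwSum_cons`. These factors
telescope along the path: the number of spanning trees of M times the probability that L begins with
given edges is τ(A ∪ t) · P(walk from the tip w reaches t before A), where A consists of the
vertices visited before w. By reversibility (`forestCount_mul_tsum_lerwSum`) this equals τ(A ∪ w) ·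
P(walk from t hits A ∪ w at w). Unzipping changes nothing away from the path (`Away`), so the last
quantity is the weight W of the unzipped map. Conversely, a map with its tip on the polygon zips up
in exactly one way (`exists_isIso_of_unzip`, `exists_unzip_eq`), since rooted maps have no
automorphisms. Hence no multiplicities arise when one sums over isomorphism classes
(`classSum_isActive_peel`).

DLA. The harmonic measure of an edge e at the cluster satisfies τ(C) · h(e) = W(map with e
unzipped), by `forestCount_mul_walkSum`. As a function of the tip, W is τ(C) times harmonic measure.
Under the weights W the tip is therefore already distributed according to harmonic measure, given
the rest of the map, and resampling it changes nothing. After averaging over the tip, adding an edge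
anywhere at the polygon according to harmonic measure has the same effect as peeling at the tip
(`classSum_isActive_grow`). So the weights W are propagated by DLA as well.

Both processes stop when the target is reached, after at most m + 1 steps. Unzipping everything is
thus the case k = m + 1, and the number of steps is half the length of the final polygon. -/

theorem Equiv.Perm.SameCycle.lift {α : Type*} {f : Perm α} {r : α → α → Prop} (hr : Equivalence r)
    {a b : α} (h : ∀ y, f.SameCycle a y → r y (f y)) (hab : f.SameCycle a b) : r a b := by
  obtain ⟨i, rfl⟩ := hab
  induction i using Int.induction_on with
  | zero => simpa using hr.refl a
  | succ i ih =>
    refine hr.trans ih ?_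
    have := h ((f ^ (i : ℤ)) a) ⟨i, Eq.refl _⟩
    rwa [← Equiv.Perm.mul_apply, ← zpow_one_add, add_comm] at this
  | pred i ih =>
    refine hr.trans ih (hr.symm ?_)
    have := h ((f ^ (-(i : ℤ) - 1)) a) ⟨_, Eq.refl _⟩
    rwa [← Equiv.Perm.mul_apply, ← zpow_one_add, add_sub_cancel] at this

theorem Equiv.Perm.sameCycle_iff_exists_pow {α : Type*} [Finite α] {f : Perm α} {a b : α} :
    f.SameCycle a b ↔ ∃ i : ℕ, (f ^ i) a = b := by
  constructor
  · intro h
    obtain ⟨i, -, h⟩ := h.exists_pow_eq'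
    exact ⟨i, h⟩
  · rintro ⟨i, h⟩
    exact ⟨i, by simpa using h⟩

section Swap

variable {α : Type*} [DecidableEq α] {f : Perm α} {a b c d : α}

/-- The swap only redirects the steps of `f` that land in `a` or `b`, so it can connect nothing
beyond the cycles of these two points. -/
theorem Equiv.Perm.SameCycle.of_swap_mul (h : (Equiv.swap a b * f).SameCycle c d) :
    f.SameCycle c d ∨
      ((f.SameCycle c a ∨ f.SameCycle c b) ∧ (f.SameCycle d a ∨ f.SameCycle d b)) := by
  refine Equiv.Perm.SameCycle.lift (r := fun c d => f.SameCycle c d ∨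
      ((f.SameCycle c a ∨ f.SameCycle c b) ∧ (f.SameCycle d a ∨ f.SameCycle d b)))
      ⟨fun x => Or.inl (Perm.SameCycle.refl _ _), ?_, ?_⟩ ?_ h
  · rintro x y (h | h)
    · exact Or.inl h.symm
    · exact Or.inr ⟨h.2, h.1⟩
  · rintro x y z (h | h) (k | k)
    · exact Or.inl (h.trans k)
    · exact Or.inr ⟨k.1.imp h.trans h.trans, k.2⟩
    · exact Or.inr ⟨h.1, h.2.imp k.symm.trans k.symm.trans⟩
    · exact Or.inr ⟨h.1, k.2⟩
  · intro y _
    have hy : f.SameCycle y (f y) := Perm.sameCycle_apply_right.2 (Perm.SameCycle.refl _ _)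
    rw [Equiv.Perm.mul_apply]
    by_cases h1 : f y = a
    · rw [h1, Equiv.swap_apply_left]
      exact Or.inr ⟨Or.inl (h1 ▸ hy), Or.inr (Perm.SameCycle.refl _ _)⟩
    by_cases h2 : f y = b
    · rw [h2, Equiv.swap_apply_right]
      exact Or.inr ⟨Or.inr (h2 ▸ hy), Or.inl (Perm.SameCycle.refl _ _)⟩
    rw [Equiv.swap_apply_of_ne_of_ne h1 h2]
    exact Or.inl hy

theorem Equiv.Perm.sameCycle_swap_mul [Finite α] (h : ¬ f.SameCycle a b) :
    (Equiv.swap a b * f).SameCycle a b := by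
  by_contra hab
  set g := Equiv.swap a b * f with hg
  -- The `f`-orbit of `a` never meets `b`, so `g` follows it until it returns to `a`; at that moment
  -- `g` would move to `b` instead, which is excluded by assumption. Hence `g` reaches `f⁻¹ a`,
  -- whose image under `g` is `b` after all.
  have key : ∀ k : ℕ, g.SameCycle a ((f ^ k) a) := by
    intro k
    induction k with
    | zero => simpa using Perm.SameCycle.refl _ _
    | succ k ih =>
      have h1 : f ((f ^ k) a) ≠ b := fun h1 => h ⟨(k + 1 : ℕ), by
        rw [zpow_natCast, pow_succ', Equiv.Perm.mul_apply, h1]⟩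
      have h2 : g ((f ^ k) a) = Equiv.swap a b (f ((f ^ k) a)) := by simp [hg]
      have h4 : g.SameCycle a (g ((f ^ k) a)) := by simpa using ih
      have h3 : f ((f ^ k) a) ≠ a := by
        intro h3
        rw [h2, h3, Equiv.swap_apply_left] at h4
        exact hab h4
      rw [h2, Equiv.swap_apply_of_ne_of_ne h3 h1] at h4
      rwa [pow_succ', Equiv.Perm.mul_apply]
  have : f.SameCycle a (f⁻¹ a) := ⟨-1, by simp⟩
  obtain ⟨k, hk⟩ := Equiv.Perm.sameCycle_iff_exists_pow.1 this
  have h1 : g.SameCycle a (f⁻¹ a) := hk ▸ key k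
  have h2 : g (f⁻¹ a) = b := by simp [hg]
  apply hab
  rw [← h2]
  simpa using h1

theorem Equiv.Perm.not_sameCycle_swap_mul [Finite α] (hab : a ≠ b) (h : f.SameCycle a b) :
    ¬ (Equiv.swap a b * f).SameCycle a b := by
  set g := Equiv.swap a b * f with hg
  have hex : ∃ k : ℕ, (f ^ k) b = a := Equiv.Perm.sameCycle_iff_exists_pow.1 h.symm
  classical
  let k := Nat.find hex
  have hk : (f ^ k) b = a := Nat.find_spec hex
  have hmin : ∀ i < k, (f ^ i) b ≠ a := fun i hi => Nat.find_min hex hi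
  have hk0 : k ≠ 0 := by
    intro h0
    rw [h0] at hk
    exact hab (by simpa using hk.symm)
  -- `k` is the first time at which `f` leads from `b` to `a`. There `g` jumps back to `b`, so the
  -- `g`-orbit of `b` stays on the arc before `a`.
  have inv : ∀ j : ℕ, ∃ i < k, (g ^ j) b = (f ^ i) b := by
    intro j
    induction j with
    | zero => exact ⟨0, by omega, by simp⟩
    | succ j ih =>
      obtain ⟨i, hi, e⟩ := ih
      have e1 : (g ^ (j + 1)) b = Equiv.swap a b ((f ^ (i + 1)) b) := by
        rw [pow_succ', Equiv.Perm.mul_apply, e, hg, Equiv.Perm.mul_apply, pow_succ',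
          Equiv.Perm.mul_apply]
      rcases Nat.lt_or_ge (i + 1) k with hlt | hge
      · refine ⟨i + 1, hlt, ?_⟩
        rw [e1, Equiv.swap_apply_of_ne_of_ne (hmin _ hlt)]
        intro hb
        have : (f ^ (k - (i + 1))) b = a := by
          rw [← hk]
          conv_rhs => rw [show k = k - (i + 1) + (i + 1) by omega, pow_add,
            Equiv.Perm.mul_apply, hb]
        exact hmin _ (by omega) this
      · have : i + 1 = k := by omega
        refine ⟨0, by omega, ?_⟩
        rw [e1, this, hk]
        simp
  intro hc
  obtain ⟨j, hj⟩ := Equiv.Perm.sameCycle_iff_exists_pow.1 hc.symm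
  obtain ⟨i, hi, e⟩ := inv j
  exact hmin i hi (e ▸ hj)

/-- Since `f` arises from the product by the same swap, `of_swap_mul` applies in the other
direction: whatever `f` joins in addition is joined through `a` and `b`, and these are already in
one cycle of the product. -/
theorem Equiv.Perm.SameCycle.swap_mul [Finite α] (h : ¬ f.SameCycle a b) (hcd : f.SameCycle c d) :
    (Equiv.swap a b * f).SameCycle c d := by
  have hab := Equiv.Perm.sameCycle_swap_mul h
  have e : f = Equiv.swap a b * (Equiv.swap a b * f) := by
    rw [← mul_assoc, Equiv.swap_mul_self, one_mul]
  rw [e] at hcd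
  rcases hcd.of_swap_mul with h1 | ⟨h1 | h1, h2 | h2⟩
  · exact h1
  · exact h1.trans h2.symm
  · exact (h1.trans hab).trans h2.symm
  · exact (h1.trans hab.symm).trans h2.symm
  · exact h1.trans h2.symm

end Swap

/-! ### Numbers of cycles: swaps, disjoint sums, conjugation -/

namespace MarkedMap

/-- Two cycles merge and the others persist. Leaving out the cycle of `b` makes the passage from the
old cycles to the new ones a bijection. -/
theorem numCycles_swap_mul {α : Type} [DecidableEq α] [Finite α] {f : Perm α} {a b : α}
    (h : ¬ f.SameCycle a b) : numCycles (Equiv.swap a b * f) + 1 = numCycles f := by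
  classical
  set g := Equiv.swap a b * f with hg
  have hab : g.SameCycle a b := Equiv.Perm.sameCycle_swap_mul h
  let qb : Quotient (Perm.SameCycle.setoid f) := Quotient.mk _ b
  have key : Nat.card {q : Quotient (Perm.SameCycle.setoid f) // q ≠ qb} =
      Nat.card (Quotient (Perm.SameCycle.setoid g)) := by
    let F : Quotient (Perm.SameCycle.setoid f) → Quotient (Perm.SameCycle.setoid g) :=
      Quotient.map id fun c d hcd => Equiv.Perm.SameCycle.swap_mul h hcd
    refine Nat.card_congr (Equiv.ofBijective (fun q => F q.1) ⟨?_, ?_⟩)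
    · rintro ⟨q, hq⟩ ⟨q', hq'⟩ e
      induction q using Quotient.inductionOn with | _ c
      induction q' using Quotient.inductionOn with | _ d
      have hc : ¬ f.SameCycle c b := fun hc => hq (Quotient.sound hc)
      have hd : ¬ f.SameCycle d b := fun hd => hq' (Quotient.sound hd)
      have hcd : g.SameCycle c d := Quotient.exact e
      apply Subtype.ext
      apply Quotient.sound
      rcases hcd.of_swap_mul with h1 | ⟨h1 | h1, h2 | h2⟩
      · exact h1
      · exact h1.trans h2.symm
      · exact absurd h2 hd
      · exact absurd h1 hc
      · exact absurd h1 hc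
    · intro q
      induction q using Quotient.inductionOn with | _ d
      by_cases hd : f.SameCycle d b
      · refine ⟨⟨Quotient.mk _ a, fun e => h (Quotient.exact e)⟩, ?_⟩
        exact Quotient.sound (hab.trans (Equiv.Perm.SameCycle.swap_mul h hd.symm))
      · exact ⟨⟨Quotient.mk _ d, fun e => hd (Quotient.exact e)⟩, rfl⟩
  rw [numCycles, ← key, numCycles]
  have : Finite (Quotient (Perm.SameCycle.setoid f)) := inferInstance
  have := Fintype.ofFinite (Quotient (Perm.SameCycle.setoid f))
  rw [Nat.card_eq_fintype_card, Nat.card_eq_fintype_card, Fintype.card_subtype_compl]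
  have : 0 < Fintype.card (Quotient (Perm.SameCycle.setoid f)) := Fintype.card_pos_iff.2 ⟨qb⟩
  simp
  omega

theorem numCycles_swap_mul_of_sameCycle {α : Type} [DecidableEq α] [Finite α] {f : Perm α} {a b : α}
    (hab : a ≠ b) (h : f.SameCycle a b) : numCycles (Equiv.swap a b * f) = numCycles f + 1 := by
  have := numCycles_swap_mul (Equiv.Perm.not_sameCycle_swap_mul hab h)
  rw [← mul_assoc, Equiv.swap_mul_self, one_mul] at this
  exact this.symm

theorem sumCongr_zpow_inl {α β : Type*} (f : Perm α) (g : Perm β) (i : ℤ) (a : α) :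
    ((Perm.sumCongr f g) ^ i) (Sum.inl a) = Sum.inl ((f ^ i) a) := by
  have : (Perm.sumCongr f g) ^ i = Perm.sumCongr (f ^ i) (g ^ i) :=
    (map_zpow (Perm.sumCongrHom α β) (f, g) i).symm
  rw [this]
  simp

theorem sumCongr_zpow_inr {α β : Type*} (f : Perm α) (g : Perm β) (i : ℤ) (a : β) :
    ((Perm.sumCongr f g) ^ i) (Sum.inr a) = Sum.inr ((g ^ i) a) := by
  have : (Perm.sumCongr f g) ^ i = Perm.sumCongr (f ^ i) (g ^ i) :=
    (map_zpow (Perm.sumCongrHom α β) (f, g) i).symm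
  rw [this]
  simp

section
variable {α β : Type*} {f : Perm α} {g : Perm β}

@[simp] theorem sameCycle_sumCongr_inl {a b : α} :
    (Perm.sumCongr f g).SameCycle (Sum.inl a) (Sum.inl b) ↔ f.SameCycle a b := by
  simp [Perm.SameCycle, sumCongr_zpow_inl]

@[simp] theorem sameCycle_sumCongr_inr {a b : β} :
    (Perm.sumCongr f g).SameCycle (Sum.inr a) (Sum.inr b) ↔ g.SameCycle a b := by
  simp [Perm.SameCycle, sumCongr_zpow_inr]

@[simp] theorem not_sameCycle_sumCongr_inl_inr {a : α} {b : β} :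
    ¬ (Perm.sumCongr f g).SameCycle (Sum.inl a) (Sum.inr b) := by
  simp [Perm.SameCycle, sumCongr_zpow_inl]

@[simp] theorem not_sameCycle_sumCongr_inr_inl {a : β} {b : α} :
    ¬ (Perm.sumCongr f g).SameCycle (Sum.inr a) (Sum.inl b) := by
  simp [Perm.SameCycle, sumCongr_zpow_inr]

end

theorem numCycles_sumCongr {α β : Type} [Finite α] [Finite β] (f : Perm α) (g : Perm β) :
    numCycles (Perm.sumCongr f g) = numCycles f + numCycles g := by
  rw [numCycles, numCycles, numCycles, ← Nat.card_sum]
  symm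
  refine Nat.card_congr (Equiv.ofBijective (Sum.elim
    (Quotient.map Sum.inl fun c d hcd => sameCycle_sumCongr_inl.2 hcd)
    (Quotient.map Sum.inr fun c d hcd => sameCycle_sumCongr_inr.2 hcd)) ⟨?_, ?_⟩)
  · rintro (q | q) (q' | q') e <;>
      induction q using Quotient.inductionOn <;> induction q' using Quotient.inductionOn
    · exact congrArg Sum.inl (Quotient.sound (sameCycle_sumCongr_inl.1 (Quotient.exact e)))
    · exact absurd (Quotient.exact e) not_sameCycle_sumCongr_inl_inr
    · exact absurd (Quotient.exact e) not_sameCycle_sumCongr_inr_inl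
    · exact congrArg Sum.inr (Quotient.sound (sameCycle_sumCongr_inr.1 (Quotient.exact e)))
  · intro q
    induction q using Quotient.inductionOn with | _ d
    rcases d with d | d
    · exact ⟨Sum.inl (Quotient.mk _ d), rfl⟩
    · exact ⟨Sum.inr (Quotient.mk _ d), rfl⟩

theorem numCycles_one (α : Type) : numCycles (1 : Perm α) = Nat.card α := by
  refine (Nat.card_congr (Equiv.ofBijective (Quotient.mk (Perm.SameCycle.setoid (1 : Perm α)))
    ⟨fun a b h => ?_, Quotient.mk_surjective⟩)).symm
  exact Perm.sameCycle_one.1 (Quotient.exact h)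

theorem numCycles_swap_false_true : numCycles (Equiv.swap false true) = 1 := by
  have : numCycles (Equiv.swap false true * (1 : Perm Bool)) + 1 = numCycles (1 : Perm Bool) :=
    numCycles_swap_mul (by simp [Perm.sameCycle_one])
  rw [mul_one, numCycles_one] at this
  simpa using this

theorem numCycles_permCongr {α β : Type} (φ : α ≃ β) {f : Perm α} {g : Perm β}
    (h : ∀ a, φ (f a) = g (φ a)) : numCycles f = numCycles g := by
  have hz : ∀ (i : ℤ) a, φ ((f ^ i) a) = (g ^ i) (φ a) := by
    intro i a
    have hc : g = φ.permCongr f := by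
      ext x
      simp [Equiv.permCongr_apply, h]
    have hp : g ^ i = φ.permCongr (f ^ i) := by
      rw [hc]
      exact (map_zpow (φ.permCongrHom) f i).symm
    rw [hp, Equiv.permCongr_apply, Equiv.symm_apply_apply]
  refine Nat.card_congr (Quotient.congr φ fun a b => ?_)
  show f.SameCycle a b ↔ g.SameCycle (φ a) (φ b)
  simp only [Perm.SameCycle, ← hz, EmbeddingLike.apply_eq_iff_eq]

end MarkedMap

namespace MarkedMap

/-! ### Rooted spanning forests and the matrix-tree theorem -/

/-- The vertices of a map. -/
abbrev Vert (S : MarkedMap) : Type := Quotient (Perm.SameCycle.setoid S.rot)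

/-- The origin of a dart. -/
def org (S : MarkedMap) (d : S.Dart) : S.Vert := Quotient.mk _ d

/-- The darts that start at a vertex in `C`. -/
def dartsAt (S : MarkedMap) (C : Set S.Vert) : Set S.Dart := {d | S.org d ∈ C}

theorem org_eq_org {S : MarkedMap} {a b : S.Dart} : S.org a = S.org b ↔ S.SameVertex a b :=
  ⟨fun h => Quotient.exact h, fun h => Quotient.sound h⟩

@[simp] theorem mem_dartsAt {S : MarkedMap} {C : Set S.Vert} {d : S.Dart} :
    d ∈ S.dartsAt C ↔ S.org d ∈ C := Iff.rfl

theorem org_surjective (S : MarkedMap) : Function.Surjective S.org := Quotient.mk_surjective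

@[simp] theorem org_out {S : MarkedMap} (v : S.Vert) : S.org v.out = v := Quotient.out_eq v

theorem SameVertex.rfl {S : MarkedMap} {a : S.Dart} : S.SameVertex a a := Perm.SameCycle.refl _ _

theorem SameVertex.symm {S : MarkedMap} {a b : S.Dart} (h : S.SameVertex a b) :
    S.SameVertex b a := Perm.SameCycle.symm h

theorem SameVertex.trans {S : MarkedMap} {a b c : S.Dart} (h : S.SameVertex a b)
    (k : S.SameVertex b c) : S.SameVertex a c := Perm.SameCycle.trans h k

/-- Following darts of `T`, one gets from the origin of the given dart to `C`. -/
inductive LeadsTo (S : MarkedMap) (C T : Set S.Dart) : S.Dart → Prop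
  | base {a : S.Dart} (h : a ∈ C) : LeadsTo S C T a
  | step {a d : S.Dart} (had : S.SameVertex a d) (hd : d ∈ T) (h : LeadsTo S C T (S.rev d)) :
      LeadsTo S C T a

/-- `T` is a spanning forest rooted at `C`, directed towards the roots: it has one dart at each
vertex outside `C`, and following the darts one gets to `C`. -/
structure IsRootedForest (S : MarkedMap) (C T : Set S.Dart) : Prop where
  notMem : ∀ d ∈ T, d ∉ C
  existsUnique : ∀ a ∉ C, ∃! d, d ∈ T ∧ S.SameVertex a d
  leadsTo : ∀ a, S.LeadsTo C T a

/-- The number of spanning forests rooted at `C`. -/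
noncomputable def forestCount (S : MarkedMap) (C : Set S.Dart) : ℕ :=
  Nat.card {T : Set S.Dart // S.IsRootedForest C T}

theorem LeadsTo.of_sameVertex {S : MarkedMap} {C : Set S.Vert} {T : Set S.Dart} {a b : S.Dart}
    (h : S.LeadsTo (S.dartsAt C) T a) (hab : S.SameVertex a b) : S.LeadsTo (S.dartsAt C) T b := by
  cases h with
  | base h =>
    refine .base ?_
    rw [mem_dartsAt, ← org_eq_org.2 hab]
    exact h
  | step had hd h => exact .step (hab.symm.trans had) hd h

/-- The Laplacian of a map, with the rows of the vertices in `C` replaced by those of the identity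
matrix. -/
noncomputable def lap (S : MarkedMap) [Fintype S.Dart] (C : Set S.Vert) :
    Matrix S.Vert S.Vert ℝ :=
  open Classical in
  fun v => if v ∈ C then Pi.single v 1
    else ∑ d : S.Dart with S.org d = v, (Pi.single v 1 - Pi.single (S.org (S.rev d)) 1)

section

variable {S : MarkedMap} [Fintype S.Dart] [Fintype S.Vert]

open Classical in
theorem lap_mulVec (C : Set S.Vert) (g : S.Vert → ℝ) (v : S.Vert) :
    (S.lap C).mulVec g v = if v ∈ C then g v
      else ∑ d : S.Dart with S.org d = v, (g v - g (S.org (S.rev d))) := by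
  rw [Matrix.mulVec, lap]
  split_ifs with h
  · simp
  · rw [sum_dotProduct]
    refine Finset.sum_congr rfl fun d _ => ?_
    rw [sub_dotProduct]
    simp

omit [Fintype S.Vert] in
open Classical in
theorem lap_insert (C : Set S.Vert) (u : S.Vert) :
    S.lap (insert u C) = (S.lap C).updateRow u (Pi.single u 1) := by
  ext v w
  rw [Matrix.updateRow_apply]
  split_ifs with h
  · subst h
    simp [lap]
  · simp [lap, h]

-- One more root means one more unit row, and replacing a row by a unit row is how the diagonal
-- entry of the adjugate is defined.
open Classical in
theorem det_lap_insert (C : Set S.Vert) (u : S.Vert) :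
    (S.lap (insert u C)).det = (S.lap C).adjugate u u := by
  rw [lap_insert, Matrix.adjugate_apply]

-- Cramer's rule for a point source, in a form that needs no invertibility.
open Classical in
theorem det_mul_of_lap_mulVec {C : Set S.Vert} {g : S.Vert → ℝ} {u : S.Vert} {c : ℝ}
    (h : (S.lap C).mulVec g = Pi.single u c) (v : S.Vert) :
    (S.lap C).det * g v = c * (S.lap C).adjugate v u := by
  have := congrFun (congrArg ((S.lap C).adjugate.mulVec) h) v
  rw [Matrix.mulVec_mulVec, Matrix.adjugate_mul, Matrix.smul_mulVec, Matrix.one_mulVec] at this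
  rw [Pi.smul_apply, smul_eq_mul] at this
  rw [this, Matrix.mulVec_single]
  simp [mul_comm]

/-- The darts that a choice of one dart for each vertex picks at the vertices outside `C`. -/
def pickSet (C : Set S.Vert) (r : S.Vert → S.Dart) : Set S.Dart := {d | ∃ v, v ∉ C ∧ r v = d}

open Classical in
/-- The rows of the matrix of a function graph. -/
noncomputable def pickRow (C : Set S.Vert) (v : S.Vert) (d : S.Dart) : S.Vert → ℝ :=
  if v ∈ C then Pi.single v 1 else Pi.single v 1 - Pi.single (S.org (S.rev d)) 1

open Classical in
/-- The darts that may be picked at a vertex. -/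
noncomputable def picks (C : Set S.Vert) (v : S.Vert) : Finset S.Dart :=
  if v ∈ C then {v.out} else Finset.univ.filter fun d => S.org d = v

-- The determinant is multilinear in the rows, and a Laplacian row is a sum over the darts at its
-- vertex. Expanding all rows leaves one summand for each choice of a dart per vertex; at `C` the
-- choice is a dummy.
open Classical in
theorem det_lap_eq_sum (C : Set S.Vert) :
    (S.lap C).det = ∑ r ∈ Fintype.piFinset (picks C),
      Matrix.det (Matrix.of fun v => pickRow C v (r v)) := by
  have : S.lap C = fun v => ∑ d ∈ picks C v, pickRow C v d := by
    funext v
    rw [lap, picks]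
    split_ifs with h
    · simp [pickRow, h]
    · exact Finset.sum_congr rfl fun d _ => by simp [pickRow, h]
  rw [this]
  exact MultilinearMap.map_sum_finset (Matrix.detRowAlternating (R := ℝ)).toMultilinearMap _ _

variable {C : Set S.Vert} {r : S.Vert → S.Dart}

open Classical in
theorem org_pick (hr : r ∈ Fintype.piFinset (picks C)) (v : S.Vert) : S.org (r v) = v := by
  have := Fintype.mem_piFinset.1 hr v
  rw [picks] at this
  split_ifs at this with h
  · rw [Finset.mem_singleton.1 this, org_out]
  · simpa using this

open Classical in
theorem leadsTo_pick_iff (hr : r ∈ Fintype.piFinset (picks C)) (a : S.Dart) (ha : S.org a ∉ C) :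
    S.LeadsTo (S.dartsAt C) (pickSet C r) a ↔
      S.LeadsTo (S.dartsAt C) (pickSet C r) (S.rev (r (S.org a))) := by
  constructor
  · intro h
    cases h with
    | base h => exact absurd h ha
    | step had hd h =>
      obtain ⟨v, hv, rfl⟩ := hd
      have : S.org a = v := by rw [org_eq_org.2 had, org_pick hr]
      rwa [this]
  · intro h
    exact .step (org_eq_org.1 (org_pick hr _).symm) ⟨_, ha, rfl⟩ h

omit [Fintype S.Dart] in
open Classical in
theorem mulVec_pick (x : S.Vert → ℝ) (v : S.Vert) :
    (Matrix.of fun v => pickRow C v (r v)).mulVec x v =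
      if v ∈ C then x v else x v - x (S.org (S.rev (r v))) := by
  show dotProduct (pickRow C v (r v)) x = _
  rw [pickRow]
  split_ifs with h
  · simp
  · rw [sub_dotProduct]
    simp

-- If the choice has a circuit that misses `C`, the indicator function of the vertices that do not
-- lead to `C` lies in the kernel.
open Classical in
theorem det_pick_of_not_leadsTo (hr : r ∈ Fintype.piFinset (picks C)) (a : S.Dart)
    (ha : ¬ S.LeadsTo (S.dartsAt C) (pickSet C r) a) :
    Matrix.det (Matrix.of fun v => pickRow C v (r v)) = 0 := by
  rw [← Matrix.exists_mulVec_eq_zero_iff]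
  let x : S.Vert → ℝ := fun v => if S.LeadsTo (S.dartsAt C) (pickSet C r) v.out then 0 else 1
  have hx : ∀ b, x (S.org b) = if S.LeadsTo (S.dartsAt C) (pickSet C r) b then 0 else 1 := by
    intro b
    have : S.SameVertex (S.org b).out b := org_eq_org.1 (by simp)
    have : S.LeadsTo (S.dartsAt C) (pickSet C r) (S.org b).out ↔
        S.LeadsTo (S.dartsAt C) (pickSet C r) b :=
      ⟨fun h => h.of_sameVertex this, fun h => h.of_sameVertex this.symm⟩
    simp only [x, this]
  refine ⟨x, fun h => ?_, ?_⟩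
  · have := hx a
    rw [h, if_neg ha] at this
    simp at this
  · funext v
    rw [mulVec_pick]
    obtain ⟨b, rfl⟩ := S.org_surjective v
    split_ifs with h
    · rw [hx, if_pos (.base h)]
      rfl
    · rw [hx, hx]
      simp only [leadsTo_pick_iff hr b h, sub_self]
      rfl

-- Following the picks strictly approaches `C`, so the matrix is `1 - N` with `N` nilpotent.
open Classical in
theorem det_pick_of_leadsTo (hr : r ∈ Fintype.piFinset (picks C))
    (ha : ∀ a, S.LeadsTo (S.dartsAt C) (pickSet C r) a) :
    Matrix.det (Matrix.of fun v => pickRow C v (r v)) = 1 := by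
  set N : Matrix S.Vert S.Vert ℝ := 1 - Matrix.of fun v => pickRow C v (r v) with hN
  have hNv : ∀ x v, N.mulVec x v = if v ∈ C then 0 else x (S.org (S.rev (r v))) := by
    intro x v
    rw [hN, Matrix.sub_mulVec, Pi.sub_apply, mulVec_pick, Matrix.one_mulVec]
    split_ifs <;> ring
  -- Each application of `N` moves one step along the forest and gives zero at `C`. The claim covers
  -- all exponents `l ≥ k` so that one exponent can serve all vertices.
  have hnil : ∀ a, ∃ k, ∀ x l, k ≤ l → ((N ^ l).mulVec x) (S.org a) = 0 := by
    intro a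
    induction ha a with
    | @base a h =>
      refine ⟨1, fun x l hl => ?_⟩
      obtain ⟨l, rfl⟩ : ∃ j, l = j + 1 := ⟨l - 1, by omega⟩
      rw [pow_succ', ← Matrix.mulVec_mulVec, hNv, if_pos (mem_dartsAt.1 h)]
    | @step a d had hd h ih =>
      obtain ⟨k, hk⟩ := ih
      refine ⟨k + 1, fun x l hl => ?_⟩
      obtain ⟨l, rfl⟩ : ∃ j, l = j + 1 := ⟨l - 1, by omega⟩
      obtain ⟨v, hv, rfl⟩ := hd
      have hav : S.org a = v := by rw [org_eq_org.2 had, org_pick hr]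
      rw [pow_succ', ← Matrix.mulVec_mulVec, hNv, hav, if_neg hv]
      exact hk x l (by omega)
  choose k hk using hnil
  obtain ⟨K, hK⟩ : ∃ K, ∀ a, k a ≤ K := by
    refine ⟨∑ a, k a, fun a => Finset.single_le_sum (fun _ _ => Nat.zero_le _) (Finset.mem_univ a)⟩
  have hNK : IsNilpotent N := by
    refine ⟨K, ?_⟩
    ext v w
    obtain ⟨a, rfl⟩ := S.org_surjective v
    have := hk a (Pi.single w 1) K (hK a)
    rw [Matrix.mulVec_single_one] at this
    simpa using this
  -- The characteristic polynomial of a nilpotent matrix is a power of `X`; its value at 1 is both 1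
  -- and `det (1 - N)`.
  have h1 : N.charpoly = Polynomial.X ^ Fintype.card S.Vert := by
    have := Matrix.isNilpotent_charpoly_sub_pow_of_isNilpotent hNK
    exact sub_eq_zero.1 this.eq_zero
  have h2 := Matrix.eval_charpoly N 1
  rw [h1] at h2
  simp only [Polynomial.eval_pow, Polynomial.eval_X, one_pow] at h2
  rw [h2, hN]
  congr 1
  simp

open Classical in
/-- The matrix-tree theorem: the determinant of the reduced Laplacian counts rooted forests. -/
theorem det_lap (C : Set S.Vert) : (S.lap C).det = S.forestCount (S.dartsAt C) := by
  have key : (S.lap C).det = (((Fintype.piFinset (picks C)).filter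
      fun r => ∀ a, S.LeadsTo (S.dartsAt C) (pickSet C r) a).card : ℝ) := by
    rw [det_lap_eq_sum, Finset.card_filter, Nat.cast_sum]
    refine Finset.sum_congr rfl fun r hr => ?_
    split_ifs with h
    · rw [det_pick_of_leadsTo hr h, Nat.cast_one]
    · push Not at h
      obtain ⟨a, ha⟩ := h
      rw [det_pick_of_not_leadsTo hr a ha, Nat.cast_zero]
  rw [key, forestCount, ← Nat.card_eq_finsetCard]
  congr 1
  have hf : ∀ r ∈ (Fintype.piFinset (picks C)).filter
      (fun r => ∀ a, S.LeadsTo (S.dartsAt C) (pickSet C r) a),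
      S.IsRootedForest (S.dartsAt C) (pickSet C r) := by
    intro r hr
    rw [Finset.mem_filter] at hr
    refine ⟨?_, ?_, hr.2⟩
    · rintro d ⟨v, hv, rfl⟩
      rwa [mem_dartsAt, org_pick hr.1]
    · intro a ha
      refine ⟨r (S.org a), ⟨⟨_, ha, rfl⟩, org_eq_org.1 (org_pick hr.1 _).symm⟩, ?_⟩
      rintro d ⟨⟨v, hv, rfl⟩, hd⟩
      rw [org_eq_org.2 hd, org_pick hr.1]
  -- At `C` the pick is forced to be `v.out`, so a forest comes from exactly one choice.
  refine Nat.card_congr (Equiv.ofBijective (fun r => ⟨pickSet C r.1, hf r.1 r.2⟩) ⟨?_, ?_⟩)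
  · rintro ⟨r, hr⟩ ⟨r', hr'⟩ e
    have hr := (Finset.mem_filter.1 hr).1
    have hr' := (Finset.mem_filter.1 hr').1
    have e : pickSet C r = pickSet C r' := congrArg Subtype.val e
    apply Subtype.ext
    funext v
    by_cases hv : v ∈ C
    · have h1 := Fintype.mem_piFinset.1 hr v
      have h2 := Fintype.mem_piFinset.1 hr' v
      rw [picks, if_pos hv, Finset.mem_singleton] at h1 h2
      exact h1.trans h2.symm
    · have : r v ∈ pickSet C r' := e ▸ ⟨v, hv, rfl⟩
      obtain ⟨w, hw, h⟩ := this
      have : v = w := by rw [← org_pick hr v, ← h, org_pick hr']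
      rw [this] at h ⊢
      exact h.symm
  · rintro ⟨T, hT⟩
    have hex : ∀ v : S.Vert, ∃ d, S.org d = v ∧ (v ∈ C → d = v.out) ∧ (v ∉ C → d ∈ T) := by
      intro v
      by_cases hv : v ∈ C
      · exact ⟨v.out, org_out v, fun _ => rfl, fun h => absurd hv h⟩
      · obtain ⟨d, ⟨hd, hvd⟩, -⟩ := hT.existsUnique v.out (by simpa using hv)
        exact ⟨d, by rw [← org_eq_org.2 hvd, org_out], fun h => absurd h hv, fun _ => hd⟩
    choose r h1 h2 h3 using hex
    have hrT : pickSet C r = T := by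
      ext d
      constructor
      · rintro ⟨v, hv, rfl⟩
        exact h3 v hv
      · intro hd
        have hdC := hT.notMem d hd
        refine ⟨S.org d, hdC, ?_⟩
        exact (hT.existsUnique d hdC).unique ⟨h3 _ hdC, org_eq_org.1 (h1 _).symm⟩
          ⟨hd, SameVertex.rfl⟩
    refine ⟨⟨r, Finset.mem_filter.2 ⟨Fintype.mem_piFinset.2 fun v => ?_, ?_⟩⟩, Subtype.ext hrT⟩
    · rw [picks]
      split_ifs with hv
      · exact Finset.mem_singleton.2 (h2 v hv)
      · simpa using h1 v
    · rw [hrT]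
      exact hT.leadsTo

end

/-- A connected set of edges contains a rooted forest. -/
theorem exists_isRootedForest_subset {S : MarkedMap} {C : Set S.Vert} {T : Set S.Dart}
    (h : ∀ a, ∃ c ∈ S.dartsAt C, S.Joined T a c) : ∃ F ⊆ T, S.IsRootedForest (S.dartsAt C) F := by
  classical
  -- `R n v` says that `C` can be reached from `v` in exactly `n` steps along darts of `T`. The
  -- forest takes at each vertex a dart that lowers the distance `lev` to `C`.
  let R : ℕ → S.Vert → Prop := fun n => Nat.rec (fun v => v ∈ C)
    (fun _ P v => ∃ d ∈ T, S.org d = v ∧ P (S.org (S.rev d))) n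
  have hR : ∀ v, ∃ n, R n v := by
    intro v
    obtain ⟨a, rfl⟩ := S.org_surjective v
    obtain ⟨c, hc, hac⟩ := h a
    induction hac using Relation.ReflTransGen.head_induction_on with
    | refl => exact ⟨0, hc⟩
    | head hab _ ih =>
      obtain ⟨n, hn⟩ := ih
      rcases hab with hab | ⟨ha, rfl⟩
      · exact ⟨n, org_eq_org.2 hab ▸ hn⟩
      · exact ⟨n + 1, _, ha, rfl, hn⟩
  let lev : S.Vert → ℕ := fun v => sInf {n | R n v}
  have hstep : ∀ v, v ∉ C → ∃ d ∈ T, S.org d = v ∧ lev (S.org (S.rev d)) < lev v := by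
    intro v hv
    have h1 : R (lev v) v := Nat.sInf_mem (hR v)
    rcases hn : lev v with _ | n
    · rw [hn] at h1
      exact absurd h1 hv
    · rw [hn] at h1
      obtain ⟨d, hd, hdv, hr⟩ := h1
      exact ⟨d, hd, hdv, Nat.lt_succ_of_le (Nat.sInf_le hr)⟩
  choose r' h1' h2' h3' using hstep
  let r : S.Vert → S.Dart := fun v => if hv : v ∈ C then v.out else r' v hv
  have h1 : ∀ v, v ∉ C → r v ∈ T := fun v hv => by simp only [r, dif_neg hv]; exact h1' v hv
  have h2 : ∀ v, v ∉ C → S.org (r v) = v := fun v hv => by simp only [r, dif_neg hv]; exact h2' v hv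
  have h3 : ∀ v, v ∉ C → lev (S.org (S.rev (r v))) < lev v := fun v hv => by
    simp only [r, dif_neg hv]; exact h3' v hv
  refine ⟨{d | ∃ v, v ∉ C ∧ r v = d}, ?_, ?_, ?_, ?_⟩
  · rintro d ⟨v, hv, rfl⟩
    exact h1 v hv
  · rintro d ⟨v, hv, rfl⟩
    rwa [mem_dartsAt, h2 v hv]
  · intro a ha
    refine ⟨r (S.org a), ⟨⟨_, ha, rfl⟩, org_eq_org.1 (h2 _ ha).symm⟩, ?_⟩
    rintro d ⟨⟨v, hv, rfl⟩, hd⟩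
    rw [org_eq_org.2 hd, h2 v hv]
  · intro a
    induction hn : lev (S.org a) using Nat.strong_induction_on generalizing a with
    | _ n ih =>
      by_cases ha : S.org a ∈ C
      · exact .base ha
      · refine .step (org_eq_org.1 (h2 _ ha).symm) ⟨_, ha, rfl⟩ (ih _ ?_ _ rfl)
        rw [← hn]
        exact h3 _ ha

end MarkedMap

namespace MarkedMap

/-! ### Spanning trees and rooted forests -/

/-- A set of darts that avoids `C` and is closed under following `T` is a trap. -/
theorem LeadsTo.false_of_closed {S : MarkedMap} {C T : Set S.Dart} {a : S.Dart}
    (h : S.LeadsTo C T a) (P : S.Dart → Prop)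
    (hP : ∀ a, P a → a ∉ C ∧ ∀ d ∈ T, S.SameVertex a d → P (S.rev d)) : ¬ P a := by
  induction h with
  | base h => exact fun ha => (hP _ ha).1 h
  | step had hd h ih => exact fun ha => ih ((hP _ ha).2 _ hd had)

/-- If both halves of an edge belonged to the forest, following it would lead back and forth along
this edge forever. -/
theorem IsRootedForest.rev_notMem {S : MarkedMap} {C T : Set S.Dart} (h : S.IsRootedForest C T)
    (hC : ∀ a b, S.SameVertex a b → a ∈ C → b ∈ C)
    (hrev : ∀ d, S.rev (S.rev d) = d) {d : S.Dart} (hd : d ∈ T) : S.rev d ∉ T := by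
  intro hd'
  refine (h.leadsTo d).false_of_closed (fun a => S.SameVertex a d ∨ S.SameVertex a (S.rev d)) ?_
    (Or.inl SameVertex.rfl)
  rintro a (ha | ha)
  · have haC : a ∉ C := fun haC => h.notMem _ hd (hC _ _ ha haC)
    refine ⟨haC, fun e he hae => Or.inr ?_⟩
    rw [(h.existsUnique a haC).unique ⟨he, hae⟩ ⟨hd, ha⟩]
    exact SameVertex.rfl
  · have haC : a ∉ C := fun haC => h.notMem _ hd' (hC _ _ ha haC)
    refine ⟨haC, fun e he hae => Or.inl ?_⟩
    rw [(h.existsUnique a haC).unique ⟨he, hae⟩ ⟨hd', ha⟩, hrev]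
    exact SameVertex.rfl

theorem Joined.symm {S : MarkedMap} {T : Set S.Dart} (hrev : ∀ d, S.rev (S.rev d) = d)
    (hT : ∀ d ∈ T, S.rev d ∈ T) {a b : S.Dart} (h : S.Joined T a b) : S.Joined T b a := by
  induction h with
  | refl => exact .refl
  | tail _ h ih =>
    refine .head ?_ ih
    rcases h with h | ⟨h, rfl⟩
    · exact Or.inl h.symm
    · exact Or.inr ⟨hT _ h, (hrev _).symm⟩

/-- The edges of a set of darts. -/
def edgeSet (S : MarkedMap) (F : Set S.Dart) : Set S.Dart := {d | d ∈ F ∨ S.rev d ∈ F}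

theorem LeadsTo.joined {S : MarkedMap} {C T : Set S.Dart} {a : S.Dart} (h : S.LeadsTo C T a) :
    ∃ c ∈ C, S.Joined (S.edgeSet T) a c := by
  induction h with
  | base h => exact ⟨_, h, .refl⟩
  | step had hd h ih =>
    obtain ⟨c, hc, hj⟩ := ih
    exact ⟨c, hc, .head (Or.inl had) (.head (Or.inr ⟨Or.inl hd, rfl⟩) hj)⟩

theorem dartsAt_saturated {S : MarkedMap} (C : Set S.Vert) (a b : S.Dart) (h : S.SameVertex a b)
    (ha : a ∈ S.dartsAt C) : b ∈ S.dartsAt C := by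
  rw [mem_dartsAt, ← org_eq_org.2 h]
  exact ha

section

variable {S : MarkedMap} [Finite S.Dart] (hrev : ∀ d, S.rev (S.rev d) = d)

include hrev

/-- There is one forest dart at each vertex other than `v`, and reversing these darts gives as many
new ones. -/
theorem IsRootedForest.ncard_edgeSet {v : S.Vert} {F : Set S.Dart}
    (h : S.IsRootedForest (S.dartsAt {v}) F) :
    Nat.card (S.edgeSet F) + 2 = 2 * numCycles S.rot := by
  have h1 : S.edgeSet F = F ∪ S.rev '' F := by
    ext d
    refine or_congr Iff.rfl ⟨fun hd => ⟨_, hd, hrev d⟩, ?_⟩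
    rintro ⟨e, he, rfl⟩
    rwa [hrev]
  have hdisj : Disjoint F (S.rev '' F) := by
    rw [Set.disjoint_left]
    rintro d hd ⟨e, he, rfl⟩
    exact h.rev_notMem (dartsAt_saturated _) hrev he hd
  have hF : F.ncard = Nat.card {w : S.Vert // w ≠ v} := by
    rw [← Nat.card_coe_set_eq]
    refine Nat.card_congr (Equiv.ofBijective (fun d => ⟨S.org d.1, h.notMem d.1 d.2⟩) ⟨?_, ?_⟩)
    · rintro ⟨d, hd⟩ ⟨e, he⟩ hde
      have hde : S.org d = S.org e := congrArg Subtype.val hde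
      exact Subtype.ext ((h.existsUnique d (h.notMem d hd)).unique ⟨hd, SameVertex.rfl⟩
        ⟨he, org_eq_org.1 hde⟩)
    · rintro ⟨w, hw⟩
      obtain ⟨a, rfl⟩ := S.org_surjective w
      obtain ⟨d, ⟨hd, had⟩, -⟩ := h.existsUnique a hw
      exact ⟨⟨d, hd⟩, Subtype.ext (org_eq_org.2 had).symm⟩
  have hV : Nat.card {w : S.Vert // w ≠ v} + 1 = numCycles S.rot := by
    have := Fintype.ofFinite S.Vert
    classical
    have h2 : numCycles S.rot = Fintype.card S.Vert := by
      rw [numCycles, Nat.card_eq_fintype_card]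
    have h3 : 0 < Fintype.card S.Vert := Fintype.card_pos_iff.2 ⟨v⟩
    rw [h2, Nat.card_eq_fintype_card, Fintype.card_subtype_compl]
    simp
    omega
  rw [Nat.card_coe_set_eq, h1, Set.ncard_union_eq hdisj,
    Set.ncard_image_of_injective _ S.rev.injective, hF]
  omega

theorem IsRootedForest.isSpanningTree {v : S.Vert} {F : Set S.Dart}
    (h : S.IsRootedForest (S.dartsAt {v}) F) : S.IsSpanningTree (S.edgeSet F) := by
  have hsym : ∀ d ∈ S.edgeSet F, S.rev d ∈ S.edgeSet F := by
    rintro d (hd | hd)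
    · exact Or.inr ((hrev d).symm ▸ hd)
    · exact Or.inl hd
  refine ⟨hsym, fun a b => ?_, h.ncard_edgeSet hrev⟩
  obtain ⟨c, hc, hac⟩ := (h.leadsTo a).joined
  obtain ⟨c', hc', hbc⟩ := (h.leadsTo b).joined
  have hc : S.org c = v := hc
  have hc' : S.org c' = v := hc'
  have hcc : S.SameVertex c c' := org_eq_org.1 (hc.trans hc'.symm)
  exact hac.trans (.head (Or.inl hcc) (hbc.symm hrev hsym))

-- At a vertex where `F'` has a dart outside `F`, the reversal of this dart is in `F`. So the two
-- forests also differ at its other end, and following `F'` through such vertices never reaches `C`.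
omit [Finite S.Dart] in
theorem IsRootedForest.subset_of_edgeSet_eq {C : Set S.Vert} {F F' : Set S.Dart}
    (h : S.IsRootedForest (S.dartsAt C) F) (h' : S.IsRootedForest (S.dartsAt C) F')
    (e : S.edgeSet F = S.edgeSet F') : F' ⊆ F := by
  intro d hd
  by_contra hdF
  refine (h'.leadsTo d).false_of_closed
    (fun a => a ∉ S.dartsAt C ∧ ∃ d ∈ F', d ∉ F ∧ S.SameVertex a d) ?_
    ⟨h'.notMem _ hd, d, hd, hdF, SameVertex.rfl⟩
  rintro a ⟨ha, d, hd, hdF, had⟩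
  refine ⟨ha, fun d' hd' had' => ?_⟩
  rw [(h'.existsUnique a ha).unique ⟨hd', had'⟩ ⟨hd, had⟩]
  have hr : S.rev d ∈ F := by
    have : d ∈ S.edgeSet F := e ▸ Or.inl hd
    exact this.resolve_left hdF
  have hrC := h.notMem _ hr
  obtain ⟨d'', ⟨h1, h2⟩, -⟩ := h'.existsUnique _ hrC
  refine ⟨hrC, d'', h1, fun h3 => ?_, h2⟩
  have : d'' = S.rev d := (h.existsUnique _ hrC).unique ⟨h3, h2⟩ ⟨hr, SameVertex.rfl⟩
  exact h'.rev_notMem (dartsAt_saturated _) hrev hd (this ▸ h1)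

/-- A tree has exactly one orientation towards a given root, and the number of trees does not depend
on the root. Surjectivity holds because a rooted forest inside the tree already has as many edges as
the tree. -/
theorem numSpanningTrees_eq (v : S.Vert) :
    S.numSpanningTrees = S.forestCount (S.dartsAt {v}) := by
  symm
  refine Nat.card_congr (Equiv.ofBijective
    (fun F => ⟨S.edgeSet F.1, F.2.isSpanningTree hrev⟩) ⟨?_, ?_⟩)
  · rintro ⟨F, hF⟩ ⟨F', hF'⟩ e
    have e : S.edgeSet F = S.edgeSet F' := congrArg Subtype.val e
    exact Subtype.ext (Set.Subset.antisymm (hF'.subset_of_edgeSet_eq hrev hF e.symm)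
      (hF.subset_of_edgeSet_eq hrev hF' e))
  · rintro ⟨T, hT⟩
    obtain ⟨F, hFT, hF⟩ := exists_isRootedForest_subset (C := {v}) (T := T)
      fun a => ⟨v.out, by simp, hT.connected _ _⟩
    refine ⟨⟨F, hF⟩, Subtype.ext (Set.eq_of_subset_of_ncard_le ?_ ?_)⟩
    · rintro d (hd | hd)
      · exact hFT hd
      · exact hrev d ▸ hT.rev_mem _ (hFT hd)
    · have h1 := hF.ncard_edgeSet hrev
      have h2 := hT.card
      rw [Nat.card_coe_set_eq] at h1 h2
      show T.ncard ≤ (S.edgeSet F).ncard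
      omega

omit hrev in
theorem forestCount_pos {C : Set S.Vert} (hC : C.Nonempty)
    (hS : ∀ a b, S.Joined Set.univ a b) : 0 < S.forestCount (S.dartsAt C) := by
  obtain ⟨v, hv⟩ := hC
  obtain ⟨F, -, hF⟩ := exists_isRootedForest_subset (C := C) (T := Set.univ)
      fun a => ⟨v.out, by simpa using hv, hS _ _⟩
  exact Nat.card_pos_iff.2 ⟨⟨F, hF⟩, inferInstance⟩

end

end MarkedMap

/-- A sum over all lists, split according to the head of the list. -/
theorem ENNReal.tsum_list {α : Type*} (F : List α → ℝ≥0∞) :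
    ∑' ω, F ω = F [] + ∑' d, ∑' ω, F (d :: ω) := by
  classical
  rw [ENNReal.tsum_eq_add_tsum_ite [], ← ENNReal.tsum_prod]
  congr 1
  have hinj : Function.Injective fun p : α × List α => p.1 :: p.2 := by
    rintro ⟨a, l⟩ ⟨b, l'⟩ h
    simpa using h
  refine (hinj.tsum_eq ?_).symm.trans (tsum_congr fun p => if_neg (by simp))
  intro ω hω
  rcases ω with _ | ⟨d, ω⟩
  · simp at hω
  · exact ⟨(d, ω), rfl⟩

namespace MarkedMap

/-! ### Stopped random walk -/

/-- The dart at the end of a walk: the reversal of the last dart, or the initial dart. -/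
def endDart (S : MarkedMap) (a : S.Dart) (ω : List S.Dart) : S.Dart :=
  (ω.getLast?.map S.rev).getD a

open Classical in
/-- The expectation of a function of the final dart of simple random walk, stopped at `C`. -/
noncomputable def walkSum (S : MarkedMap) (C : Set S.Dart) (a : S.Dart) (f : S.Dart → ℝ≥0∞) :
    ℝ≥0∞ :=
  ∑' ω : List S.Dart, if S.IsStoppedWalk C a ω then S.walkWeight ω * f (S.endDart a ω) else 0

theorem endDart_cons (S : MarkedMap) (a d : S.Dart) (ω : List S.Dart) :
    S.endDart a (d :: ω) = S.endDart (S.rev d) ω := by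
  rw [endDart, endDart, List.getLast?_cons]
  rcases ω.getLast? with _ | b <;> rfl

@[simp] theorem walkWeight_nil (S : MarkedMap) : S.walkWeight [] = 1 := by simp [walkWeight]

theorem walkWeight_cons (S : MarkedMap) (d : S.Dart) (ω : List S.Dart) :
    S.walkWeight (d :: ω) = (S.deg d : ℝ≥0∞)⁻¹ * S.walkWeight ω := by simp [walkWeight]

variable {S : MarkedMap} {C : Set S.Dart} {a b : S.Dart} {f : S.Dart → ℝ≥0∞}

theorem isStoppedWalk_of_mem (ha : a ∈ C) {ω : List S.Dart} :
    S.IsStoppedWalk C a ω ↔ ω = [] := by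
  rcases ω with _ | ⟨d, ω⟩
  · simpa [IsStoppedWalk] using ha
  · simp [IsStoppedWalk, ha]

theorem walkSum_of_mem (ha : a ∈ C) : S.walkSum C a f = f a := by
  rw [walkSum, tsum_eq_single []]
  · simp [IsStoppedWalk, ha, endDart]
  · intro ω hω
    rw [if_neg (fun h => hω ((isStoppedWalk_of_mem ha).1 h))]

-- First-step analysis, for an arbitrary functional of the walk.
open Classical in
theorem tsum_isStoppedWalk (ha : a ∉ C) (F : List S.Dart → ℝ≥0∞) :
    ∑' ω : List S.Dart, (if S.IsStoppedWalk C a ω then S.walkWeight ω * F ω else 0) =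
      ∑' d, if S.SameVertex a d then (S.deg d : ℝ≥0∞)⁻¹ *
        ∑' ω : List S.Dart, (if S.IsStoppedWalk C (S.rev d) ω then
          S.walkWeight ω * F (d :: ω) else 0) else 0 := by
  rw [ENNReal.tsum_list]
  simp only [IsStoppedWalk, ha, if_false, zero_add, not_false_eq_true, true_and]
  congr 1
  funext d
  by_cases had : S.SameVertex a d
  · rw [if_pos had, ← ENNReal.tsum_mul_left]
    congr 1
    funext ω
    by_cases hω : S.IsStoppedWalk C (S.rev d) ω
    · rw [if_pos ⟨had, hω⟩, if_pos hω, walkWeight_cons, mul_assoc]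
    · rw [if_neg (fun h => hω h.2), if_neg hω, mul_zero]
  · simp [had]

open Classical in
theorem walkSum_of_notMem (ha : a ∉ C) : S.walkSum C a f =
    ∑' d, if S.SameVertex a d then (S.deg d : ℝ≥0∞)⁻¹ * S.walkSum C (S.rev d) f else 0 := by
  rw [walkSum, tsum_isStoppedWalk ha fun ω => f (S.endDart a ω)]
  simp only [endDart_cons, walkSum]

theorem deg_pos [Finite S.Dart] (a : S.Dart) : 0 < S.deg a :=
  Nat.card_pos_iff.2 ⟨⟨⟨a, SameVertex.rfl⟩⟩, inferInstance⟩

theorem deg_eq (h : S.SameVertex a b) : S.deg a = S.deg b :=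
  Nat.card_congr (Equiv.subtypeEquivRight fun _ => ⟨h.symm.trans, h.trans⟩)

open Classical in
theorem tsum_sameVertex_inv_deg [Finite S.Dart] (a : S.Dart) :
    ∑' d, (if S.SameVertex a d then (S.deg d : ℝ≥0∞)⁻¹ else 0) = 1 := by
  have := Fintype.ofFinite S.Dart
  have h1 : ∀ d, (if S.SameVertex a d then (S.deg d : ℝ≥0∞)⁻¹ else 0) =
      if S.SameVertex a d then (S.deg a : ℝ≥0∞)⁻¹ else 0 := by
    intro d
    split_ifs with h
    · rw [deg_eq h]
    · rfl
  simp only [h1]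
  rw [tsum_fintype, ← Finset.sum_filter, Finset.sum_const, nsmul_eq_mul]
  have h2 : (Finset.univ.filter fun d => S.SameVertex a d).card = S.deg a := by
    rw [deg, Nat.card_eq_fintype_card, Fintype.card_subtype]
  rw [h2]
  refine ENNReal.mul_inv_cancel ?_ (ENNReal.natCast_ne_top _)
  exact_mod_cast (deg_pos a).ne'

-- Total mass at most one is needed for finiteness before recurrence is available. Walks of bounded
-- length are treated by induction on the bound, and any finite family of walks has bounded length.
open Classical in
theorem walkSum_one_le [Finite S.Dart] (C : Set S.Dart) (a : S.Dart) :
    S.walkSum C a (fun _ => 1) ≤ 1 := by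
  have key : ∀ (N : ℕ) (a : S.Dart), ∑' ω : List S.Dart,
      (if ω.length ≤ N ∧ S.IsStoppedWalk C a ω then S.walkWeight ω else 0) ≤ 1 := by
    intro N
    induction N with
    | zero =>
      intro a
      rw [tsum_eq_single []]
      · split_ifs <;> simp
      · intro ω hω
        rw [if_neg]
        rintro ⟨h, -⟩
        exact hω (List.length_eq_zero_iff.1 (by omega))
    | succ N ih =>
      intro a
      by_cases ha : a ∈ C
      · rw [tsum_eq_single []]
        · split_ifs <;> simp
        · intro ω hω
          rw [if_neg]
          rintro ⟨-, h⟩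
          exact hω ((isStoppedWalk_of_mem ha).1 h)
      · rw [ENNReal.tsum_list]
        simp only [IsStoppedWalk, ha, and_false, if_false, zero_add]
        rw [← tsum_sameVertex_inv_deg a]
        refine ENNReal.tsum_le_tsum fun d => ?_
        by_cases had : S.SameVertex a d
        · rw [if_pos had]
          calc _ = (S.deg d : ℝ≥0∞)⁻¹ * ∑' ω : List S.Dart,
                (if ω.length ≤ N ∧ S.IsStoppedWalk C (S.rev d) ω then S.walkWeight ω else 0) := by
                rw [← ENNReal.tsum_mul_left]
                congr 1
                funext ω
                simp only [List.length_cons, Nat.add_le_add_iff_right, had, true_and,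
                  not_false_eq_true, walkWeight_cons]
                split_ifs <;> simp
            _ ≤ (S.deg d : ℝ≥0∞)⁻¹ * 1 := by gcongr; exact ih _
            _ = _ := mul_one _
        · simp [had]
  rw [walkSum, ENNReal.tsum_eq_iSup_sum]
  refine iSup_le fun s => ?_
  obtain ⟨N, hN⟩ : ∃ N, ∀ ω ∈ s, ω.length ≤ N :=
    ⟨s.sup List.length, fun ω hω => Finset.le_sup (f := List.length) hω⟩
  refine le_trans ?_ (key N a)
  refine le_trans (Finset.sum_le_sum (g := fun ω : List S.Dart =>
    if ω.length ≤ N ∧ S.IsStoppedWalk C a ω then S.walkWeight ω else 0) fun ω hω => ?_)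
    (ENNReal.sum_le_tsum s)
  simp [hN ω hω]

theorem walkSum_mono {g : S.Dart → ℝ≥0∞} (h : ∀ d, f d ≤ g d) :
    S.walkSum C a f ≤ S.walkSum C a g := by
  refine ENNReal.tsum_le_tsum fun ω => ?_
  split_ifs
  · gcongr
    exact h _
  · exact le_rfl

theorem walkSum_le_one [Finite S.Dart] (h : ∀ d, f d ≤ 1) : S.walkSum C a f ≤ 1 :=
  (walkSum_mono h).trans (walkSum_one_le C a)

theorem walkSum_congr_of_sameVertex (hab : S.SameVertex a b) (ha : a ∉ C) (hb : b ∉ C) :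
    S.walkSum C a f = S.walkSum C b f := by
  classical
  rw [walkSum_of_notMem ha, walkSum_of_notMem hb]
  congr 1
  funext d
  have : S.SameVertex a d ↔ S.SameVertex b d := ⟨hab.symm.trans, hab.trans⟩
  simp only [this]

theorem walkSum_congr {g : S.Dart → ℝ≥0∞} (h : ∀ d ∈ C, f d = g d) :
    S.walkSum C a f = S.walkSum C a g := by
  have hend : ∀ (ω : List S.Dart) (a : S.Dart), S.IsStoppedWalk C a ω → S.endDart a ω ∈ C := by
    intro ω
    induction ω with
    | nil => exact fun a h => h
    | cons d ω ih =>
      intro a h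
      rw [endDart_cons]
      exact ih _ h.2.2
  refine tsum_congr fun ω => ?_
  split_ifs with hω
  · rw [h _ (hend ω a hω)]
  · rfl

/-! ### Poisson equation -/

section

variable [Fintype S.Dart] [Fintype S.Vert]

open Classical in
/-- The vertex function of a function of darts, set to zero on `C`. -/
noncomputable def vertFun (C : Set S.Vert) (Y : S.Dart → ℝ≥0∞) (v : S.Vert) : ℝ :=
  if v ∈ C then 0 else (Y v.out).toReal

-- The equation for `Y` involves the starting dart only through its vertex, so the representative
-- `v.out` is immaterial.
omit [Fintype S.Dart] [Fintype S.Vert] in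
open Classical in
theorem vertFun_org {C : Set S.Vert} {Y r : S.Dart → ℝ≥0∞} (hY0 : ∀ a ∈ S.dartsAt C, Y a = 0)
    (hY : ∀ a ∉ S.dartsAt C, Y a = ∑' d, if S.SameVertex a d then
      (S.deg d : ℝ≥0∞)⁻¹ * (Y (S.rev d) + r d) else 0) (a : S.Dart) :
    vertFun C Y (S.org a) = (Y a).toReal := by
  rw [vertFun]
  split_ifs with h
  · rw [hY0 a h]
    rfl
  · have hab : S.SameVertex (S.org a).out a := org_eq_org.1 (by simp)
    congr 1
    rw [hY _ (by simpa using h), hY a h]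
    congr 1
    funext d
    have : S.SameVertex (S.org a).out d ↔ S.SameVertex a d := ⟨hab.symm.trans, hab.trans⟩
    simp only [this]

-- The averaging equation, multiplied by the degree of the vertex, is a Poisson equation with source
-- `r`; on `C` the boundary value is zero.
open Classical in
theorem lap_mulVec_vertFun {C : Set S.Vert} {Y r : S.Dart → ℝ≥0∞}
    (hfin : ∀ a, Y a ≠ ∞) (hr : ∀ a, r a ≠ ∞) (hY0 : ∀ a ∈ S.dartsAt C, Y a = 0)
    (hY : ∀ a ∉ S.dartsAt C, Y a = ∑' d, if S.SameVertex a d then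
      (S.deg d : ℝ≥0∞)⁻¹ * (Y (S.rev d) + r d) else 0) (v : S.Vert) :
    (S.lap C).mulVec (vertFun C Y) v =
      if v ∈ C then 0 else ∑ d : S.Dart with S.org d = v, (r d).toReal := by
  rw [lap_mulVec]
  split_ifs with hv
  · simp [vertFun, hv]
  obtain ⟨a, rfl⟩ := S.org_surjective v
  have h1 : (S.deg a : ℝ≥0∞) * Y a = ∑ d : S.Dart with S.org d = S.org a,
      (Y (S.rev d) + r d) := by
    rw [hY a hv, tsum_fintype, ← Finset.sum_filter, Finset.mul_sum]
    have : (Finset.univ.filter fun d => S.SameVertex a d) =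
        Finset.univ.filter fun d => S.org d = S.org a := by
      ext d
      simp [← org_eq_org, eq_comm]
    rw [this]
    refine Finset.sum_congr rfl fun d hd => ?_
    have : S.deg d = S.deg a := deg_eq (org_eq_org.1 (by simpa using hd))
    rw [this, ← mul_assoc, ENNReal.mul_inv_cancel, one_mul]
    · exact_mod_cast (deg_pos a).ne'
    · exact ENNReal.natCast_ne_top _
  have h2 := congrArg ENNReal.toReal h1
  rw [ENNReal.toReal_mul, ENNReal.toReal_natCast,
    ENNReal.toReal_sum fun d _ => ENNReal.add_ne_top.2 ⟨hfin _, hr _⟩] at h2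
  have h3 : ∀ d : S.Dart, (Y (S.rev d) + r d).toReal =
      vertFun C Y (S.org (S.rev d)) + (r d).toReal := by
    intro d
    rw [ENNReal.toReal_add (hfin _) (hr _), vertFun_org hY0 hY]
  simp only [h3] at h2
  rw [Finset.sum_add_distrib] at h2
  have h4 : (Finset.univ.filter fun d => S.org d = S.org a).card = S.deg a := by
    rw [deg, Nat.card_eq_fintype_card, Fintype.card_subtype]
    congr 1
    ext d
    simp [← org_eq_org, eq_comm]
  rw [Finset.sum_sub_distrib, Finset.sum_const, nsmul_eq_mul, h4, vertFun_org hY0 hY, h2]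
  ring

-- The walk function is set to zero on `C`, and its boundary values reappear as a source at the
-- darts that lead into `C`.
omit [Fintype S.Dart] [Fintype S.Vert] in
open Classical in
theorem walkSum_poisson (a : S.Dart) (ha : a ∉ C) :
    (if a ∈ C then 0 else S.walkSum C a f) = ∑' d, if S.SameVertex a d then
      (S.deg d : ℝ≥0∞)⁻¹ * ((if S.rev d ∈ C then 0 else S.walkSum C (S.rev d) f) +
        if S.rev d ∈ C then f (S.rev d) else 0) else 0 := by
  rw [if_neg ha, walkSum_of_notMem ha]
  congr 1
  funext d
  split_ifs with h1 h2
  · rw [walkSum_of_mem h2, zero_add]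
  · rw [add_zero]
  · rfl

/-- The vertex function of stopped random walk. -/
noncomputable def walkVert (C : Set S.Vert) (f : S.Dart → ℝ≥0∞) : S.Vert → ℝ :=
  open Classical in
  vertFun C fun a => if a ∈ S.dartsAt C then 0 else S.walkSum (S.dartsAt C) a f

omit [Fintype S.Dart] [Fintype S.Vert] in
theorem walkVert_org {C : Set S.Vert} {f : S.Dart → ℝ≥0∞} {a : S.Dart} (ha : S.org a ∉ C) :
    walkVert C f (S.org a) = (S.walkSum (S.dartsAt C) a f).toReal := by
  classical
  rw [walkVert, vertFun_org (r := fun d => if S.rev d ∈ S.dartsAt C then f (S.rev d) else 0)]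
  · rw [if_neg (by simpa using ha)]
  · intro a ha
    rw [if_pos ha]
  · intro a ha
    exact walkSum_poisson a ha

open Classical in
theorem lap_mulVec_walkVert {C : Set S.Vert} {f : S.Dart → ℝ≥0∞} (hf : ∀ d, f d ≤ 1)
    (v : S.Vert) : (S.lap C).mulVec (walkVert C f) v = if v ∈ C then 0 else
      ∑ d : S.Dart with S.org d = v, if S.org (S.rev d) ∈ C then (f (S.rev d)).toReal else 0 := by
  rw [walkVert, lap_mulVec_vertFun
    (r := fun d => if S.rev d ∈ S.dartsAt C then f (S.rev d) else 0)]
  · simp only [mem_dartsAt]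
    split_ifs with h
    · rfl
    · refine Finset.sum_congr rfl fun d _ => ?_
      split_ifs <;> rfl
  · intro a
    split_ifs
    · exact ENNReal.zero_ne_top
    · exact ((walkSum_le_one hf).trans_lt ENNReal.one_lt_top).ne
  · intro a
    split_ifs
    · exact ((hf _).trans_lt ENNReal.one_lt_top).ne
    · exact ENNReal.zero_ne_top
  · intro a ha
    rw [if_pos ha]
  · intro a ha
    exact walkSum_poisson a ha

open Classical in
theorem det_lap_ne_zero {C : Set S.Vert} (hC : C.Nonempty)
    (hS : ∀ a b, S.Joined Set.univ a b) : (S.lap C).det ≠ 0 := by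
  rw [det_lap]
  exact_mod_cast (forestCount_pos hC hS).ne'

open Classical in
theorem eq_of_lap_mulVec_eq {C : Set S.Vert} (hC : C.Nonempty)
    (hS : ∀ a b, S.Joined Set.univ a b) {g g' : S.Vert → ℝ}
    (h : (S.lap C).mulVec g = (S.lap C).mulVec g') : g = g' := by
  by_contra hne
  refine det_lap_ne_zero hC hS (Matrix.exists_mulVec_eq_zero_iff.1
    ⟨g - g', sub_ne_zero.2 hne, ?_⟩)
  rw [Matrix.mulVec_sub, h, sub_self]

end

/-- Simple random walk on a finite connected map hits every nonempty set of vertices. -/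
theorem walkSum_one [Finite S.Dart] {C : Set S.Vert} (hC : C.Nonempty)
    (hS : ∀ a b, S.Joined Set.univ a b) (a : S.Dart) :
    S.walkSum (S.dartsAt C) a (fun _ => 1) = 1 := by
  classical
  have := Fintype.ofFinite S.Dart
  have := Fintype.ofFinite S.Vert
  by_cases ha : a ∈ S.dartsAt C
  · rw [walkSum_of_mem ha]
  -- The walk function was set to zero on `C`; `g` restores the boundary value 1. The sum then
  -- solves the same equation as the constant 1.
  let g : S.Vert → ℝ := fun v => if v ∈ C then 1 else 0
  have : (fun v => walkVert C (fun _ => 1) v + g v) = fun _ => 1 := by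
    refine eq_of_lap_mulVec_eq hC hS ?_
    change (S.lap C).mulVec (walkVert C (fun _ => 1) + g) = _
    rw [Matrix.mulVec_add]
    funext v
    rw [Pi.add_apply, lap_mulVec_walkVert (fun _ => le_rfl), lap_mulVec, lap_mulVec]
    simp only [g]
    split_ifs with h
    · simp
    · simp
  have := congrFun this (S.org a)
  rw [walkVert_org (mt mem_dartsAt.2 ha)] at this
  simp only [g] at this
  rw [if_neg (by simpa using ha), add_zero] at this
  exact (ENNReal.toReal_eq_one_iff _).1 this

/-! ### Ratios of forest counts as hitting probabilities -/

open Classical in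
/-- The harmonic measure of an edge `e` in terms of the harmonic measure of its endpoint after this
endpoint has been added to `C`. -/
theorem forestCount_mul_walkSum [Finite S.Dart] {C : Set S.Vert}
    (hrev : ∀ d, S.rev (S.rev d) = d) (hS : ∀ a b, S.Joined Set.univ a b) {e : S.Dart}
    (he : S.org e ∈ C) (he' : S.org (S.rev e) ∉ C) {a : S.Dart} (ha : S.org a ∉ C) :
    (S.forestCount (S.dartsAt C) : ℝ≥0∞) *
        S.walkSum (S.dartsAt C) a (fun d => if d = e then 1 else 0) =
      S.forestCount (S.dartsAt (insert (S.org (S.rev e)) C)) *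
        S.walkSum (S.dartsAt (insert (S.org (S.rev e)) C)) a
          (fun d => if S.SameVertex (S.rev e) d then 1 else 0) := by
  have := Fintype.ofFinite S.Dart
  have := Fintype.ofFinite S.Vert
  have hf1 : ∀ d : S.Dart, (if d = e then 1 else 0 : ℝ≥0∞) ≤ 1 := fun d => by split_ifs <;> simp
  have hf2 : ∀ d : S.Dart, (if S.SameVertex (S.rev e) d then 1 else 0 : ℝ≥0∞) ≤ 1 :=
    fun d => by split_ifs <;> simp
  set u := S.org (S.rev e) with hu
  have hC : C.Nonempty := ⟨_, he⟩
  -- A walk that enters `C` through the edge of `e` traverses `rev e` last, so the source sits at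
  -- `u` and has mass one.
  have h1 : (S.lap C).mulVec (walkVert C fun d => if d = e then 1 else 0) = Pi.single u 1 := by
    funext v
    rw [lap_mulVec_walkVert hf1]
    split_ifs with hv
    · rw [Pi.single_eq_of_ne]
      rintro rfl
      exact he' hv
    · have : ∀ d : S.Dart, (if S.org (S.rev d) ∈ C then
          (if S.rev d = e then 1 else 0 : ℝ≥0∞).toReal else 0) = if d = S.rev e then 1 else 0 := by
        intro d
        by_cases hd : S.rev d = e
        · have : d = S.rev e := by rw [← hd, hrev]
          rw [if_pos hd, if_pos this, hd, if_pos he]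
          rfl
        · have : d ≠ S.rev e := by
            rintro rfl
            exact hd (hrev e)
          rw [if_neg hd, if_neg this]
          simp
      simp only [this]
      by_cases hvu : v = u
      · subst hvu
        rw [Pi.single_eq_same, Finset.sum_ite_eq']
        simp [hu]
      · rw [Pi.single_eq_of_ne hvu, Finset.sum_ite_eq', if_neg]
        simpa [hu, eq_comm] using hvu
  set g := walkVert (insert u C) fun d => if S.SameVertex (S.rev e) d then 1 else 0 with hg
  -- The probability of hitting `insert u C` at `u` is harmonic outside `insert u C` and zero on
  -- `C`. For the Laplacian of `C` it thus has a source at `u` only, of a mass that is still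
  -- unknown.
  have h2 : (S.lap C).mulVec (g + Pi.single u 1) =
      Pi.single u ((S.lap C).mulVec (g + Pi.single u (1 : ℝ) : S.Vert → ℝ) u) := by
    funext v
    by_cases hvu : v = u
    · subst hvu
      rw [Pi.single_eq_same]
    rw [Pi.single_eq_of_ne hvu]
    have hl := lap_mulVec_walkVert (C := insert u C) hf2 v
    rw [← hg] at hl
    rw [Matrix.mulVec_add, Pi.add_apply]
    have e1 : (S.lap C).mulVec g v = (S.lap (insert u C)).mulVec g v := by
      rw [lap_mulVec, lap_mulVec]
      simp [hvu]
    rw [e1, hl, lap_mulVec]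
    by_cases hv : v ∈ C
    · rw [if_pos (Set.mem_insert_of_mem _ hv), if_pos hv, Pi.single_eq_of_ne hvu, add_zero]
    · rw [if_neg (by simp [hvu, hv]), if_neg hv, ← Finset.sum_add_distrib]
      refine Finset.sum_eq_zero fun d _ => ?_
      rw [Pi.single_eq_of_ne hvu]
      by_cases hd : S.org (S.rev d) = u
      · have : S.SameVertex (S.rev e) (S.rev d) := org_eq_org.1 (by rw [hd, hu])
        simp [hd, this]
      · have : ¬ S.SameVertex (S.rev e) (S.rev d) := fun h => hd (org_eq_org.2 h).symm
        rw [if_neg this, Pi.single_eq_of_ne hd]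
        simp
  -- Both functions are multiples of the same column of the adjugate. The second one equals 1 at
  -- `u`, which identifies its source mass as the ratio of the two determinants.
  have k1 := det_mul_of_lap_mulVec h1 (S.org a)
  have k2 := det_mul_of_lap_mulVec h2 (S.org a)
  have k3 := det_mul_of_lap_mulVec h2 u
  rw [← det_lap_insert] at k3
  have hgu : (g + Pi.single u (1 : ℝ) : S.Vert → ℝ) u = 1 := by
    rw [Pi.add_apply, Pi.single_eq_same, hg, walkVert, vertFun, if_pos (Set.mem_insert _ _),
      zero_add]
  rw [hgu, mul_one] at k3
  have hc : (S.lap C).mulVec (g + Pi.single u (1 : ℝ) : S.Vert → ℝ) u ≠ 0 := by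
    intro h
    rw [h, zero_mul] at k3
    exact det_lap_ne_zero hC hS k3
  have hreal : (S.lap C).det * walkVert C (fun d => if d = e then 1 else 0) (S.org a) =
      (S.lap (insert u C)).det * (g + Pi.single u (1 : ℝ) : S.Vert → ℝ) (S.org a) := by
    refine mul_left_cancel₀ hc ?_
    rw [k1, one_mul, ← k2, k3]
    ring
  rw [det_lap, det_lap, walkVert_org ha] at hreal
  have hga : (g + Pi.single u (1 : ℝ) : S.Vert → ℝ) (S.org a) = (S.walkSum (S.dartsAt (insert u C)) a
      (fun d => if S.SameVertex (S.rev e) d then 1 else 0)).toReal := by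
    rw [Pi.add_apply]
    by_cases hau : S.org a = u
    · have : a ∈ S.dartsAt (insert u C) := by simp [hau]
      have hs : S.SameVertex (S.rev e) a := org_eq_org.1 (by rw [hau, hu])
      rw [walkSum_of_mem this, hau, ← Pi.add_apply, hgu, if_pos hs]
      rfl
    · rw [Pi.single_eq_of_ne hau, add_zero, hg, walkVert_org]
      simp [hau, ha]
  rw [hga] at hreal
  have fin1 : S.walkSum (S.dartsAt C) a (fun d => if d = e then 1 else 0) ≠ ∞ :=
    ((walkSum_le_one hf1).trans_lt ENNReal.one_lt_top).ne
  have fin2 : S.walkSum (S.dartsAt (insert u C)) a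
      (fun d => if S.SameVertex (S.rev e) d then 1 else 0) ≠ ∞ :=
    ((walkSum_le_one hf2).trans_lt ENNReal.one_lt_top).ne
  rw [← ENNReal.toReal_eq_toReal_iff' (ENNReal.mul_ne_top (ENNReal.natCast_ne_top _) fin1)
    (ENNReal.mul_ne_top (ENNReal.natCast_ne_top _) fin2), ENNReal.toReal_mul, ENNReal.toReal_mul,
    ENNReal.toReal_natCast, ENNReal.toReal_natCast]
  exact hreal

open Classical in
/-- The expectation of a quantity that is collected when the walk, killed at `C`, leaves the origin
of `e` through `e`. -/
theorem forestCount_mul_of_poisson [Finite S.Dart] {C : Set S.Vert} {e : S.Dart}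
    (he : S.org e ∉ C) {Y : S.Dart → ℝ≥0∞} {z : ℝ≥0∞}
    (hfin : ∀ a, Y a ≠ ∞) (hz : z ≠ ∞) (hY0 : ∀ a ∈ S.dartsAt C, Y a = 0)
    (hY : ∀ a ∉ S.dartsAt C, Y a = ∑' d, if S.SameVertex a d then
      (S.deg d : ℝ≥0∞)⁻¹ * (Y (S.rev d) + if d = e then z else 0) else 0) :
    (S.forestCount (S.dartsAt C) : ℝ≥0∞) * Y e =
      S.forestCount (S.dartsAt (insert (S.org e) C)) * z := by
  have := Fintype.ofFinite S.Dart
  have := Fintype.ofFinite S.Vert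
  have h1 : (S.lap C).mulVec (vertFun C Y) = Pi.single (S.org e) z.toReal := by
    funext v
    rw [lap_mulVec_vertFun hfin (fun d => by split_ifs; exacts [hz, ENNReal.zero_ne_top]) hY0 hY]
    have : ∀ d, (if d = e then z else 0).toReal = if d = e then z.toReal else 0 := by
      intro d
      split_ifs <;> rfl
    simp only [this]
    split_ifs with hv
    · rw [Pi.single_eq_of_ne]
      rintro rfl
      exact he hv
    · by_cases hve : v = S.org e
      · subst hve
        simp
      · rw [Pi.single_eq_of_ne hve, Finset.sum_ite_eq', if_neg]
        simpa [eq_comm] using hve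
  have k := det_mul_of_lap_mulVec h1 (S.org e)
  rw [← det_lap_insert, det_lap, det_lap, vertFun_org hY0 hY] at k
  rw [← ENNReal.toReal_eq_toReal_iff' (ENNReal.mul_ne_top (ENNReal.natCast_ne_top _) (hfin _))
    (ENNReal.mul_ne_top (ENNReal.natCast_ne_top _) hz), ENNReal.toReal_mul, ENNReal.toReal_mul,
    ENNReal.toReal_natCast, ENNReal.toReal_natCast, k, mul_comm]

end MarkedMap

namespace MarkedMap

/-! ### Loop erasure -/

section

variable {S : MarkedMap}

open Classical in
/-- One step of chronological loop erasure. -/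
noncomputable def eraseStep (S : MarkedMap) (γ : List S.Dart) (d : S.Dart) : List S.Dart :=
  (γ ++ [d]).takeWhile fun e => ¬ S.SameVertex e (S.rev d)

theorem loopErase_eq_foldl (ω : List S.Dart) : S.loopErase ω = ω.foldl S.eraseStep [] := by
  rfl

theorem eraseStep_cons_of_sameVertex {e d : S.Dart} (h : S.SameVertex e (S.rev d))
    (γ : List S.Dart) : S.eraseStep (e :: γ) d = [] := by
  simp [eraseStep, h]

theorem eraseStep_cons_of_not {e d : S.Dart} (h : ¬ S.SameVertex e (S.rev d))
    (γ : List S.Dart) : S.eraseStep (e :: γ) d = e :: S.eraseStep γ d := by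
  simp [eraseStep, h]

theorem eraseStep_nil_of_sameVertex {d : S.Dart} (h : S.SameVertex d (S.rev d)) :
    S.eraseStep [] d = [] := by
  simp [eraseStep, h]

theorem eraseStep_nil_of_not {d : S.Dart} (h : ¬ S.SameVertex d (S.rev d)) :
    S.eraseStep [] d = [d] := by
  simp [eraseStep, h]

/-- After the last visit to the origin of `e`, the walk traverses `e` and then follows a walk with loop
erasure `γ`. -/
def LastExit (S : MarkedMap) (e : S.Dart) (γ : List S.Dart) : List S.Dart → Prop
  | [] => False
  | d :: ω => LastExit S e γ ω ∨
      (d = e ∧ (∀ d' ∈ d :: ω, ¬ S.SameVertex e (S.rev d')) ∧ S.loopErase ω = γ)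

/-- Induction on the walk, with the two states that the loop erasure can be in: the current path is
empty and the walk is at the origin of `e`, or the current path starts there with some dart `d₀` and
the walk is elsewhere. A return to the origin erases everything; without a return the first dart
`d₀` survives and the rest is erased independently of it. -/
theorem loopErase_eq_cons_iff_aux {C : Set S.Dart} (e : S.Dart) (γ : List S.Dart)
    (ω : List S.Dart) :
    (∀ a, S.IsStoppedWalk C a ω → S.SameVertex e a →
      (ω.foldl S.eraseStep [] = e :: γ ↔ S.LastExit e γ ω)) ∧
    (∀ a d₀ γ', S.IsStoppedWalk C a ω → ¬ S.SameVertex e a → S.SameVertex e d₀ →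
      (ω.foldl S.eraseStep (d₀ :: γ') = e :: γ ↔ S.LastExit e γ ω ∨
        ((∀ d' ∈ ω, ¬ S.SameVertex e (S.rev d')) ∧ d₀ = e ∧
          ω.foldl S.eraseStep γ' = γ))) := by
  induction ω with
  | nil =>
    refine ⟨fun a _ _ => ?_, fun a d₀ γ' _ _ _ => ?_⟩ <;> simp [LastExit]
  | cons d ω ih =>
    refine ⟨fun a hω hea => ?_, fun a d₀ γ' hω hea hed => ?_⟩
    · have hed : S.SameVertex e d := hea.trans hω.2.1
      rw [List.foldl_cons, LastExit]
      by_cases h : S.SameVertex e (S.rev d)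
      · rw [eraseStep_nil_of_sameVertex (hed.symm.trans h), ih.1 _ hω.2.2 h]
        simp [h]
      · rw [eraseStep_nil_of_not (fun h' => h (hed.trans h')), ih.2 _ d [] hω.2.2 h hed]
        simp only [List.forall_mem_cons, h, not_false_eq_true, true_and, loopErase_eq_foldl]
        tauto
    · have hde : d ≠ e := by
        rintro rfl
        exact hea hω.2.1.symm
      rw [List.foldl_cons, LastExit]
      by_cases h : S.SameVertex e (S.rev d)
      · rw [eraseStep_cons_of_sameVertex (hed.symm.trans h), ih.1 _ hω.2.2 h]
        simp [h]
      · rw [eraseStep_cons_of_not (fun h' => h (hed.trans h')),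
          ih.2 _ d₀ _ hω.2.2 h hed]
        simp [h, hde]

theorem loopErase_eq_cons_iff {C : Set S.Dart} {e a : S.Dart} {γ ω : List S.Dart}
    (hω : S.IsStoppedWalk C a ω) (hea : S.SameVertex e a) :
    S.loopErase ω = e :: γ ↔ S.LastExit e γ ω :=
  (loopErase_eq_cons_iff_aux e γ ω).1 a hω hea

theorem not_lastExit {C : Set S.Dart} {e : S.Dart} {γ ω : List S.Dart} {a : S.Dart}
    (hω : S.IsStoppedWalk C a ω) (ha : ¬ S.SameVertex e a)
    (h : ∀ d ∈ ω, ¬ S.SameVertex e (S.rev d)) : ¬ S.LastExit e γ ω := by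
  induction ω generalizing a with
  | nil => exact id
  | cons d ω ih =>
    rw [List.forall_mem_cons] at h
    rintro (h1 | ⟨rfl, -, -⟩)
    · exact ih hω.2.2 h.1 h.2 h1
    · exact ha hω.2.1.symm

/-- Invariants of loop erasure: a nonempty path starts at the starting vertex `b` of the walk, and
the path is empty only while the walk is at `b`. -/
theorem loopErase_start_aux {C : Set S.Dart} {b : S.Dart} (ω : List S.Dart) (a : S.Dart)
    (γ : List S.Dart) (hω : S.IsStoppedWalk C a ω) (h0 : γ = [] → S.SameVertex b a)
    (h1 : ∀ x ∈ γ.head?, S.SameVertex b x) :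
    (∀ x ∈ (ω.foldl S.eraseStep γ).head?, S.SameVertex b x) ∧
      (ω.foldl S.eraseStep γ = [] → S.SameVertex b (S.endDart a ω)) := by
  induction ω generalizing a γ with
  | nil => exact ⟨h1, h0⟩
  | cons d ω ih =>
    rw [endDart_cons, List.foldl_cons]
    refine ih _ _ hω.2.2 ?_ ?_
    · rcases γ with _ | ⟨x, γ⟩
      · have hbd := (h0 rfl).trans hω.2.1
        by_cases h : S.SameVertex d (S.rev d)
        · exact fun _ => hbd.trans h
        · rw [eraseStep_nil_of_not h]
          simp
      · have hbx := h1 x (by simp)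
        by_cases h : S.SameVertex x (S.rev d)
        · exact fun _ => hbx.trans h
        · rw [eraseStep_cons_of_not h]
          simp
    · rcases γ with _ | ⟨x, γ⟩
      · have hbd := (h0 rfl).trans hω.2.1
        by_cases h : S.SameVertex d (S.rev d)
        · rw [eraseStep_nil_of_sameVertex h]
          simp
        · rw [eraseStep_nil_of_not h]
          simpa using hbd
      · have hbx := h1 x (by simp)
        by_cases h : S.SameVertex x (S.rev d)
        · rw [eraseStep_cons_of_sameVertex h]
          simp
        · rw [eraseStep_cons_of_not h]
          simpa using hbx

theorem sameVertex_of_loopErase_eq_cons {C : Set S.Dart} {a e : S.Dart} {ω γ : List S.Dart}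
    (hω : S.IsStoppedWalk C a ω) (h : S.loopErase ω = e :: γ) : S.SameVertex a e := by
  refine (loopErase_start_aux ω a [] hω (fun _ => SameVertex.rfl) (by simp)).1 e ?_
  rw [← loopErase_eq_foldl, h]
  simp

theorem sameVertex_endDart_of_loopErase_eq_nil {C : Set S.Dart} {a : S.Dart} {ω : List S.Dart}
    (hω : S.IsStoppedWalk C a ω) (h : S.loopErase ω = []) : S.SameVertex a (S.endDart a ω) :=
  (loopErase_start_aux ω a [] hω (fun _ => SameVertex.rfl) (by simp)).2 h

end

/-! ### Loop-erased random walk killed at a set of vertices -/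

open Classical in
/-- The probability that simple random walk reaches the vertex `t` before it is killed at `A`, and has
loop erasure `γ`. -/
noncomputable def lerwSum (S : MarkedMap) (A : Set S.Vert) (t : S.Vert) (a : S.Dart)
    (γ : List S.Dart) : ℝ≥0∞ :=
  ∑' ω : List S.Dart, if S.IsStoppedWalk (S.dartsAt (insert t A)) a ω then
    S.walkWeight ω * (if S.org (S.endDart a ω) = t ∧ S.loopErase ω = γ then 1 else 0) else 0

section

variable {S : MarkedMap} {A : Set S.Vert} {t : S.Vert} {a e : S.Dart} {γ : List S.Dart}

theorem targetVertex_eq (S : MarkedMap) : S.targetVertex = S.dartsAt {S.org S.target} := by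
  ext d
  exact ⟨fun h => (org_eq_org.2 h).symm, fun h => org_eq_org.1 (Eq.symm h)⟩

theorem endDart_mem {C : Set S.Dart} {ω : List S.Dart} {a : S.Dart} (h : S.IsStoppedWalk C a ω) :
    S.endDart a ω ∈ C := by
  induction ω generalizing a with
  | nil => exact h
  | cons d ω ih =>
    rw [endDart_cons]
    exact ih h.2.2

theorem lerwProb_eq (S : MarkedMap) (γ : List S.Dart) :
    S.lerwProb γ = S.lerwSum ∅ (S.org S.target) S.tip γ := by
  rw [lerwProb, lerwSum, targetVertex_eq]
  have h0 : insert (S.org S.target) (∅ : Set S.Vert) = {S.org S.target} := by simp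
  rw [h0]
  refine tsum_congr fun ω => ?_
  by_cases h : S.IsStoppedWalk (S.dartsAt {S.org S.target}) S.tip ω
  · have h1 : S.org (S.endDart S.tip ω) = S.org S.target := endDart_mem h
    rw [if_pos h]
    by_cases h2 : S.loopErase ω = γ
    · rw [if_pos ⟨h, h2⟩, if_pos ⟨h1, h2⟩, mul_one]
    · rw [if_neg (fun h' => h2 h'.2), if_neg (fun h' => h2 h'.2), mul_zero]
  · rw [if_neg (fun h' => h h'.1), if_neg h]

theorem lerwSum_of_mem (ht : t ∉ A) (ha : S.org a ∈ A) : S.lerwSum A t a γ = 0 := by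
  rw [lerwSum, ENNReal.tsum_eq_zero]
  intro ω
  split_ifs with h1 h2
  · rw [isStoppedWalk_of_mem (by simp [ha])] at h1
    subst h1
    have : S.org a = t := h2.1
    exact absurd (this ▸ ha) ht
  · simp
  · rfl

open Classical in
theorem lerwSum_of_eq (ha : S.org a = t) :
    S.lerwSum A t a γ = if γ = [] then 1 else 0 := by
  have ham : a ∈ S.dartsAt (insert t A) := by simp [ha]
  rw [lerwSum, tsum_eq_single []]
  · have h0 : S.IsStoppedWalk (S.dartsAt (insert t A)) a [] := ham
    have h1 : S.loopErase [] = [] := by simp [loopErase]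
    rw [if_pos h0, h1]
    simp only [walkWeight_nil, one_mul, endDart, List.getLast?_nil, Option.map_none,
      Option.getD_none, ha, true_and, eq_comm]
  · intro ω hω
    rw [if_neg (fun h => hω ((isStoppedWalk_of_mem ham).1 h))]

theorem lerwSum_nil (ha : S.org a ≠ t) : S.lerwSum A t a [] = 0 := by
  rw [lerwSum, ENNReal.tsum_eq_zero]
  intro ω
  split_ifs with h1 h2
  · have := sameVertex_endDart_of_loopErase_eq_nil h1 h2.2
    exact absurd ((org_eq_org.2 this).trans h2.1) ha
  · simp
  · rfl

theorem lerwSum_cons_of_not_sameVertex (h : ¬ S.SameVertex a e) :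
    S.lerwSum A t a (e :: γ) = 0 := by
  rw [lerwSum, ENNReal.tsum_eq_zero]
  intro ω
  split_ifs with h1 h2
  · exact absurd (sameVertex_of_loopErase_eq_cons h1 h2.2) h
  · simp
  · rfl

theorem tsum_walkWeight_le_one [Finite S.Dart] {C : Set S.Dart} (p : List S.Dart → Prop) :
    open Classical in
    ∑' ω : List S.Dart, (if S.IsStoppedWalk C a ω then
      S.walkWeight ω * (if p ω then 1 else 0) else 0) ≤ 1 := by
  classical
  refine le_trans ?_ (walkSum_one_le C a)
  refine ENNReal.tsum_le_tsum fun ω => ?_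
  split_ifs <;> simp

/-- For walks that end at `t`, being killed at the origin of `e` as well just means avoiding it. In
this way the part of a walk after the last visit becomes a walk with a larger killing set. -/
theorem isStoppedWalk_insert_iff (het : S.org e ≠ t) {ω : List S.Dart} {a : S.Dart} :
    (S.IsStoppedWalk (S.dartsAt (insert t (insert (S.org e) A))) a ω ∧
      S.org (S.endDart a ω) = t) ↔
    ((S.IsStoppedWalk (S.dartsAt (insert t A)) a ω ∧ S.org (S.endDart a ω) = t) ∧
      ¬ S.SameVertex e a ∧ ∀ d ∈ ω, ¬ S.SameVertex e (S.rev d)) := by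
  induction ω generalizing a with
  | nil =>
    simp only [IsStoppedWalk, endDart, mem_dartsAt, List.getLast?_nil, Option.map_none,
      Option.getD_none, Set.mem_insert_iff, ← org_eq_org]
    constructor
    · rintro ⟨-, rfl⟩
      simpa using het
    · rintro ⟨⟨-, rfl⟩, -⟩
      simp
  | cons d ω ih =>
    rw [endDart_cons]
    simp only [IsStoppedWalk, mem_dartsAt, Set.mem_insert_iff, List.forall_mem_cons] at ih ⊢
    have := @ih (S.rev d)
    rw [show S.SameVertex e a ↔ S.org a = S.org e by rw [← org_eq_org, eq_comm]]
    tauto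

open Classical in
/-- The first step of the loop erasure: after the last visit to its starting point, the walk is a walk
that avoids this point. -/
theorem forestCount_mul_lerwSum_cons [Finite S.Dart] (hae : S.SameVertex a e)
    (ha : S.org a ∉ insert t A) :
    (S.forestCount (S.dartsAt (insert t A)) : ℝ≥0∞) * S.lerwSum A t a (e :: γ) =
      S.forestCount (S.dartsAt (insert t (insert (S.org a) A))) *
        S.lerwSum (insert (S.org a) A) t (S.rev e) γ := by
  have hea := org_eq_org.2 hae
  rw [hea] at ha ⊢
  have het : S.org e ≠ t := fun h => ha (by simp [h])
  -- `Y` extends the left-hand side to all starting points. The last exit gives it a Poisson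
  -- equation whose only source is a step through `e`, of mass equal to the probability of the
  -- remaining path.
  let Y : S.Dart → ℝ≥0∞ := fun b => ∑' ω : List S.Dart,
    if S.IsStoppedWalk (S.dartsAt (insert t A)) b ω then
    S.walkWeight ω * (if S.org (S.endDart b ω) = t ∧ S.LastExit e γ ω then 1 else 0) else 0
  have hYle : ∀ b, Y b ≤ 1 := by
    intro b
    convert tsum_walkWeight_le_one (C := S.dartsAt (insert t A)) (a := b)
      fun ω => S.org (S.endDart b ω) = t ∧ S.LastExit e γ ω
  have hz : S.lerwSum (insert (S.org e) A) t (S.rev e) γ ≤ 1 := by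
    rw [lerwSum]
    convert tsum_walkWeight_le_one
      (C := S.dartsAt (insert t (insert (S.org e) A))) (a := S.rev e)
      fun ω => S.org (S.endDart (S.rev e) ω) = t ∧ S.loopErase ω = γ
  have hY : ∀ b ∉ S.dartsAt (insert t A), Y b = ∑' d, if S.SameVertex b d then
      (S.deg d : ℝ≥0∞)⁻¹ * (Y (S.rev d) +
        if d = e then S.lerwSum (insert (S.org e) A) t (S.rev e) γ else 0) else 0 := by
    intro b hb
    simp only [Y]
    rw [tsum_isStoppedWalk hb fun ω =>
      if S.org (S.endDart b ω) = t ∧ S.LastExit e γ ω then 1 else 0]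
    refine tsum_congr fun d => ?_
    split_ifs with hbd hde
    · subst hde
      congr 1
      rw [lerwSum, ← ENNReal.tsum_add]
      refine tsum_congr fun ω => ?_
      have key := isStoppedWalk_insert_iff (S := S) (A := A) het (ω := ω) (a := S.rev d)
      -- A last exit through the present dart excludes a later one, so the probabilities of the two
      -- alternatives add up.
      have key2 : S.IsStoppedWalk (S.dartsAt (insert t A)) (S.rev d) ω →
          (¬ S.SameVertex d (S.rev d) ∧ ∀ d' ∈ ω, ¬ S.SameVertex d (S.rev d')) →
          ¬ S.LastExit d γ ω := fun h1 h2 => not_lastExit h1 h2.1 h2.2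
      rw [endDart_cons]
      simp only [LastExit, List.forall_mem_cons, true_and]
      by_cases p1 : S.IsStoppedWalk (S.dartsAt (insert t A)) (S.rev d) ω
      · by_cases p2 : S.org (S.endDart (S.rev d) ω) = t
        · by_cases p3 : ¬ S.SameVertex d (S.rev d) ∧ ∀ d' ∈ ω, ¬ S.SameVertex d (S.rev d')
          · have p4 := key2 p1 p3
            have p5 := (key.2 ⟨⟨p1, p2⟩, p3⟩).1
            simp only [p1, p2, p3.1, p4, p5, eq_true p3.2, if_true, true_and, false_or, and_self,
              not_false_eq_true, if_false, mul_zero, zero_add]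
          · have p5 : ¬ S.IsStoppedWalk (S.dartsAt (insert t (insert (S.org d) A)))
                (S.rev d) ω := fun h => p3 (key.1 ⟨h, p2⟩).2
            simp [p1, p2, p3, p5]
        · simp [p2]
      · have : ¬ (S.IsStoppedWalk (S.dartsAt (insert t (insert (S.org d) A))) (S.rev d) ω ∧
            S.org (S.endDart (S.rev d) ω) = t) := fun h => p1 (key.1 h).1.1
        by_cases p2 : S.org (S.endDart (S.rev d) ω) = t
        · have p5 : ¬ S.IsStoppedWalk (S.dartsAt (insert t (insert (S.org d) A))) (S.rev d) ω :=
            fun h => this ⟨h, p2⟩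
          rw [if_neg p1, if_neg p1, if_neg p5, add_zero]
        · simp [p2]
    · rw [add_zero]
      congr 1
      refine tsum_congr fun ω => ?_
      rw [endDart_cons]
      simp [LastExit, hde]
    · rfl
  have h1 := forestCount_mul_of_poisson (S := S) (C := insert t A) (e := e) ha (Y := Y)
    (fun b => ((hYle b).trans_lt ENNReal.one_lt_top).ne) (hz.trans_lt ENNReal.one_lt_top).ne
    ?_ hY
  · rw [Set.insert_comm] at h1
    rw [← h1]
    congr 1
    have hYa : S.lerwSum A t a (e :: γ) = Y a := by
      refine tsum_congr fun ω => ?_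
      by_cases hω : S.IsStoppedWalk (S.dartsAt (insert t A)) a ω
      · simp only [loopErase_eq_cons_iff hω hae.symm]
      · rw [if_neg hω, if_neg hω]
    rw [hYa, hY e (by simpa using ha), hY a (by simpa [hea] using ha)]
    refine tsum_congr fun d => ?_
    have : S.SameVertex a d ↔ S.SameVertex e d := ⟨hae.symm.trans, hae.trans⟩
    simp only [this]
  · intro b hb
    simp only [Y, ENNReal.tsum_eq_zero]
    intro ω
    split_ifs with p1 p2
    · rw [isStoppedWalk_of_mem hb] at p1
      subst p1
      exact absurd p2.2 id
    · simp
    · rfl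

end

end MarkedMap

namespace MarkedMap

/-! ### Unzipping an edge -/

open Classical in
/-- Doubling the edge of `e`: the rotation before the vertex is split. -/
noncomputable def doubledRot (S : MarkedMap) (e : S.Dart) : Perm (S.Dart ⊕ Bool) :=
  Equiv.swap (Sum.inl (S.rev e)) (Sum.inr true) *
    (Equiv.swap (Sum.inl e) (Sum.inr false) * Perm.sumCongr S.rot 1)

open Classical in
/-- The rotation after the edge of `e` has been unzipped, where the origin of `e` is split between the
new dart and the corner of `c`. It is not split if `c` is the new dart itself. -/
noncomputable def unzipRot (S : MarkedMap) (e : S.Dart) (c : S.Dart ⊕ Bool) :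
    Perm (S.Dart ⊕ Bool) := S.doubledRot e * Equiv.swap (Sum.inr false) c

open Classical in
/-- The reversal of darts after the edge of `e` has been unzipped. -/
noncomputable def unzipRev (S : MarkedMap) (e : S.Dart) : Perm (S.Dart ⊕ Bool) :=
  Equiv.swap (Sum.inl (S.rev e)) (Sum.inr true) *
    Perm.sumCongr S.rev (Equiv.swap false true) * Equiv.swap (Sum.inl (S.rev e)) (Sum.inr true)

/-- Unzip the edge of `e`, where the origin of `e` is split between the new dart and the corner
of `c`. -/
noncomputable def unzipWith (S : MarkedMap) (e : S.Dart) (c : S.Dart ⊕ Bool) : MarkedMap where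
  Dart := S.Dart ⊕ Bool
  rot := S.unzipRot e c
  rev := S.unzipRev e
  root := Sum.inl S.root
  grey := Sum.inl '' S.grey ∪ {Sum.inr false, Sum.inr true}
  tip := Sum.inr true
  target := Sum.inl S.target

theorem unzip_eq_of_exists {S : MarkedMap} {e : S.Dart} (h : ∃ g ∈ S.grey, S.SameVertex e g) :
    ∃ g ∈ S.grey, S.SameVertex e g ∧ S.unzip e = S.unzipWith e (Sum.inl g) := by
  refine ⟨h.choose, h.choose_spec.1, h.choose_spec.2, ?_⟩
  simp only [unzip, unzipWith, dif_pos h, doubledRot, unzipRot, unzipRev, mul_assoc]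

theorem unzip_eq_of_not_exists {S : MarkedMap} {e : S.Dart}
    (h : ¬ ∃ g ∈ S.grey, S.SameVertex e g) : S.unzip e = S.unzipWith e (Sum.inr false) := by
  simp only [unzip, unzipWith, dif_neg h, doubledRot, unzipRot, unzipRev, mul_assoc, Equiv.swap_self,
    ← Equiv.Perm.one_def, mul_one]

/-- The dart of the original map at the same end of the same edge. -/
def fold (S : MarkedMap) (e : S.Dart) : S.Dart ⊕ Bool → S.Dart
  | Sum.inl d => d
  | Sum.inr false => e
  | Sum.inr true => S.rev e

section

open scoped Classical

variable {S : MarkedMap} {e : S.Dart} {c : S.Dart ⊕ Bool}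

@[simp] theorem fold_inl (d : S.Dart) : S.fold e (Sum.inl d) = d := rfl
@[simp] theorem fold_false : S.fold e (Sum.inr false) = e := rfl
@[simp] theorem fold_true : S.fold e (Sum.inr true) = S.rev e := rfl

theorem doubledRot_inl_of_ne {d : S.Dart} (h1 : S.rot d ≠ e) (h2 : S.rot d ≠ S.rev e) :
    S.doubledRot e (Sum.inl d) = Sum.inl (S.rot d) := by
  simp only [doubledRot, Equiv.Perm.mul_apply, Perm.sumCongr_apply, Sum.map_inl]
  rw [Equiv.swap_apply_of_ne_of_ne (a := Sum.inl e) (by simpa using h1) (by simp),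
    Equiv.swap_apply_of_ne_of_ne (by simpa using h2) (by simp)]

theorem doubledRot_inl_rev {d : S.Dart} (h1 : S.rot d = S.rev e) (h2 : S.rev e ≠ e) :
    S.doubledRot e (Sum.inl d) = Sum.inr true := by
  simp only [doubledRot, Equiv.Perm.mul_apply, Perm.sumCongr_apply, Sum.map_inl, h1]
  rw [Equiv.swap_apply_of_ne_of_ne (a := Sum.inl e) (by simpa using h2) (by simp),
    Equiv.swap_apply_left]

theorem doubledRot_inl_self {d : S.Dart} (h1 : S.rot d = e) :
    S.doubledRot e (Sum.inl d) = Sum.inr false := by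
  simp only [doubledRot, Equiv.Perm.mul_apply, Perm.sumCongr_apply, Sum.map_inl, h1]
  rw [Equiv.swap_apply_left, Equiv.swap_apply_of_ne_of_ne (by simp) (by simp)]

theorem doubledRot_false (h : S.rev e ≠ e) :
    S.doubledRot e (Sum.inr false) = Sum.inl e := by
  simp only [doubledRot, Equiv.Perm.mul_apply, Perm.sumCongr_apply, Sum.map_inr,
    Equiv.Perm.one_apply, Equiv.swap_apply_right]
  rw [Equiv.swap_apply_of_ne_of_ne (by simpa using h.symm) (by simp)]

theorem doubledRot_true : S.doubledRot e (Sum.inr true) = Sum.inl (S.rev e) := by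
  simp only [doubledRot, Equiv.Perm.mul_apply, Perm.sumCongr_apply, Sum.map_inr,
    Equiv.Perm.one_apply]
  rw [Equiv.swap_apply_of_ne_of_ne (a := Sum.inl e) (by simp) (by simp), Equiv.swap_apply_right]

theorem fold_doubledRot (h : S.rev e ≠ e) (y : S.Dart ⊕ Bool) :
    S.SameVertex (S.fold e y) (S.fold e (S.doubledRot e y)) := by
  rcases y with d | _ | _
  · have hd : S.SameVertex d (S.rot d) := Perm.sameCycle_apply_right.2 SameVertex.rfl
    by_cases h1 : S.rot d = e
    · rw [doubledRot_inl_self h1, fold_inl, fold_false, ← h1]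
      exact hd
    by_cases h2 : S.rot d = S.rev e
    · rw [doubledRot_inl_rev h2 h, fold_inl, fold_true, ← h2]
      exact hd
    rw [doubledRot_inl_of_ne h1 h2]
    exact hd
  · rw [doubledRot_false h]
    exact SameVertex.rfl
  · rw [doubledRot_true]
    exact SameVertex.rfl

/-- Zipping up maps vertices to vertices: the doubled darts return to their original positions, and
the two halves of the origin of `e` are identified. -/
theorem fold_sameVertex (h : S.rev e ≠ e) (hc : S.SameVertex e (S.fold e c))
    {a b : S.Dart ⊕ Bool} (hab : (S.unzipRot e c).SameCycle a b) :
    S.SameVertex (S.fold e a) (S.fold e b) := by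
  refine Perm.SameCycle.lift (r := fun a b => S.SameVertex (S.fold e a) (S.fold e b))
    ⟨fun _ => SameVertex.rfl, SameVertex.symm, SameVertex.trans⟩ (fun y _ => ?_) hab
  have h2 : S.SameVertex (S.fold e y) (S.fold e (Equiv.swap (Sum.inr false) c y)) := by
    by_cases hy : y = Sum.inr false
    · rw [hy, Equiv.swap_apply_left]
      exact hc
    by_cases hy' : y = c
    · rw [hy', Equiv.swap_apply_right]
      exact hc.symm
    rw [Equiv.swap_apply_of_ne_of_ne hy hy']
    exact SameVertex.rfl
  exact h2.trans (fold_doubledRot h _)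

variable (S) in
theorem not_sameCycle_rot_inl_false (e : S.Dart) :
    ¬ (Perm.sumCongr S.rot (1 : Perm Bool)).SameCycle (Sum.inl e) (Sum.inr false) := by simp

theorem not_sameCycle_rot_rev_true : ¬ (Equiv.swap (Sum.inl e) (Sum.inr false) *
    Perm.sumCongr S.rot (1 : Perm Bool)).SameCycle (Sum.inl (S.rev e)) (Sum.inr true) := by
  intro h
  rcases h.of_swap_mul with h | ⟨-, h | h⟩
  · simp at h
  · simp at h
  · simp [Perm.sameCycle_one] at h

theorem doubledRot_sameCycle [Finite S.Dart] {a b : S.Dart} (hab : S.SameVertex a b) :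
    (S.doubledRot e).SameCycle (Sum.inl a) (Sum.inl b) := by
  have h1 : (Perm.sumCongr S.rot (1 : Perm Bool)).SameCycle (Sum.inl a) (Sum.inl b) :=
    sameCycle_sumCongr_inl.2 hab
  have h2 := Equiv.Perm.SameCycle.swap_mul not_sameCycle_rot_rev_true
    (Equiv.Perm.SameCycle.swap_mul (not_sameCycle_rot_inl_false S e) h1)
  unfold doubledRot
  convert h2

/-- The two new darts start out as fixed points, and each of the two swaps inserts one of them into
an existing vertex. -/
theorem numCycles_doubledRot [Finite S.Dart] : numCycles (S.doubledRot e) = numCycles S.rot := by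
  have h1 := numCycles_swap_mul (not_sameCycle_rot_inl_false S e)
  have h2 := numCycles_swap_mul (not_sameCycle_rot_rev_true (S := S) (e := e))
  rw [numCycles_sumCongr, numCycles_one, Nat.card_eq_fintype_card, Fintype.card_bool] at h1
  have h3 : numCycles (S.doubledRot e) + 1 = _ := h2
  omega

theorem unzipRot_apply (y : S.Dart ⊕ Bool) :
    S.unzipRot e c y = S.doubledRot e (Equiv.swap (Sum.inr false) c y) := by
  rfl

theorem unzipRot_false : S.unzipRot e c (Sum.inr false) = S.doubledRot e c := by
  rw [unzipRot_apply, Equiv.swap_apply_left]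

theorem unzipRot_corner (h : S.rev e ≠ e) : S.unzipRot e c c = Sum.inl e := by
  rw [unzipRot_apply, Equiv.swap_apply_right, doubledRot_false h]

theorem unzipRot_true (hc : c ≠ Sum.inr true) :
    S.unzipRot e c (Sum.inr true) = Sum.inl (S.rev e) := by
  rw [unzipRot_apply, Equiv.swap_apply_of_ne_of_ne (by simp) hc.symm, doubledRot_true]

theorem sameVertex_rot (S : MarkedMap) (d : S.Dart) : S.SameVertex d (S.rot d) :=
  Perm.sameCycle_apply_right.2 SameVertex.rfl

theorem unzipRot_true_rev (hc : c ≠ Sum.inr true) :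
    (S.unzipRot e c).SameCycle (Sum.inr true) (Sum.inl (S.rev e)) := by
  exact ⟨1, by rw [zpow_one, unzipRot_true hc]⟩

theorem unzipRot_corner_self (h : S.rev e ≠ e) :
    (S.unzipRot e c).SameCycle c (Sum.inl e) := by
  exact ⟨1, by rw [zpow_one, unzipRot_corner h]⟩

/-- Away from the origin of `e` the only change to the rotation is the new dart inserted just before
`rev e`. -/
theorem unzipRot_sameVertex_of_not (h : S.rev e ≠ e) (hc : S.SameVertex e (S.fold e c))
    (hc' : c ≠ Sum.inr true) {a b : S.Dart} (ha : ¬ S.SameVertex e a) (hab : S.SameVertex a b) :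
    (S.unzipRot e c).SameCycle (Sum.inl a) (Sum.inl b) := by
  refine Perm.SameCycle.lift (r := fun a b => (S.unzipRot e c).SameCycle (Sum.inl a) (Sum.inl b))
    ⟨fun _ => Perm.SameCycle.refl _ _, Perm.SameCycle.symm, Perm.SameCycle.trans⟩
    (fun y hy => ?_) hab
  have hey : ¬ S.SameVertex e y := fun h => ha (h.trans (SameVertex.symm hy))
  have h1 : (S.unzipRot e c).SameCycle (Sum.inl y) (S.unzipRot e c (Sum.inl y)) :=
    Perm.sameCycle_apply_right.2 (Perm.SameCycle.refl _ _)
  rw [unzipRot_apply, Equiv.swap_apply_of_ne_of_ne (by simp)] at h1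
  · have h2 : S.rot y ≠ e := by
      intro h2
      have := sameVertex_rot S y
      rw [h2] at this
      exact hey this.symm
    by_cases h3 : S.rot y = S.rev e
    · rw [doubledRot_inl_rev h3 h] at h1
      rw [h3]
      exact h1.trans (unzipRot_true_rev hc')
    · rwa [doubledRot_inl_of_ne h2 h3] at h1
  · rintro rfl
    exact hey hc

/-- Undoing the split by a swap on the left instead of the right, which is the form to which the
lemmas on cycles apply. -/
theorem doubledRot_eq : S.doubledRot e =
    Equiv.swap (S.unzipRot e c (Sum.inr false)) (S.unzipRot e c c) *
      S.unzipRot e c := by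
  have h : S.doubledRot e = S.unzipRot e c * Equiv.swap (Sum.inr false) c := by
    simp [unzipRot, mul_assoc]
  rw [← Equiv.mul_swap_eq_swap_mul, ← h]

theorem sameVertex_of_doubledRot (h : S.rev e ≠ e) {a b : S.Dart ⊕ Bool}
    (hab : (S.doubledRot e).SameCycle a b) : (S.unzipRot e c).SameCycle a b ∨
      (((S.unzipRot e c).SameCycle a (Sum.inr false) ∨
        (S.unzipRot e c).SameCycle a (Sum.inl e)) ∧
      ((S.unzipRot e c).SameCycle b (Sum.inr false) ∨
        (S.unzipRot e c).SameCycle b (Sum.inl e))) := by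
  rw [doubledRot_eq (c := c)] at hab
  have h1 : (S.unzipRot e c).SameCycle (Sum.inr false) (S.unzipRot e c (Sum.inr false)) :=
    Perm.sameCycle_apply_right.2 (Perm.SameCycle.refl _ _)
  rw [unzipRot_corner h] at hab
  rcases hab.of_swap_mul with h2 | ⟨h2, h3⟩
  · exact Or.inl h2
  · exact Or.inr ⟨h2.imp_left fun h => Perm.SameCycle.trans h h1.symm,
      h3.imp_left fun h => Perm.SameCycle.trans h h1.symm⟩

theorem unzipRot_sameVertex_self [Finite S.Dart] (h : S.rev e ≠ e) {a : S.Dart}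
    (ha : S.SameVertex e a) : (S.unzipRot e c).SameCycle (Sum.inl a) (Sum.inr false) ∨
      (S.unzipRot e c).SameCycle (Sum.inl a) (Sum.inl e) := by
  rcases sameVertex_of_doubledRot (c := c) h (doubledRot_sameCycle (e := e) ha.symm) with h1 | h1
  · exact Or.inr h1
  · exact h1.1

theorem sameVertex_doubledRot_false (h : S.rev e ≠ e) :
    (S.doubledRot e).SameCycle (Sum.inr false) (Sum.inl e) := by
  refine ⟨1, ?_⟩
  rw [zpow_one, doubledRot_false h]

theorem unzipRot_not_sameVertex [Finite S.Dart] (h : S.rev e ≠ e) {g : S.Dart}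
    (hg : S.SameVertex e g) :
    ¬ (S.unzipRot e (Sum.inl g)).SameCycle (Sum.inr false) (Sum.inl g) := by
  have h1 : (S.doubledRot e).SameCycle (Sum.inr false) (Sum.inl g) :=
    (sameVertex_doubledRot_false h).trans (doubledRot_sameCycle hg)
  have h2 := Equiv.Perm.not_sameCycle_swap_mul
    (a := S.doubledRot e (Sum.inr false)) (b := S.doubledRot e (Sum.inl g))
    (f := S.doubledRot e) (by simp) (by simpa using h1)
  rw [← Equiv.mul_swap_eq_swap_mul] at h2
  have h3 : S.doubledRot e * Equiv.swap (Sum.inr false) (Sum.inl g) =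
    S.unzipRot e (Sum.inl g) := by rfl
  rw [h3] at h2
  intro h4
  apply h2
  have e1 : S.doubledRot e (Sum.inr false) = S.unzipRot e (Sum.inl g) (Sum.inl g) := by
    rw [unzipRot_apply, Equiv.swap_apply_right]
  have e2 : S.doubledRot e (Sum.inl g) = S.unzipRot e (Sum.inl g) (Sum.inr false) := by
    rw [unzipRot_apply, Equiv.swap_apply_left]
  rw [e1, e2]
  simpa using Perm.SameCycle.symm h4

theorem numCycles_unzipRot [Finite S.Dart] (h : S.rev e ≠ e) {g : S.Dart}
    (hg : S.SameVertex e g) :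
    numCycles (S.unzipRot e (Sum.inl g)) = numCycles S.rot + 1 := by
  have h1 : (S.doubledRot e).SameCycle (Sum.inr false) (Sum.inl g) :=
    (sameVertex_doubledRot_false h).trans (doubledRot_sameCycle hg)
  have h2 := numCycles_swap_mul_of_sameCycle
    (a := S.doubledRot e (Sum.inr false)) (b := S.doubledRot e (Sum.inl g))
    (f := S.doubledRot e) (by simp) (by simpa using h1)
  rw [← Equiv.mul_swap_eq_swap_mul, numCycles_doubledRot] at h2
  exact h2

theorem numCycles_unzipRot_false [Finite S.Dart] :
    numCycles (S.unzipRot e (Sum.inr false)) = numCycles S.rot := by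
  have : S.unzipRot e (Sum.inr false) = S.doubledRot e := by
    simp only [unzipRot, Equiv.swap_self]
    rfl
  rw [this]
  exact numCycles_doubledRot

theorem unzipRev_apply (y : S.Dart ⊕ Bool) : S.unzipRev e y =
    Equiv.swap (Sum.inl (S.rev e)) (Sum.inr true) (Perm.sumCongr S.rev (Equiv.swap false true)
      (Equiv.swap (Sum.inl (S.rev e)) (Sum.inr true) y)) := by
  simp only [unzipRev, Equiv.Perm.mul_apply]

theorem unzipRev_true (hrev : S.rev (S.rev e) = e) (h : S.rev e ≠ e) :
    S.unzipRev e (Sum.inr true) = Sum.inl e := by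
  rw [unzipRev_apply, Equiv.swap_apply_right, Perm.sumCongr_apply, Sum.map_inl, hrev,
    Equiv.swap_apply_of_ne_of_ne (by simpa using h.symm) (by simp)]

theorem unzipRev_false : S.unzipRev e (Sum.inr false) = Sum.inl (S.rev e) := by
  rw [unzipRev_apply, Equiv.swap_apply_of_ne_of_ne (a := Sum.inl (S.rev e)) (x := Sum.inr false)
    (by simp) (by simp), Perm.sumCongr_apply,
    Sum.map_inr, Equiv.swap_apply_left, Equiv.swap_apply_right]

theorem unzipRev_inl_self (h : S.rev e ≠ e) : S.unzipRev e (Sum.inl e) = Sum.inr true := by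
  rw [unzipRev_apply, Equiv.swap_apply_of_ne_of_ne (x := Sum.inl e) (by simpa using h.symm) (by simp),
    Perm.sumCongr_apply, Sum.map_inl, Equiv.swap_apply_left]

theorem unzipRev_inl_rev : S.unzipRev e (Sum.inl (S.rev e)) = Sum.inr false := by
  rw [unzipRev_apply, Equiv.swap_apply_left, Perm.sumCongr_apply, Sum.map_inr,
    Equiv.swap_apply_right, Equiv.swap_apply_of_ne_of_ne (by simp) (by simp)]

theorem unzipRev_inl {d : S.Dart} (h1 : d ≠ e) (h2 : d ≠ S.rev e) :
    S.unzipRev e (Sum.inl d) = Sum.inl (S.rev d) := by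
  rw [unzipRev_apply, Equiv.swap_apply_of_ne_of_ne (x := Sum.inl d) (by simpa using h2) (by simp),
    Perm.sumCongr_apply, Sum.map_inl, Equiv.swap_apply_of_ne_of_ne (by simpa using h1) (by simp)]

/-- Doubling an edge preserves the old faces and adds a 2-gon formed by the two new darts. Splitting
the vertex acts on faces as a swap, which merges the 2-gon with the face of `c`, or does nothing if
`c` is the new dart. This formula carries all statements about the grey polygon. -/
theorem unzipRot_inv_mul_unzipRev (hrev : ∀ d, S.rev (S.rev d) = d) (h : S.rev e ≠ e) :
    (S.unzipRot e c)⁻¹ * S.unzipRev e =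
      Equiv.swap (Sum.inr false) c * Perm.sumCongr S.faceRot (Equiv.swap false true) := by
  rw [inv_mul_eq_iff_eq_mul, unzipRot, mul_assoc, ← mul_assoc (Equiv.swap (Sum.inr false) c),
    Equiv.swap_mul_self, one_mul]
  refine Equiv.ext fun y => ?_
  rw [Equiv.Perm.mul_apply, Perm.sumCongr_apply]
  rcases y with d | _ | _
  · have hf : S.rot (S.faceRot d) = S.rev d := by simp [faceRot]
    rw [Sum.map_inl]
    by_cases h1 : d = e
    · subst h1
      rw [unzipRev_inl_self h, doubledRot_inl_rev hf h]
    by_cases h2 : d = S.rev e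
    · rw [h2, unzipRev_inl_rev, doubledRot_inl_self (by rw [← h2, hf, h2, hrev])]
    rw [unzipRev_inl h1 h2, doubledRot_inl_of_ne, hf]
    · rw [hf]
      intro h3
      exact h2 (by rw [← h3, hrev])
    · rw [hf]
      exact fun h3 => h1 (S.rev.injective h3)
  · rw [unzipRev_false, Sum.map_inr, Equiv.swap_apply_left, doubledRot_true]
  · rw [unzipRev_true (hrev e) h, Sum.map_inr, Equiv.swap_apply_right, doubledRot_false h]

theorem unzipWith_faceRot (hrev : ∀ d, S.rev (S.rev d) = d) (h : S.rev e ≠ e) :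
    (S.unzipWith e c).faceRot =
      Equiv.swap (Sum.inr false) c * Perm.sumCongr S.faceRot (Equiv.swap false true) :=
  unzipRot_inv_mul_unzipRev hrev h

theorem unzipRev_unzipRev (hrev : ∀ d, S.rev (S.rev d) = d) (y : S.Dart ⊕ Bool) :
    S.unzipRev e (S.unzipRev e y) = y := by
  have h2 : S.unzipRev e * S.unzipRev e = 1 := by
    have h1 : Perm.sumCongr S.rev (Equiv.swap false true) *
        Perm.sumCongr S.rev (Equiv.swap false true) = 1 := by
      refine Equiv.ext fun y => ?_
      rcases y with d | _ | _ <;> simp [hrev]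
    rw [unzipRev]
    set s := Equiv.swap (Sum.inl (S.rev e)) (Sum.inr true : S.Dart ⊕ Bool) with hs
    set F := Perm.sumCongr S.rev (Equiv.swap false true)
    have hss : s * s = 1 := Equiv.swap_mul_self _ _
    calc s * F * s * (s * F * s) = s * F * (s * s) * F * s := by group
      _ = s * (F * F) * s := by rw [hss]; group
      _ = 1 := by rw [h1, mul_one, hss]
  exact congrFun (congrArg DFunLike.coe h2) y

theorem unzipRev_ne (hne : ∀ d, S.rev d ≠ d) (y : S.Dart ⊕ Bool) : S.unzipRev e y ≠ y := by
  rw [unzipRev_apply]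
  intro h
  rw [← Equiv.eq_symm_apply, Equiv.symm_swap] at h
  rcases hz : Equiv.swap (Sum.inl (S.rev e)) (Sum.inr true) y with d | _ | _ <;> rw [hz] at h
  · exact hne d (by simpa using h)
  · simp at h
  · simp at h

theorem numCycles_unzipWith_faceRot [Finite S.Dart] (hrev : ∀ d, S.rev (S.rev d) = d)
    (h : S.rev e ≠ e) (g : S.Dart) :
    numCycles (S.unzipWith e (Sum.inl g)).faceRot = numCycles S.faceRot := by
  have h1 := numCycles_swap_mul (f := Perm.sumCongr S.faceRot (Equiv.swap false true))
    (a := Sum.inr false) (b := Sum.inl g) (by simp)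
  rw [numCycles_sumCongr, numCycles_swap_false_true] at h1
  rw [unzipWith_faceRot hrev h]
  exact Nat.succ_injective h1

theorem numCycles_unzipWith_faceRot_false [Finite S.Dart] (hrev : ∀ d, S.rev (S.rev d) = d)
    (h : S.rev e ≠ e) :
    numCycles (S.unzipWith e (Sum.inr false)).faceRot = numCycles S.faceRot + 1 := by
  rw [unzipWith_faceRot hrev h, Equiv.swap_self, ← Equiv.Perm.one_def, one_mul]
  rw [← numCycles_swap_false_true, ← numCycles_sumCongr]
  rfl

/-- The two halves of the split vertex remain connected through the other endpoint, by the two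
copies of the edge. -/
theorem unzipWith_joined [Finite S.Dart] (hrev : ∀ d, S.rev (S.rev d) = d) (h : S.rev e ≠ e)
    (hc : c ≠ Sum.inr true)
    (hS : ∀ a b, S.Joined Set.univ a b) (a b : S.Dart ⊕ Bool) :
    (S.unzipWith e c).Joined Set.univ a b := by
  have symm : ∀ {a b : S.Dart ⊕ Bool}, (S.unzipWith e c).Joined Set.univ a b →
      (S.unzipWith e c).Joined Set.univ b a := fun h =>
    Joined.symm (S := S.unzipWith e c) (unzipRev_unzipRev hrev) (fun _ _ => Set.mem_univ _) h
  have hcyc : ∀ {a b : S.Dart ⊕ Bool}, (S.unzipRot e c).SameCycle a b →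
      (S.unzipWith e c).Joined Set.univ a b := fun h => .single (Or.inl h)
  have hr : ∀ y : S.Dart ⊕ Bool, (S.unzipWith e c).Joined Set.univ y (S.unzipRev e y) :=
    fun y => .single (Or.inr ⟨Set.mem_univ _, rfl⟩)
  have h1 : (S.unzipWith e c).Joined Set.univ (Sum.inl e) (Sum.inl (S.rev e)) := by
    have := hr (Sum.inl e)
    rw [unzipRev_inl_self h] at this
    exact this.trans (hcyc (unzipRot_true_rev hc))
  have h2 : (S.unzipWith e c).Joined Set.univ (Sum.inr false) (Sum.inl e) := by
    have := hr (Sum.inr false)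
    rw [unzipRev_false] at this
    exact this.trans (symm h1)
  have h3 : ∀ {a b : S.Dart}, S.SameVertex a b →
      (S.unzipWith e c).Joined Set.univ (Sum.inl a) (Sum.inl b) := by
    intro a b hab
    rcases sameVertex_of_doubledRot (c := c) h (doubledRot_sameCycle (e := e) hab)
      with k | ⟨k1, k2⟩
    · exact hcyc k
    · have k3 : (S.unzipWith e c).Joined Set.univ (Sum.inl a) (Sum.inl e) := by
        rcases k1 with k1 | k1
        · exact (hcyc k1).trans h2
        · exact hcyc k1
      have k4 : (S.unzipWith e c).Joined Set.univ (Sum.inl b) (Sum.inl e) := by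
        rcases k2 with k2 | k2
        · exact (hcyc k2).trans h2
        · exact hcyc k2
      exact k3.trans (symm k4)
  have h4 : ∀ d : S.Dart, (S.unzipWith e c).Joined Set.univ (Sum.inl d) (Sum.inl (S.rev d)) := by
    intro d
    by_cases d1 : d = e
    · rw [d1]
      exact h1
    by_cases d2 : d = S.rev e
    · rw [d2, hrev]
      exact symm h1
    have := hr (Sum.inl d)
    rwa [unzipRev_inl d1 d2] at this
  have h5 : ∀ a b : S.Dart, (S.unzipWith e c).Joined Set.univ (Sum.inl a) (Sum.inl b) := by
    intro a b
    induction hS a b with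
    | refl => exact .refl
    | tail _ hbc ih =>
      rcases hbc with hbc | ⟨-, rfl⟩
      · exact ih.trans (h3 hbc)
      · exact ih.trans (h4 _)
  have h6 : ∀ y : S.Dart ⊕ Bool, (S.unzipWith e c).Joined Set.univ y (Sum.inl e) := by
    rintro (d | _ | _)
    · exact h5 d e
    · exact h2
    · exact (hcyc (unzipRot_true_rev hc)).trans (symm h1)
  exact (h6 a).trans (symm (h6 b))

end

end MarkedMap

namespace MarkedMap

/-! ### Partially unzipped maps -/

/-- A map with a simple grey polygon with `2 * j` edges, which becomes a rooted planar map with `n`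
edges, `m + 1` vertices and `n - m + 1` faces when the polygon is zipped up. -/
structure IsZipped (n m j : ℕ) (S : MarkedMap) : Prop where
  finite : Finite S.Dart
  rev_rev : ∀ d, S.rev (S.rev d) = d
  rev_ne : ∀ d, S.rev d ≠ d
  connected : ∀ a b, S.Joined Set.univ a b
  edges : Nat.card S.Dart = 2 * (n + j)
  vertices : numCycles S.rot = m + max 1 j
  faces : numCycles S.faceRot + m = n + 1 + min 1 j
  grey_card : S.grey.ncard = 2 * j
  grey_faceRot : ∀ d ∈ S.grey, S.faceRot d ∈ S.grey
  grey_cycle : ∀ a ∈ S.grey, ∀ b ∈ S.grey, S.faceRot.SameCycle a b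
  grey_unique : ∀ a ∈ S.grey, ∀ b ∈ S.grey, S.SameVertex a b → a = b
  root_notMem : S.root ∉ S.grey

/-- The edge of `e` can be unzipped: it starts at the grey polygon, if there is one, and its endpoint is a
new vertex. -/
structure CanUnzip (j : ℕ) (S : MarkedMap) (e : S.Dart) : Prop where
  base : j = 0 ∨ ∃ g ∈ S.grey, S.SameVertex e g
  rev_grey : ∀ g ∈ S.grey, ¬ S.SameVertex (S.rev e) g
  rev_self : ¬ S.SameVertex e (S.rev e)

/-- The corner at which the origin of `e` is split when `e` is unzipped. -/
def IsCorner (j : ℕ) (S : MarkedMap) (e : S.Dart) (c : S.Dart ⊕ Bool) : Prop :=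
  (j = 0 ∧ c = Sum.inr false) ∨ (0 < j ∧ ∃ g ∈ S.grey, S.SameVertex e g ∧ c = Sum.inl g)

section

variable {n m j : ℕ} {S : MarkedMap} {e : S.Dart} {c : S.Dart ⊕ Bool}

theorem IsZipped.grey_eq_empty (h : S.IsZipped n m 0) : S.grey = ∅ := by
  have := h.finite
  exact (Set.ncard_eq_zero (Set.toFinite _)).1 h.grey_card

theorem IsZipped.isRootedPlanarMap (h : S.IsZipped n m 0) : S.IsRootedPlanarMap n m where
  finite := h.finite
  rev_rev := h.rev_rev
  rev_ne := h.rev_ne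
  connected := h.connected
  edges := h.edges
  vertices := h.vertices
  faces := h.faces
  grey := h.grey_eq_empty

theorem IsRootedPlanarMap.isZipped (h : S.IsRootedPlanarMap n m) : S.IsZipped n m 0 where
  finite := h.finite
  rev_rev := h.rev_rev
  rev_ne := h.rev_ne
  connected := h.connected
  edges := h.edges
  vertices := h.vertices
  faces := h.faces
  grey_card := by simp [h.grey]
  grey_faceRot := by simp [h.grey]
  grey_cycle := by simp [h.grey]
  grey_unique := by simp [h.grey]
  root_notMem := by simp [h.grey]

theorem IsZipped.exists_isCorner (h : S.IsZipped n m j) (he : S.CanUnzip j e) :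
    ∃ c, S.IsCorner j e c ∧ S.unzip e = S.unzipWith e c := by
  rcases Nat.eq_zero_or_pos j with rfl | hj
  · refine ⟨_, Or.inl ⟨rfl, rfl⟩, unzip_eq_of_not_exists ?_⟩
    simp [h.grey_eq_empty]
  · obtain ⟨g, hg, heg, e1⟩ := unzip_eq_of_exists (he.base.resolve_left hj.ne')
    exact ⟨_, Or.inr ⟨hj, g, hg, heg, rfl⟩, e1⟩

theorem IsCorner.ne_true (hc : S.IsCorner j e c) : c ≠ Sum.inr true := by
  rcases hc with ⟨-, rfl⟩ | ⟨-, g, -, -, rfl⟩ <;> simp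

theorem IsCorner.sameVertex (hc : S.IsCorner j e c) : S.SameVertex e (S.fold e c) := by
  rcases hc with ⟨-, rfl⟩ | ⟨-, g, -, hg, rfl⟩
  · exact SameVertex.rfl
  · exact hg

theorem mem_unzipWith_grey {y : S.Dart ⊕ Bool} : y ∈ (S.unzipWith e c).grey ↔
    (∃ g ∈ S.grey, y = Sum.inl g) ∨ y = Sum.inr false ∨ y = Sum.inr true := by
  have : y ∈ (Sum.inl '' S.grey ∪ {Sum.inr false, Sum.inr true} : Set (S.Dart ⊕ Bool)) ↔
      (∃ g ∈ S.grey, y = Sum.inl g) ∨ y = Sum.inr false ∨ y = Sum.inr true := by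
    simp only [Set.mem_union, Set.mem_image, Set.mem_insert_iff, Set.mem_singleton_iff,
      eq_comm (b := y)]
  exact this

theorem inl_mem_unzipWith_grey {d : S.Dart} :
    (Sum.inl d : S.Dart ⊕ Bool) ∈ (S.unzipWith e c).grey ↔ d ∈ S.grey := by
  rw [mem_unzipWith_grey]
  simp

theorem unzipWith_faceRot_false (hrev : ∀ d, S.rev (S.rev d) = d) (h : S.rev e ≠ e)
    (hc : c ≠ Sum.inr true) :
    (S.unzipWith e c).faceRot (Sum.inr false) = (Sum.inr true : S.Dart ⊕ Bool) := by
  classical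
  rw [unzipWith_faceRot hrev h]
  show Equiv.swap (Sum.inr false) c (Sum.inr (Equiv.swap false true false)) = _
  rw [Equiv.swap_apply_left, Equiv.swap_apply_of_ne_of_ne (by simp) hc.symm]

theorem unzipWith_faceRot_true (hrev : ∀ d, S.rev (S.rev d) = d) (h : S.rev e ≠ e) :
    (S.unzipWith e c).faceRot (Sum.inr true) = c := by
  classical
  rw [unzipWith_faceRot hrev h]
  show Equiv.swap (Sum.inr false) c (Sum.inr (Equiv.swap false true true)) = _
  rw [Equiv.swap_apply_right, Equiv.swap_apply_left]

open Classical in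
theorem unzipWith_faceRot_inl (hrev : ∀ d, S.rev (S.rev d) = d) (h : S.rev e ≠ e) (d : S.Dart) :
    (S.unzipWith e c).faceRot (Sum.inl d) =
      Equiv.swap (Sum.inr false) c (Sum.inl (S.faceRot d)) := by
  rw [unzipWith_faceRot hrev h]
  rfl

/-- Simplicity of the polygon persists: after zipping up, the only two distinct grey corners at a
common vertex are the new corner and the old one at the origin of `e`, and exactly these are
separated by the split. -/
theorem IsZipped.unzipWith_grey_unique (h : S.IsZipped n m j) (he : S.CanUnzip j e)
    (hc : S.IsCorner j e c) (a b : S.Dart ⊕ Bool) (ha : a ∈ (S.unzipWith e c).grey)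
    (hb : b ∈ (S.unzipWith e c).grey) (hab : (S.unzipWith e c).SameVertex a b) : a = b := by
  have := h.finite
  have hf := fold_sameVertex (h.rev_ne e) hc.sameVertex hab
  have key : ∀ g ∈ S.grey, S.SameVertex e g →
      ¬ (S.unzipWith e c).SameVertex (Sum.inr false) (Sum.inl g) := by
    intro g hg heg
    rcases hc with ⟨rfl, -⟩ | ⟨-, g', hg', heg', rfl⟩
    · rw [h.grey_eq_empty] at hg
      exact absurd hg (Set.notMem_empty g)
    · rw [h.grey_unique g hg g' hg' (heg.symm.trans heg')]
      exact unzipRot_not_sameVertex (h.rev_ne e) heg'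
  rw [mem_unzipWith_grey] at ha hb
  rcases ha with ⟨g, hg, rfl⟩ | rfl | rfl <;> rcases hb with ⟨g', hg', rfl⟩ | rfl | rfl
  · rw [h.grey_unique g hg g' hg' hf]
  · exact absurd hab.symm (key g hg hf.symm)
  · exact absurd hf.symm (he.rev_grey g hg)
  · exact absurd hab (key g' hg' hf)
  · rfl
  · exact absurd hf he.rev_self
  · exact absurd hf (he.rev_grey g' hg')
  · exact absurd hf.symm he.rev_self
  · rfl

theorem ncard_unzipWith_grey [Finite S.Dart] :
    (S.unzipWith e c).grey.ncard = S.grey.ncard + 2 := by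
  have h1 : (Sum.inl '' S.grey ∪ {Sum.inr false, Sum.inr true} : Set (S.Dart ⊕ Bool)).ncard =
      S.grey.ncard + 2 := by
    rw [Set.ncard_union_eq, Set.ncard_image_of_injective _ Sum.inl_injective, Set.ncard_pair]
    · simp
    · rw [Set.disjoint_left]
      rintro y ⟨d, -, rfl⟩
      simp
  exact h1

/-- The first unzipping adds the grey face and no vertex, each later one splits a vertex and adds no
face; hence `max 1 j` and `min 1 j` in the Euler data. On faces, the 2-gon is inserted into the grey
cycle. -/
theorem IsZipped.unzipWith (h : S.IsZipped n m j) (he : S.CanUnzip j e)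
    (hc : S.IsCorner j e c) : (S.unzipWith e c).IsZipped n m (j + 1) := by
  classical
  have := h.finite
  have hne := h.rev_ne e
  refine ⟨inferInstanceAs (Finite (S.Dart ⊕ Bool)), unzipRev_unzipRev h.rev_rev,
    unzipRev_ne h.rev_ne, unzipWith_joined h.rev_rev hne hc.ne_true h.connected, ?_, ?_, ?_, ?_, ?_,
    ?_, fun a ha b hb => h.unzipWith_grey_unique he hc a b ha hb, fun hr => h.root_notMem (inl_mem_unzipWith_grey.1 hr)⟩
  · have : Nat.card (S.Dart ⊕ Bool) = 2 * (n + (j + 1)) := by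
      rw [Nat.card_sum, h.edges, Nat.card_eq_fintype_card, Fintype.card_bool]
      ring
    exact this
  · have hv := h.vertices
    rcases hc with ⟨rfl, rfl⟩ | ⟨hj, g, hg, heg, rfl⟩
    · have := numCycles_unzipRot_false (S := S) (e := e)
      have : numCycles (S.unzipWith e (Sum.inr false)).rot = numCycles S.rot := this
      omega
    · have : numCycles (S.unzipWith e (Sum.inl g)).rot = numCycles S.rot + 1 :=
        numCycles_unzipRot hne heg
      omega
  · have hv := h.faces
    rcases hc with ⟨rfl, rfl⟩ | ⟨hj, g, hg, heg, rfl⟩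
    · rw [numCycles_unzipWith_faceRot_false h.rev_rev hne]
      omega
    · rw [numCycles_unzipWith_faceRot h.rev_rev hne]
      omega
  · rw [ncard_unzipWith_grey, h.grey_card]
    ring
  · intro y hy
    rcases mem_unzipWith_grey.1 hy with ⟨g, hg, rfl⟩ | rfl | rfl
    · rw [unzipWith_faceRot_inl h.rev_rev hne]
      by_cases h1 : Sum.inl (S.faceRot g) = c
      · rw [h1, Equiv.swap_apply_right]
        exact mem_unzipWith_grey.2 (Or.inr (Or.inl rfl))
      · rw [Equiv.swap_apply_of_ne_of_ne (by simp) h1]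
        exact inl_mem_unzipWith_grey.2 (h.grey_faceRot g hg)
    · rw [unzipWith_faceRot_false h.rev_rev hne hc.ne_true]
      exact mem_unzipWith_grey.2 (Or.inr (Or.inr rfl))
    · rw [unzipWith_faceRot_true h.rev_rev hne]
      rcases hc with ⟨rfl, rfl⟩ | ⟨hj, g, hg, heg, rfl⟩
      · exact mem_unzipWith_grey.2 (Or.inr (Or.inl rfl))
      · exact inl_mem_unzipWith_grey.2 hg
  · have key : ∀ y : S.Dart ⊕ Bool, y ∈ (S.unzipWith e c).grey →
        (S.unzipWith e c).faceRot.SameCycle y (Sum.inr false) := by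
      intro y hy
      rcases mem_unzipWith_grey.1 hy with ⟨g, hg, rfl⟩ | rfl | rfl
      · rcases hc with ⟨rfl, rfl⟩ | ⟨hj, g', hg', heg, rfl⟩
        · rw [h.grey_eq_empty] at hg
          exact absurd hg (Set.notMem_empty g)
        · rw [unzipWith_faceRot h.rev_rev hne]
          have hn : ¬ (Perm.sumCongr S.faceRot (Equiv.swap false true)).SameCycle
            (Sum.inr false) (Sum.inl g') := by simp
          have h1 := Equiv.Perm.SameCycle.swap_mul hn
            (sameCycle_sumCongr_inl.2 (h.grey_cycle g hg g' hg'))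
          exact h1.trans (Equiv.Perm.sameCycle_swap_mul hn).symm
      · exact Perm.SameCycle.refl _ _
      · refine Perm.SameCycle.symm ⟨1, ?_⟩
        rw [zpow_one, unzipWith_faceRot_false h.rev_rev hne hc.ne_true]
    exact fun a ha b hb => (key a ha).trans (key b hb).symm

theorem IsZipped.unzip (h : S.IsZipped n m j) (he : S.CanUnzip j e) :
    (S.unzip e).IsZipped n m (j + 1) := by
  obtain ⟨c, hc, e1⟩ := h.exists_isCorner he
  rw [e1]
  exact h.unzipWith he hc

end

/-! ### Isomorphisms -/

section

variable {n m j : ℕ} {S S' : MarkedMap} {φ : S.Dart ≃ S'.Dart}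

theorem IsIso.sameVertex_iff (h : IsIso S S' φ) {a b : S.Dart} :
    S'.SameVertex (φ a) (φ b) ↔ S.SameVertex a b := by
  refine ⟨fun hab => ?_, sameVertex_of_conj φ h.rot⟩
  simpa using sameVertex_of_conj φ.symm h.symm.rot hab

theorem IsIso.faceRot (h : IsIso S S' φ) (d : S.Dart) : φ (S.faceRot d) = S'.faceRot (φ d) := by
  have h1 : S.rot (S.faceRot d) = S.rev d := by simp [MarkedMap.faceRot]
  have h2 : S'.rot (S'.faceRot (φ d)) = S'.rev (φ d) := by simp [MarkedMap.faceRot]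
  apply S'.rot.injective
  rw [h2, ← h.rot, h1, h.rev]

/-- Faces and edges determine the vertices, since `rot` is `rev * faceRot⁻¹`. Unzipping is easier to
invert on faces than on vertices. -/
theorem rot_comm_of_faceRot_comm (hf : ∀ d, φ (S.faceRot d) = S'.faceRot (φ d))
    (hr : ∀ d, φ (S.rev d) = S'.rev (φ d)) (d : S.Dart) : φ (S.rot d) = S'.rot (φ d) := by
  obtain ⟨y, rfl⟩ := S.faceRot.surjective d
  have h1 : S.rot (S.faceRot y) = S.rev y := by simp [MarkedMap.faceRot]
  have h2 : S'.rot (S'.faceRot (φ y)) = S'.rev (φ y) := by simp [MarkedMap.faceRot]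
  rw [h1, hr, hf, h2]

theorem IsIso.faceRot_sameCycle_iff (h : IsIso S S' φ) {a b : S.Dart} :
    S'.faceRot.SameCycle (φ a) (φ b) ↔ S.faceRot.SameCycle a b := by
  have hz : ∀ (i : ℤ) a, φ ((S.faceRot ^ i) a) = (S'.faceRot ^ i) (φ a) := by
    intro i a
    have hc : S'.faceRot = φ.permCongr S.faceRot := by
      ext x
      simp [Equiv.permCongr_apply, h.faceRot]
    have hp : S'.faceRot ^ i = φ.permCongr (S.faceRot ^ i) := by
      rw [hc]
      exact (map_zpow (φ.permCongrHom) S.faceRot i).symm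
    rw [hp, Equiv.permCongr_apply, Equiv.symm_apply_apply]
  simp only [Perm.SameCycle, ← hz, EmbeddingLike.apply_eq_iff_eq]

theorem IsIso.joined (h : IsIso S S' φ) {a b : S.Dart} (hab : S.Joined Set.univ a b) :
    S'.Joined Set.univ (φ a) (φ b) := by
  induction hab with
  | refl => exact .refl
  | tail _ hbc ih =>
    refine ih.tail ?_
    rcases hbc with hbc | ⟨-, rfl⟩
    · exact Or.inl (h.sameVertex_iff.2 hbc)
    · exact Or.inr ⟨Set.mem_univ _, h.rev _⟩

theorem IsIso.image_grey (h : IsIso S S' φ) : φ '' S.grey = S'.grey := by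
  ext y
  constructor
  · rintro ⟨d, hd, rfl⟩
    exact (h.grey d).2 hd
  · intro hy
    exact ⟨φ.symm y, by rwa [← h.grey, Equiv.apply_symm_apply], by simp⟩

theorem IsZipped.of_isIso (hS : S.IsZipped n m j) (h : IsIso S S' φ) : S'.IsZipped n m j := by
  have := hS.finite
  refine ⟨Finite.of_equiv _ φ, ?_, ?_, ?_, ?_, ?_, ?_, ?_, ?_, ?_, ?_, ?_⟩
  · intro d
    obtain ⟨d, rfl⟩ := φ.surjective d
    rw [← h.rev, ← h.rev, hS.rev_rev]
  · intro d
    obtain ⟨d, rfl⟩ := φ.surjective d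
    rw [← h.rev]
    exact fun h' => hS.rev_ne d (φ.injective h')
  · intro a b
    obtain ⟨a, rfl⟩ := φ.surjective a
    obtain ⟨b, rfl⟩ := φ.surjective b
    exact h.joined (hS.connected a b)
  · rw [← Nat.card_congr φ, hS.edges]
  · rw [← numCycles_permCongr φ h.rot, hS.vertices]
  · rw [← numCycles_permCongr φ h.faceRot, hS.faces]
  · rw [← h.image_grey, Set.ncard_image_of_injective _ φ.injective, hS.grey_card]
  · rw [← h.image_grey]
    rintro _ ⟨d, hd, rfl⟩
    exact ⟨_, hS.grey_faceRot d hd, h.faceRot d⟩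
  · rw [← h.image_grey]
    rintro _ ⟨a, ha, rfl⟩ _ ⟨b, hb, rfl⟩
    exact h.faceRot_sameCycle_iff.2 (hS.grey_cycle a ha b hb)
  · rw [← h.image_grey]
    rintro _ ⟨a, ha, rfl⟩ _ ⟨b, hb, rfl⟩ hab
    rw [hS.grey_unique a ha b hb (h.sameVertex_iff.1 hab)]
  · rw [← h.image_grey, ← h.root]
    rintro ⟨d, hd, hd'⟩
    exact hS.root_notMem (φ.injective hd' ▸ hd)

theorem IsIso.canUnzip (h : IsIso S S' φ) {e : S.Dart} (he : S.CanUnzip j e) :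
    S'.CanUnzip j (φ e) := by
  refine ⟨he.base.imp_right ?_, ?_, ?_⟩
  · rintro ⟨g, hg, heg⟩
    exact ⟨φ g, (h.grey g).2 hg, h.sameVertex_iff.2 heg⟩
  · rw [← h.image_grey]
    rintro _ ⟨g, hg, rfl⟩ hr
    rw [← h.rev, h.sameVertex_iff] at hr
    exact he.rev_grey g hg hr
  · rw [← h.rev, h.sameVertex_iff]
    exact he.rev_self

theorem IsIso.map_unzipRot (h : IsIso S S' φ) (e : S.Dart) (c y : S.Dart ⊕ Bool) :
    Sum.map φ id (S.unzipRot e c y) = S'.unzipRot (φ e) (Sum.map φ id c) (Sum.map φ id y) := by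
  classical
  have hinj : Function.Injective (Sum.map φ id : S.Dart ⊕ Bool → S'.Dart ⊕ Bool) :=
    φ.injective.sumMap Function.injective_id
  simp only [unzipRot, doubledRot, Equiv.Perm.mul_apply]
  rw [hinj.map_swap, hinj.map_swap, Sum.map_inl, Sum.map_inl, Sum.map_inr, Sum.map_inr, h.rev]
  simp only [id]
  congr 2
  rw [show (Sum.inr false : S'.Dart ⊕ Bool) = Sum.map φ id (Sum.inr false : S.Dart ⊕ Bool) from rfl,
    ← hinj.map_swap]
  rcases Equiv.swap (Sum.inr false) c y with d | b
  · simp [h.rot]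
  · simp

theorem IsIso.map_unzipRev (h : IsIso S S' φ) (e : S.Dart) (y : S.Dart ⊕ Bool) :
    Sum.map φ id (S.unzipRev e y) = S'.unzipRev (φ e) (Sum.map φ id y) := by
  classical
  have hinj : Function.Injective (Sum.map φ id : S.Dart ⊕ Bool → S'.Dart ⊕ Bool) :=
    φ.injective.sumMap Function.injective_id
  simp only [unzipRev, Equiv.Perm.mul_apply]
  rw [hinj.map_swap, Sum.map_inl, Sum.map_inr, h.rev]
  simp only [id]
  congr 1
  rw [show (Sum.inr true : S'.Dart ⊕ Bool) = Sum.map φ id (Sum.inr true : S.Dart ⊕ Bool) from rfl,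
    ← h.rev, show (Sum.inl (φ (S.rev e)) : S'.Dart ⊕ Bool) =
      Sum.map φ id (Sum.inl (S.rev e) : S.Dart ⊕ Bool) from rfl, ← hinj.map_swap]
  rcases Equiv.swap (Sum.inl (S.rev e)) (Sum.inr true) y with d | b
  · simp [h.rev]
  · simp

/-- Isomorphisms preserve the target only as a vertex. If it were the origin of `e`, which gets
split, its image could end up in the other half; this is why `ht` is needed. -/
theorem IsIso.unzipWith (h : IsIso S S' φ) {e : S.Dart} {c : S.Dart ⊕ Bool}
    (hne : ∀ d, S.rev d ≠ d) (hc : S.SameVertex e (S.fold e c)) (hc' : c ≠ Sum.inr true)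
    (ht : ¬ S.SameVertex e S.target) :
    IsIso (S.unzipWith e c) (S'.unzipWith (φ e) (Sum.map φ id c))
      (Equiv.sumCongr φ (Equiv.refl Bool)) := by
  refine ⟨fun y => h.map_unzipRot e c y, fun y => h.map_unzipRev e y,
    congrArg Sum.inl h.root, ?_, SameVertex.rfl, ?_⟩
  · rintro (d | b)
    · exact inl_mem_unzipWith_grey.trans ((h.grey d).trans inl_mem_unzipWith_grey.symm)
    · have : ∀ (T : MarkedMap) (e : T.Dart) c, (Sum.inr b : T.Dart ⊕ Bool) ∈
          (T.unzipWith e c).grey := by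
        intro T e c
        rw [mem_unzipWith_grey]
        cases b <;> simp
      exact iff_of_true (this _ _ _) (this _ _ _)
  · have h1 : (S.unzipRot e c).SameCycle (Sum.inl S.target) (Sum.inl (φ.symm S'.target)) := by
      refine unzipRot_sameVertex_of_not (hne e) hc hc' ht ?_
      rw [← h.sameVertex_iff, Equiv.apply_symm_apply]
      exact h.target
    have h2 := sameVertex_of_conj (S := S.unzipWith e c)
      (S' := S'.unzipWith (φ e) (Sum.map φ id c)) (Equiv.sumCongr φ (Equiv.refl Bool))
      (fun y => h.map_unzipRot e c y) h1
    have h3 : Equiv.sumCongr φ (Equiv.refl Bool) (Sum.inl (φ.symm S'.target)) =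
      Sum.inl S'.target := by simp
    exact Eq.mp (congrArg (fun z : S'.Dart ⊕ Bool => (S'.unzipWith (φ e) (Sum.map φ id c)).SameVertex
      (Sum.inl (φ S.target)) z) h3) h2

theorem IsCorner.unique (hS : S.IsZipped n m j) {e : S.Dart} {c c' : S.Dart ⊕ Bool}
    (hc : S.IsCorner j e c) (hc' : S.IsCorner j e c') : c = c' := by
  rcases hc with ⟨h0, rfl⟩ | ⟨h0, g, hg, heg, rfl⟩ <;>
    rcases hc' with ⟨h0', rfl⟩ | ⟨h0', g', hg', heg', rfl⟩
  · rfl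
  · omega
  · omega
  · rw [hS.grey_unique g hg g' hg' (heg.symm.trans heg')]

theorem IsIso.isCorner (h : IsIso S S' φ) {e : S.Dart} {c : S.Dart ⊕ Bool}
    (hc : S.IsCorner j e c) : S'.IsCorner j (φ e) (Sum.map φ id c) := by
  rcases hc with ⟨h0, rfl⟩ | ⟨h0, g, hg, heg, rfl⟩
  · exact Or.inl ⟨h0, rfl⟩
  · exact Or.inr ⟨h0, φ g, (h.grey g).2 hg, h.sameVertex_iff.2 heg, rfl⟩

theorem IsIso.unzip (h : IsIso S S' φ) (hS : S.IsZipped n m j) {e : S.Dart}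
    (he : S.CanUnzip j e) (ht : ¬ S.SameVertex e S.target) :
    (⟦S.unzip e⟧ : IsoClass) = ⟦S'.unzip (φ e)⟧ := by
  obtain ⟨c, hc, e1⟩ := hS.exists_isCorner he
  obtain ⟨c', hc', e2⟩ := (hS.of_isIso h).exists_isCorner (h.canUnzip he)
  have := IsCorner.unique (hS.of_isIso h) (h.isCorner hc) hc'
  rw [e1, e2, ← this]
  exact Quotient.sound ⟨_, h.unzipWith hS.rev_ne hc.sameVertex hc.ne_true ht⟩

end

end MarkedMap

namespace MarkedMap

/-! ### Zipping up: uniqueness -/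

section

variable {n m j : ℕ} {S S' : MarkedMap}

theorem mem_cluster {d : S.Dart} :
    d ∈ S.cluster ↔ S.SameVertex S.tip d ∨ ∃ g ∈ S.grey, S.SameVertex g d := Iff.rfl

/-- The tip is on the grey polygon, if there is one. -/
def TipOnGrey (j : ℕ) (S : MarkedMap) : Prop := 0 < j → ∃ g ∈ S.grey, S.SameVertex S.tip g

theorem cluster_congr {a b : S.Dart} (hab : S.SameVertex a b) (ha : a ∈ S.cluster) :
    b ∈ S.cluster := by
  rcases ha with ha | ⟨g, hg, ha⟩
  · exact Or.inl (SameVertex.trans ha hab)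
  · exact Or.inr ⟨g, hg, ha.trans hab⟩

theorem canUnzip_of_mem_cluster (ht : S.TipOnGrey j) {e : S.Dart} (he : e ∈ S.cluster)
    (he' : S.rev e ∉ S.cluster) : S.CanUnzip j e := by
  refine ⟨?_, fun g hg h => he' (Or.inr ⟨g, hg, h.symm⟩), fun h => he' (cluster_congr h he)⟩
  rcases Nat.eq_zero_or_pos j with h | h
  · exact Or.inl h
  · right
    rcases he with he | ⟨g, hg, he⟩
    · obtain ⟨g, hg, htg⟩ := ht h
      exact ⟨g, hg, (SameVertex.symm he).trans htg⟩
    · exact ⟨g, hg, he.symm⟩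

theorem exists_restrict_of_apply_inr {α β : Type*} (Φ : α ⊕ Bool ≃ β ⊕ Bool)
    (h : ∀ b, Φ (Sum.inr b) = Sum.inr b) : ∃ φ : α ≃ β, ∀ d, Φ (Sum.inl d) = Sum.inl (φ d) := by
  have h' : ∀ b, Φ.symm (Sum.inr b) = Sum.inr b := fun b => by rw [Equiv.symm_apply_eq, h]
  have h1 : ∀ d, ∃ d', Φ (Sum.inl d) = Sum.inl d' := by
    intro d
    rcases hd : Φ (Sum.inl d) with d' | b
    · exact ⟨d', rfl⟩
    · rw [← h b] at hd
      exact absurd (Φ.injective hd) (by simp)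
  have h2 : ∀ d, ∃ d', Φ.symm (Sum.inl d) = Sum.inl d' := by
    intro d
    rcases hd : Φ.symm (Sum.inl d) with d' | b
    · exact ⟨d', rfl⟩
    · rw [← h' b] at hd
      exact absurd (Φ.symm.injective hd) (by simp)
  choose f hf using h1
  choose g hg using h2
  refine ⟨⟨f, g, fun d => ?_, fun d => ?_⟩, hf⟩
  · have : (Sum.inl (g (f d)) : α ⊕ Bool) = Sum.inl d := by rw [← hg, ← hf, Equiv.symm_apply_apply]
    exact Sum.inl_injective this
  · have : (Sum.inl (f (g d)) : β ⊕ Bool) = Sum.inl d := by rw [← hf, ← hg, Equiv.apply_symm_apply]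
    exact Sum.inl_injective this

/-- A map is determined by the result of unzipping an edge at its tip. -/
theorem exists_isIso_of_unzip (hS : S.IsZipped n m j) (hS' : S'.IsZipped n m j)
    {e : S.Dart} {e' : S'.Dart} (he : S.CanUnzip j e) (he' : S'.CanUnzip j e')
    (htip : S.SameVertex e S.tip) (htip' : S'.SameVertex e' S'.tip)
    (h : (⟦S.unzip e⟧ : IsoClass) = ⟦S'.unzip e'⟧) :
    ∃ φ : S.Dart ≃ S'.Dart, IsIso S S' φ ∧ φ e = e' := by
  classical
  obtain ⟨c, hc, e1⟩ := hS.exists_isCorner he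
  obtain ⟨c', hc', e2⟩ := hS'.exists_isCorner he'
  rw [e1, e2] at h
  obtain ⟨Φ, hΦ⟩ : ∃ Φ : S.Dart ⊕ Bool ≃ S'.Dart ⊕ Bool,
    IsIso (S.unzipWith e c) (S'.unzipWith e' c') Φ := Quotient.exact h
  have hU' := hS'.unzipWith he' hc'
  -- The new tip has only one grey corner, so an isomorphism preserves it. Its neighbours along the
  -- polygon, `inr false` and `c`, are then preserved too.
  have ht : Φ (Sum.inr true) = Sum.inr true := by
    refine hU'.grey_unique _ ((hΦ.grey _).2 ?_) _ ?_ hΦ.tip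
    · exact mem_unzipWith_grey.2 (Or.inr (Or.inr rfl))
    · exact mem_unzipWith_grey.2 (Or.inr (Or.inr rfl))
  have hfalse : Φ (Sum.inr false) = Sum.inr false := by
    apply (S'.unzipWith e' c').faceRot.injective
    have h1 := hΦ.faceRot (Sum.inr false)
    have h2 := unzipWith_faceRot_false (c := c) hS.rev_rev (hS.rev_ne e) hc.ne_true
    have h3 := unzipWith_faceRot_false (c := c') hS'.rev_rev (hS'.rev_ne e') hc'.ne_true
    exact h1.symm.trans (((congrArg Φ h2).trans ht).trans h3.symm)
  have hcc : Φ c = c' := by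
    have h1 := hΦ.faceRot (Sum.inr true)
    have h2 := unzipWith_faceRot_true (c := c) hS.rev_rev (hS.rev_ne e)
    have h3 := unzipWith_faceRot_true (c := c') hS'.rev_rev (hS'.rev_ne e')
    exact ((congrArg Φ h2).symm.trans h1).trans ((congrArg (S'.unzipWith e' c').faceRot ht).trans h3)
  have hrevΦ : ∀ y : S.Dart ⊕ Bool, Φ (S.unzipRev e y) = S'.unzipRev e' (Φ y) := hΦ.rev
  obtain ⟨φ, hφ⟩ := exists_restrict_of_apply_inr Φ (by rintro (_ | _) <;> assumption)
  have he1 : φ e = e' := by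
    apply Sum.inl_injective (β := Bool)
    rw [← hφ, ← unzipRev_true (hS.rev_rev e) (hS.rev_ne e), hrevΦ, ht,
      unzipRev_true (hS'.rev_rev e') (hS'.rev_ne e')]
  have he2 : φ (S.rev e) = S'.rev e' := by
    apply Sum.inl_injective (β := Bool)
    rw [← hφ, ← unzipRev_false, hrevΦ, hfalse, unzipRev_false]
  have hrev : ∀ d, φ (S.rev d) = S'.rev (φ d) := by
    intro d
    by_cases h1 : d = e
    · rw [h1, he2, he1]
    by_cases h2 : d = S.rev e
    · rw [h2, he2, hS.rev_rev, hS'.rev_rev, he1]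
    have h3 := hrevΦ (Sum.inl d)
    rw [unzipRev_inl h1 h2, hφ, hφ, unzipRev_inl] at h3
    · exact Sum.inl_injective h3
    · rw [← he1]
      exact fun h => h1 (φ.injective h)
    · rw [← he2]
      exact fun h => h2 (φ.injective h)
  -- On both sides the face rotation of the old darts is recovered by removing the same swap, whose
  -- entries correspond under `Φ`.
  have hface : ∀ d, φ (S.faceRot d) = S'.faceRot (φ d) := by
    intro d
    have h1 : Φ ((S.unzipWith e c).faceRot (Sum.inl d)) =
      (S'.unzipWith e' c').faceRot (Φ (Sum.inl d)) := hΦ.faceRot (Sum.inl d)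
    have h2 := unzipWith_faceRot_inl (c := c) hS.rev_rev (hS.rev_ne e) d
    have h3 := unzipWith_faceRot_inl (c := c') hS'.rev_rev (hS'.rev_ne e') (φ d)
    rw [hφ] at h1
    have h4 := ((congrArg Φ h2).symm.trans h1).trans h3
    rw [Φ.injective.map_swap, hfalse, hcc, hφ] at h4
    exact Sum.inl_injective ((Equiv.swap _ _).injective h4)
  refine ⟨φ, ⟨rot_comm_of_faceRot_comm hface hrev, hrev, ?_, fun d => ?_, ?_, ?_⟩, he1⟩
  · apply Sum.inl_injective (β := Bool)
    rw [← hφ]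
    exact hΦ.root
  · have h1 := hΦ.grey (Sum.inl d)
    have h2 : Φ (Sum.inl d) ∈ (S'.unzipWith e' c').grey ↔ φ d ∈ S'.grey := by
      rw [hφ]
      exact inl_mem_unzipWith_grey
    exact h2.symm.trans (h1.trans inl_mem_unzipWith_grey)
  · have h1 := sameVertex_of_conj φ (rot_comm_of_faceRot_comm hface hrev) htip.symm
    rw [he1] at h1
    exact h1.trans htip'
  · have h1 : (S'.unzipWith e' c').SameVertex (Φ (Sum.inl S.target)) (Sum.inl S'.target) :=
      hΦ.target
    rw [hφ] at h1
    exact fold_sameVertex (hS'.rev_ne e') hc'.sameVertex h1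

/-- Rooted maps have no automorphisms. -/
theorem eq_of_isIso (hS : ∀ a b, S.Joined Set.univ a b) {φ ψ : S.Dart ≃ S'.Dart}
    (hφ : IsIso S S' φ) (hψ : IsIso S S' ψ) : φ = ψ := by
  ext d
  have hrot : ∀ a b, S.SameVertex a b → φ a = ψ a → φ b = ψ b := by
    intro a b hab ha
    refine (Perm.SameCycle.lift (r := fun a b => φ a = ψ a ↔ φ b = ψ b)
      ⟨fun _ => Iff.rfl, Iff.symm, Iff.trans⟩ (fun y _ => ?_) hab).1 ha
    rw [hφ.rot, hψ.rot, EmbeddingLike.apply_eq_iff_eq]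
  induction hS S.root d with
  | refl => rw [hφ.root, hψ.root]
  | tail _ hbc ih =>
    rcases hbc with hbc | ⟨-, rfl⟩
    · exact hrot _ _ hbc ih
    · rw [hφ.rev, hψ.rev, ih]

end

/-! ### Zipping up: existence -/

section

variable {S : MarkedMap} {e : S.Dart} {c : S.Dart ⊕ Bool}

/-- Converse of the split: two corners that are separate after the swap lie at one vertex before it.
-/
theorem sameVertex_of_not_unzipRot [Finite S.Dart] (h : S.rev e ≠ e) {g : S.Dart}
    (hg : ¬ (S.unzipRot e (Sum.inl g)).SameCycle (Sum.inr false) (Sum.inl g)) :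
    S.SameVertex e g := by
  classical
  have h1 : (S.doubledRot e).SameCycle (S.unzipRot e (Sum.inl g) (Sum.inr false))
      (S.unzipRot e (Sum.inl g) (Sum.inl g)) := by
    rw [doubledRot_eq (c := Sum.inl g)]
    refine Equiv.Perm.sameCycle_swap_mul ?_
    simpa using hg
  rw [unzipRot_false, unzipRot_corner h] at h1
  have h2 : (S.doubledRot e).SameCycle (Sum.inl e) (Sum.inl g) := by
    simpa using h1.symm
  exact Perm.SameCycle.lift (r := fun a b => S.SameVertex (S.fold e a) (S.fold e b))
    ⟨fun _ => SameVertex.rfl, SameVertex.symm, SameVertex.trans⟩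
    (fun y _ => fold_doubledRot h y) h2

theorem fold_unzipRev (hrev : ∀ d, S.rev (S.rev d) = d) (h : S.rev e ≠ e) (y : S.Dart ⊕ Bool) :
    S.fold e (S.unzipRev e y) = S.rev (S.fold e y) := by
  rcases y with d | _ | _
  · by_cases h1 : d = e
    · rw [h1, unzipRev_inl_self h]
      rfl
    by_cases h2 : d = S.rev e
    · rw [h2, unzipRev_inl_rev, fold_false, fold_inl, hrev]
    rw [unzipRev_inl h1 h2]
    rfl
  · rw [unzipRev_false]
    rfl
  · rw [unzipRev_true (hrev e) h, fold_true, hrev]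
    rfl

theorem fold_joined (hrev : ∀ d, S.rev (S.rev d) = d) (h : S.rev e ≠ e)
    (hc : S.SameVertex e (S.fold e c)) {a b : S.Dart ⊕ Bool}
    (hab : (S.unzipWith e c).Joined Set.univ a b) :
    S.Joined Set.univ (S.fold e a) (S.fold e b) := by
  induction hab with
  | refl => exact .refl
  | tail _ hbc ih =>
    refine ih.tail ?_
    rcases hbc with hbc | ⟨-, rfl⟩
    · exact Or.inl (fold_sameVertex h hc hbc)
    · exact Or.inr ⟨Set.mem_univ _, fold_unzipRev hrev h _⟩

end

end MarkedMap

namespace MarkedMap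

section

variable {n m j : ℕ} {S : MarkedMap} {e : S.Dart} {c : S.Dart ⊕ Bool}

/-- Both halves of the origin of `e` have a corner on the new polygon, so no vertex leaves the
cluster, and the other end of `e` is the only vertex that joins it. -/
theorem mem_cluster_unzipWith (hS : S.IsZipped n m j) (he : S.CanUnzip j e)
    (hc : S.IsCorner j e c) (ht : S.TipOnGrey j) (hec : e ∈ S.cluster) (d : S.Dart) :
    (Sum.inl d : S.Dart ⊕ Bool) ∈ (S.unzipWith e c).cluster ↔
      d ∈ S.cluster ∨ S.SameVertex (S.rev e) d := by
  have := hS.finite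
  have hne := hS.rev_ne e
  have hcg : c ∈ (S.unzipWith e c).grey := by
    rcases hc with ⟨-, rfl⟩ | ⟨-, g, hg, -, rfl⟩
    · exact mem_unzipWith_grey.2 (Or.inr (Or.inl rfl))
    · exact inl_mem_unzipWith_grey.2 hg
  constructor
  · rintro (h | ⟨y, hy, h⟩)
    · exact Or.inr (fold_sameVertex hne hc.sameVertex h)
    · have h1 := fold_sameVertex hne hc.sameVertex h
      rcases mem_unzipWith_grey.1 hy with ⟨g, hg, rfl⟩ | rfl | rfl
      · exact Or.inl (Or.inr ⟨g, hg, h1⟩)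
      · exact Or.inl (cluster_congr h1 hec)
      · exact Or.inr h1
  · have key : ∀ {g : S.Dart}, g ∈ S.grey → S.SameVertex g d → ¬ S.SameVertex e d →
        (Sum.inl d : S.Dart ⊕ Bool) ∈ (S.unzipWith e c).cluster := fun {g} hg hgd hed =>
      Or.inr ⟨Sum.inl g, inl_mem_unzipWith_grey.2 hg, unzipRot_sameVertex_of_not hne hc.sameVertex
        hc.ne_true (fun h => hed (h.trans hgd)) hgd⟩
    rintro (h | h)
    · by_cases hed : S.SameVertex e d
      · rcases unzipRot_sameVertex_self (c := c) hne hed with h1 | h1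
        · exact Or.inr ⟨Sum.inr false, mem_unzipWith_grey.2 (Or.inr (Or.inl rfl)),
            Perm.SameCycle.symm h1⟩
        · exact Or.inr ⟨c, hcg, (unzipRot_corner_self hne).trans (Perm.SameCycle.symm h1)⟩
      · rcases Nat.eq_zero_or_pos j with rfl | hj
        · rw [mem_cluster, hS.grey_eq_empty] at h hec
          simp only [Set.mem_empty_iff_false, false_and, exists_false, or_false] at h hec
          exact absurd (hec.symm.trans h) hed
        · rcases h with h | ⟨g, hg, h⟩
          · obtain ⟨g, hg, htg⟩ := ht hj
            exact key hg (htg.symm.trans h) hed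
          · exact key hg h hed
    · exact Or.inl ((unzipRot_true_rev hc.ne_true).trans
        (unzipRot_sameVertex_of_not hne hc.sameVertex hc.ne_true he.rev_self h))

/-- Everything is read off from the unzipped map. Simplicity of its polygon is what places `c` at
the origin of `e` and keeps the other end of `e` away from the old polygon. -/
theorem isZipped_of_unzipWith (hfin : Finite S.Dart) (hrev : ∀ d, S.rev (S.rev d) = d)
    (hne : ∀ d, S.rev d ≠ d)
    (hc : (j = 0 ∧ c = Sum.inr false) ∨ (0 < j ∧ ∃ g ∈ S.grey, c = Sum.inl g))
    (hU : (S.unzipWith e c).IsZipped n m (j + 1)) :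
    S.IsZipped n m j ∧ S.CanUnzip j e ∧ S.IsCorner j e c := by
  classical
  have hgc : S.grey.ncard = 2 * j := by
    have := hU.grey_card
    rw [ncard_unzipWith_grey] at this
    omega
  have hfalse : (Sum.inr false : S.Dart ⊕ Bool) ∈ (S.unzipWith e c).grey :=
    mem_unzipWith_grey.2 (Or.inr (Or.inl rfl))
  have htrue : (Sum.inr true : S.Dart ⊕ Bool) ∈ (S.unzipWith e c).grey :=
    mem_unzipWith_grey.2 (Or.inr (Or.inr rfl))
  have hcorner : S.IsCorner j e c := by
    rcases hc with ⟨h0, rfl⟩ | ⟨h0, g, hg, rfl⟩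
    · exact Or.inl ⟨h0, rfl⟩
    · refine Or.inr ⟨h0, g, hg, sameVertex_of_not_unzipRot (hne e) fun h => ?_, rfl⟩
      have := hU.grey_unique (Sum.inr false : S.Dart ⊕ Bool) hfalse (Sum.inl g : S.Dart ⊕ Bool)
        (inl_mem_unzipWith_grey.2 hg) h
      exact absurd this (Sum.inr_ne_inl)
  have hcg : c ∈ (S.unzipWith e c).grey := by
    rcases hc with ⟨-, rfl⟩ | ⟨-, g, hg, rfl⟩
    · exact hfalse
    · exact inl_mem_unzipWith_grey.2 hg
  have hct := hcorner.ne_true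
  have hself : ∀ {d : S.Dart}, S.SameVertex e d →
      (S.unzipWith e c).SameVertex (Sum.inl d : S.Dart ⊕ Bool) (Sum.inr false : S.Dart ⊕ Bool) ∨
        (S.unzipWith e c).SameVertex (Sum.inl d : S.Dart ⊕ Bool) c := by
    intro d hd
    rcases unzipRot_sameVertex_self (c := c) (hne e) hd with h | h
    · exact Or.inl h
    · exact Or.inr (Perm.SameCycle.trans h (unzipRot_corner_self (hne e)).symm)
  have hrevU : (S.unzipWith e c).SameVertex (Sum.inr true : S.Dart ⊕ Bool)
    (Sum.inl (S.rev e) : S.Dart ⊕ Bool) := unzipRot_true_rev hct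
  -- Were `e` a loop, the new tip would coincide with one of the two halves of the split vertex,
  -- against simplicity of the polygon.
  have hee : ¬ S.SameVertex e (S.rev e) := by
    intro h
    rcases hself h with h1 | h1
    · exact absurd (hU.grey_unique _ htrue _ hfalse (hrevU.trans h1))
        (fun h => by cases (h : (Sum.inr true : S.Dart ⊕ Bool) = Sum.inr false))
    · exact hct (hU.grey_unique _ htrue _ hcg (hrevU.trans h1)).symm
  have hgrey : ∀ a ∈ S.grey, S.SameVertex e a → c = Sum.inl a := by
    intro a ha hea
    rcases hself hea with h | h
    · exact absurd (hU.grey_unique (Sum.inl a : S.Dart ⊕ Bool) (inl_mem_unzipWith_grey.2 ha) _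
        hfalse h) Sum.inl_ne_inr
    · exact (hU.grey_unique (Sum.inl a : S.Dart ⊕ Bool) (inl_mem_unzipWith_grey.2 ha) _ hcg h).symm
  refine ⟨⟨hfin, hrev, hne, fun a b => ?_, ?_, ?_, ?_, hgc, ?_, ?_, ?_, fun h =>
    hU.root_notMem (inl_mem_unzipWith_grey.2 h)⟩, ⟨?_, ?_, hee⟩, hcorner⟩
  · exact fold_joined hrev (hne e) hcorner.sameVertex
      (hU.connected (Sum.inl a : S.Dart ⊕ Bool) (Sum.inl b : S.Dart ⊕ Bool))
  · have h1 : Nat.card (S.Dart ⊕ Bool) = 2 * (n + (j + 1)) := hU.edges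
    rw [Nat.card_sum, Nat.card_eq_fintype_card (α := Bool), Fintype.card_bool] at h1
    omega
  · have hv := hU.vertices
    rcases hcorner with ⟨h0, rfl⟩ | ⟨h0, g, hg, heg, rfl⟩
    · have : numCycles (S.unzipWith e (Sum.inr false)).rot = numCycles S.rot :=
        numCycles_unzipRot_false (S := S) (e := e)
      omega
    · have : numCycles (S.unzipWith e (Sum.inl g)).rot = numCycles S.rot + 1 :=
        numCycles_unzipRot (hne e) heg
      omega
  · have hv := hU.faces
    rcases hcorner with ⟨h0, rfl⟩ | ⟨h0, g, hg, heg, rfl⟩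
    · rw [numCycles_unzipWith_faceRot_false hrev (hne e)] at hv
      omega
    · rw [numCycles_unzipWith_faceRot hrev (hne e)] at hv
      omega
  · intro d hd
    have h1 := hU.grey_faceRot (Sum.inl d : S.Dart ⊕ Bool) (inl_mem_unzipWith_grey.2 hd)
    rw [unzipWith_faceRot_inl hrev (hne e)] at h1
    by_cases h2 : Sum.inl (S.faceRot d) = c
    · rw [← h2] at hcg
      exact inl_mem_unzipWith_grey.1 hcg
    · rw [Equiv.swap_apply_of_ne_of_ne (by simp) h2] at h1
      exact inl_mem_unzipWith_grey.1 h1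
  · intro a ha b hb
    have h0 := hU.grey_cycle (Sum.inl a : S.Dart ⊕ Bool) (inl_mem_unzipWith_grey.2 ha)
      (Sum.inl b : S.Dart ⊕ Bool) (inl_mem_unzipWith_grey.2 hb)
    rw [unzipWith_faceRot hrev (hne e)] at h0
    have h1 : (Equiv.swap (Sum.inr false) c *
        Perm.sumCongr S.faceRot (Equiv.swap false true)).SameCycle (Sum.inl a : S.Dart ⊕ Bool)
        (Sum.inl b) := h0
    rcases h1.of_swap_mul with h2 | ⟨h2, h3⟩
    · exact sameCycle_sumCongr_inl.1 h2
    · have h2 := h2.resolve_left not_sameCycle_sumCongr_inl_inr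
      have h3 := h3.resolve_left not_sameCycle_sumCongr_inl_inr
      exact sameCycle_sumCongr_inl.1 (h2.trans h3.symm)
  · intro a ha b hb hab
    by_cases hea : S.SameVertex e a
    · exact Sum.inl_injective ((hgrey a ha hea).symm.trans (hgrey b hb (hea.trans hab)))
    · exact Sum.inl_injective (hU.grey_unique (Sum.inl a : S.Dart ⊕ Bool)
        (inl_mem_unzipWith_grey.2 ha) (Sum.inl b : S.Dart ⊕ Bool) (inl_mem_unzipWith_grey.2 hb)
        (unzipRot_sameVertex_of_not (hne e) hcorner.sameVertex hct hea hab))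
  · rcases hcorner with ⟨h0, -⟩ | ⟨-, g, hg, heg, -⟩
    · exact Or.inl h0
    · exact Or.inr ⟨g, hg, heg⟩
  · intro g hg hr
    have h1 := unzipRot_sameVertex_of_not (hne e) hcorner.sameVertex hct hee hr
    exact absurd (hU.grey_unique _ htrue (Sum.inl g : S.Dart ⊕ Bool)
      (inl_mem_unzipWith_grey.2 hg) (hrevU.trans h1)) Sum.inr_ne_inl

end

/-- The darts that remain when two darts are removed, together with the removed darts. -/
noncomputable def removeTwoEquiv {α : Type} {x x' : α} (h : x ≠ x') :
    {d : α // d ≠ x ∧ d ≠ x'} ⊕ Bool ≃ α :=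
  open Classical in
  { toFun := Sum.elim Subtype.val fun b => if b then x' else x
    invFun := fun d => if h1 : d = x then Sum.inr false else
      if h2 : d = x' then Sum.inr true else Sum.inl ⟨d, h1, h2⟩
    left_inv := by
      rintro (⟨d, h1, h2⟩ | _ | _)
      · simp [h1, h2]
      · simp
      · simp [h.symm]
    right_inv := by
      intro d
      by_cases h1 : d = x
      · simp [h1]
      by_cases h2 : d = x'
      · subst h2
        simp [h1]
      simp [h1, h2] }

/-- The tip has a corner `x'` on the polygon; let `x` and `g` be the preceding and the following
corner. Gluing the two sides of the polygon that meet at the tip removes the darts `x` and `x'` and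
identifies the vertices of `x` and `g`. -/
theorem exists_unzip_eq {n m j : ℕ} {U : MarkedMap} (hU : U.IsZipped n m (j + 1))
    (htip : U.TipOnGrey (j + 1))
    (htarget : U.SameVertex U.tip U.target ∨ U.target ∉ U.cluster) :
    ∃ (S : MarkedMap) (e : S.Dart), S.IsZipped n m j ∧ S.TipOnGrey j ∧ S.SameVertex S.tip e ∧
      S.rev e ∉ S.cluster ∧ S.target ∉ S.cluster ∧ (⟦S.unzip e⟧ : IsoClass) = ⟦U⟧ := by
  classical
  have := hU.finite
  obtain ⟨x', hx', htx'⟩ := htip (Nat.succ_pos j)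
  have hinv : ∀ d ∈ U.grey, U.faceRot⁻¹ d ∈ U.grey := by
    intro d hd
    have h1 : U.faceRot.SameCycle d (U.faceRot⁻¹ d) := ⟨-1, by simp⟩
    obtain ⟨k, hk⟩ := Equiv.Perm.sameCycle_iff_exists_pow.1 h1
    rw [← hk]
    clear hk h1
    induction k with
    | zero => simpa using hd
    | succ k ih =>
      rw [pow_succ', Equiv.Perm.mul_apply]
      exact hU.grey_faceRot _ ih
  obtain ⟨x, hxdef⟩ : ∃ x, x = U.faceRot⁻¹ x' := ⟨_, rfl⟩
  obtain ⟨g, hgdef⟩ : ∃ g, g = U.faceRot x' := ⟨_, rfl⟩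
  have hfx : U.faceRot x = x' := by rw [hxdef]; simp
  have hx : x ∈ U.grey := hxdef ▸ hinv _ hx'
  have hg : g ∈ U.grey := hgdef ▸ hU.grey_faceRot _ hx'
  -- The polygon has at least two corners.
  have hfix : U.faceRot x' ≠ x' := by
    intro hfix
    have h1 : U.grey ⊆ {x'} := by
      intro d hd
      obtain ⟨k, hk⟩ := Equiv.Perm.sameCycle_iff_exists_pow.1 (hU.grey_cycle x' hx' d hd)
      rw [← hk]
      clear hk
      induction k with
      | zero => simp
      | succ k ih =>
        rw [pow_succ', Equiv.Perm.mul_apply, Set.mem_singleton_iff.1 ih, hfix]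
        rfl
    have h2 := Set.ncard_le_ncard h1
    rw [hU.grey_card, Set.ncard_singleton] at h2
    omega
  have hxx' : x ≠ x' := fun h => hfix (by rw [← h, hfx, h])
  have hgx' : g ≠ x' := fun h => hfix (by rw [← hgdef, h])
  have hrot1 : U.rot x' = U.rev x := by rw [← hfx]; simp [faceRot]
  have hrot2 : U.rot g = U.rev x' := by rw [hgdef]; simp [faceRot]
  -- Otherwise `x` and `x'` would form an isolated edge, hence the whole map, and the root would be
  -- grey.
  have hrx : U.rev x' ≠ x := by
    intro h
    have h1 : U.rev x = x' := by rw [← h, hU.rev_rev]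
    have h2 : U.SameVertex g x := by
      have := sameVertex_rot U g
      rwa [hrot2, h] at this
    have h3 : g = x := hU.grey_unique _ hg _ hx h2
    rw [h3, h] at hrot2
    rw [h1] at hrot1
    have h4 : ∀ d, U.Joined Set.univ x d → d = x ∨ d = x' := by
      intro d hd
      induction hd with
      | refl => exact Or.inl rfl
      | @tail b d _ hbd ih =>
        rcases hbd with hbd | ⟨-, rfl⟩
        · refine (Perm.SameCycle.lift (r := fun a b => (a = x ∨ a = x') ↔ (b = x ∨ b = x'))
            ⟨fun _ => Iff.rfl, Iff.symm, Iff.trans⟩ (fun y _ => ?_) hbd).1 ih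
          have e1 : U.rot y = x ↔ y = x :=
            ⟨fun h => U.rot.injective (h.trans hrot2.symm), fun h => h ▸ hrot2⟩
          have e2 : U.rot y = x' ↔ y = x' :=
            ⟨fun h => U.rot.injective (h.trans hrot1.symm), fun h => h ▸ hrot1⟩
          rw [e1, e2]
        · rcases ih with rfl | rfl
          · exact Or.inr h1
          · exact Or.inl h
    rcases h4 _ (hU.connected x U.root) with h5 | h5
    · exact hU.root_notMem (h5 ▸ hx)
    · exact hU.root_notMem (h5 ▸ hx')
  have hrx' : U.rev x ≠ x' := fun h => hrx (by rw [← h, hU.rev_rev])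
  set p : U.Dart → Prop := fun d => d ≠ x ∧ d ≠ x' with hp
  -- The formulas for unzipping, inverted: the swap of `x` and `g` cuts a 2-cycle of `x` and `x'`
  -- out of the grey face, and conjugation by `s` pairs `x` with `x'` and `rev x` with `rev x'`. The
  -- remaining darts are therefore invariant under both permutations.
  set fhat : Perm U.Dart := Equiv.swap x g * U.faceRot with hfhat
  set s : Perm U.Dart := Equiv.swap (U.rev x) x' with hs
  set rhat : Perm U.Dart := s * U.rev * s with hrhat
  have hss : ∀ d, s (s d) = d := fun d => by simp [hs]
  have hfhx : fhat x = x' := by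
    rw [hfhat, Equiv.Perm.mul_apply, hfx, Equiv.swap_apply_of_ne_of_ne hxx'.symm hgx'.symm]
  have hfhx' : fhat x' = x := by
    rw [hfhat, Equiv.Perm.mul_apply, ← hgdef, Equiv.swap_apply_right]
  have hsx : s x = x := by
    rw [hs, Equiv.swap_apply_of_ne_of_ne (fun h => hU.rev_ne x h.symm) hxx']
  have hrhx : rhat x = x' := by
    rw [hrhat, Equiv.Perm.mul_apply, Equiv.Perm.mul_apply, hsx, hs, Equiv.swap_apply_left]
  have hsx' : s x' = U.rev x := by rw [hs, Equiv.swap_apply_right]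
  have hrhx' : rhat x' = x := by
    rw [hrhat, Equiv.Perm.mul_apply, Equiv.Perm.mul_apply, hsx', hU.rev_rev, hsx]
  have hpf : ∀ q : Perm U.Dart, q x = x' → q x' = x → ∀ d, p (q d) ↔ p d := by
    intro q h1 h2 d
    have e1 : q d = x ↔ d = x' := by rw [← h2, q.injective.eq_iff]
    have e2 : q d = x' ↔ d = x := by rw [← h1, q.injective.eq_iff]
    simp only [hp, ne_eq, e1, e2]
    tauto
  have hrr : ∀ d, rhat (rhat d) = d := by
    intro d
    simp [hrhat, hss, hU.rev_rev]
  have hroot : p U.root := ⟨fun h => hU.root_notMem (h ▸ hx), fun h => hU.root_notMem (h ▸ hx')⟩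
  have he0 : p (U.rev x') := ⟨hrx, hU.rev_ne x'⟩
  have hr0 : p (U.rev x) := ⟨hU.rev_ne x, hrx'⟩
  -- The vertex of `x` is on the polygon and differs from the tip, while a target in the cluster is
  -- at the tip.
  have htgt : U.target ≠ x := by
    intro h
    have h1 : U.SameVertex U.tip U.target := by
      rcases htarget with h1 | h1
      · exact h1
      · exact absurd (Or.inr ⟨x, hx, h ▸ SameVertex.rfl⟩) h1
    rw [h] at h1
    exact hxx' (hU.grey_unique _ hx _ hx' (h1.symm.trans htx'))
  let D := {d : U.Dart // p d}
  let revS : Perm D := rhat.subtypePerm (hpf rhat hrhx hrhx')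
  let faceS : Perm D := fhat.subtypePerm (hpf fhat hfhx hfhx')
  -- If the dart of the target is the deleted `x'`, then `rev x`, the next dart at the same vertex,
  -- represents the target instead.
  let tgt : D := if h : U.target = x' then ⟨U.rev x, hr0⟩ else ⟨U.target, htgt, h⟩
  let S : MarkedMap :=
    { Dart := D
      rot := revS * faceS⁻¹
      rev := revS
      root := ⟨U.root, hroot⟩
      grey := {d | d.1 ∈ U.grey}
      tip := ⟨U.rev x', he0⟩
      target := tgt }
  let e : S.Dart := (⟨U.rev x', he0⟩ : D)
  let ε : S.Dart ⊕ Bool ≃ U.Dart := removeTwoEquiv hxx'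
  have hε0 : ∀ d : D, ε (Sum.inl d) = d.1 := fun _ => rfl
  have hε1 : ε (Sum.inr false) = x := rfl
  have hε2 : ε (Sum.inr true) = x' := rfl
  have hrevS : ∀ d : D, (S.rev d : D).1 = rhat d.1 := fun _ => rfl
  have hfaceEq : S.faceRot = faceS := by
    show (revS * faceS⁻¹)⁻¹ * revS = faceS
    group
  have hfaceS : ∀ d : D, (S.faceRot d : D).1 = fhat d.1 := fun d => by rw [hfaceEq]; rfl
  have hSrr : ∀ d, S.rev (S.rev d) = d := fun d => Subtype.ext (by
    show rhat (rhat _) = _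
    exact hrr _)
  have hSne : ∀ d, S.rev d ≠ d := by
    intro d hd
    have h1 : rhat (Subtype.val d) = Subtype.val d := congrArg Subtype.val hd
    rw [hrhat, Equiv.Perm.mul_apply, Equiv.Perm.mul_apply] at h1
    have h2 := congrArg s h1
    rw [hss] at h2
    exact hU.rev_ne _ h2
  have hreve : S.rev e = (⟨U.rev x, hr0⟩ : D) := by
    apply Subtype.ext
    show rhat (U.rev x') = U.rev x
    have h1 : s (U.rev x') = U.rev x' := by
      rw [hs, Equiv.swap_apply_of_ne_of_ne (fun h => hxx' (U.rev.injective h).symm) (hU.rev_ne x')]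
    rw [hrhat, Equiv.Perm.mul_apply, Equiv.Perm.mul_apply, h1, hU.rev_rev, hsx']
  let c : S.Dart ⊕ Bool := ε.symm g
  have hεc : ε c = g := ε.apply_symm_apply g
  have hsw : ∀ (i : DecidableEq (S.Dart ⊕ Bool)) (a b z : S.Dart ⊕ Bool),
      ε (@Equiv.swap _ i a b z) = Equiv.swap (ε a) (ε b) (ε z) :=
    fun i a b z => ε.injective.map_swap a b z
  have hεrev : ∀ y : S.Dart ⊕ Bool, ε (S.unzipRev e y) = U.rev (ε y) := by
    intro y
    have h1 : ∀ y, ε (Perm.sumCongr S.rev (Equiv.swap false true) y) = rhat (ε y) := by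
      rintro (d | _ | _)
      · rfl
      · exact hrhx.symm
      · exact hrhx'.symm
    have h2 : ε (Sum.inl (S.rev e)) = U.rev x := by
      rw [hreve]
      rfl
    have h3 : ∀ (i : DecidableEq (S.Dart ⊕ Bool)) z,
        ε (@Equiv.swap _ i (Sum.inl (S.rev e)) (Sum.inr true) z) = s (ε z) := fun i z => by
      rw [hs, ← h2, ← hε2]
      exact hsw _ _ _ _
    rw [unzipRev_apply]
    refine (h3 _ _).trans ?_
    rw [h1]
    refine (congrArg (fun u => s (rhat u)) (h3 _ y)).trans ?_
    simp [hrhat, hss]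
  have hεface : ∀ y : S.Dart ⊕ Bool, ε ((S.unzipWith e c).faceRot y) = U.faceRot (ε y) := by
    intro y
    have h1 : ∀ y, ε (Perm.sumCongr S.faceRot (Equiv.swap false true) y) = fhat (ε y) := by
      rintro (d | _ | _)
      · exact hfaceS d
      · exact hfhx.symm
      · exact hfhx'.symm
    rw [unzipWith_faceRot hSrr (hSne e)]
    refine (hsw _ _ _ _).trans ?_
    rw [h1, hε1, hεc, hfhat]
    simp
  have hεtarget : U.SameVertex (ε (Sum.inl S.target)) U.target := by
    by_cases h : U.target = x'
    · have h1 : S.target = (⟨U.rev x, hr0⟩ : D) := dif_pos h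
      rw [h1, hε0, h]
      have := sameVertex_rot U x'
      rw [hrot1] at this
      exact this.symm
    · have h1 : S.target = (⟨U.target, htgt, h⟩ : D) := dif_neg h
      rw [h1, hε0]
      exact SameVertex.rfl
  have hiso : IsIso (S.unzipWith e c) U ε := by
    refine ⟨rot_comm_of_faceRot_comm (S := S.unzipWith e c) hεface hεrev, hεrev, rfl, ?_,
      htx'.symm, hεtarget⟩
    rintro (d | _ | _)
    · exact (inl_mem_unzipWith_grey (S := S)).symm
    · exact iff_of_true hx (mem_unzipWith_grey.2 (Or.inr (Or.inl rfl)))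
    · exact iff_of_true hx' (mem_unzipWith_grey.2 (Or.inr (Or.inr rfl)))
  have hUS := hU.of_isIso hiso.symm
  have hfin : Finite S.Dart := inferInstanceAs (Finite D)
  have hc : (j = 0 ∧ c = Sum.inr false) ∨ (0 < j ∧ ∃ g ∈ S.grey, c = Sum.inl g) := by
    have hncard := hUS.grey_card
    rw [ncard_unzipWith_grey] at hncard
    -- If `x` follows `x'`, the polygon is a 2-gon, and zipping it up leaves no polygon.
    by_cases hgx : g = x
    · left
      have hcx : c = Sum.inr false := (Equiv.symm_apply_eq ε).2 (hgx.trans hε1.symm)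
      refine ⟨?_, hcx⟩
      by_contra hj
      have hne : S.grey.Nonempty := by
        rw [← Set.ncard_pos]
        omega
      obtain ⟨d, hd⟩ := hne
      have hd' : (d : D).1 ∈ U.grey := hd
      have hcl : ∀ k : ℕ, (U.faceRot ^ k) x' = x ∨ (U.faceRot ^ k) x' = x' := by
        intro k
        induction k with
        | zero => exact Or.inr rfl
        | succ k ih =>
          rw [pow_succ', Equiv.Perm.mul_apply]
          rcases ih with h | h
          · rw [h]; exact Or.inr hfx
          · rw [h]; exact Or.inl (hgdef.symm.trans hgx)
      obtain ⟨k, hk⟩ := Equiv.Perm.sameCycle_iff_exists_pow.1 (hU.grey_cycle x' hx' _ hd')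
      have := hcl k
      rw [hk] at this
      exact this.elim d.2.1 d.2.2
    · right
      have hcx : c = Sum.inl (⟨g, hgx, hgx'⟩ : D) := (Equiv.symm_apply_eq ε).2 rfl
      have hgS : (⟨g, hgx, hgx'⟩ : D) ∈ S.grey := hg
      refine ⟨?_, _, hgS, hcx⟩
      have : 0 < S.grey.ncard := (Set.ncard_pos).2 ⟨_, hgS⟩
      omega
  obtain ⟨hSz, hcan, hcor⟩ := isZipped_of_unzipWith hfin hSrr hSne hc hUS
  have htipS : S.TipOnGrey j := by
    intro hj
    rcases hcor with ⟨h0, -⟩ | ⟨-, g, hg, heg, -⟩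
    · omega
    · exact ⟨g, hg, heg⟩
  have hec : e ∈ S.cluster := Or.inl SameVertex.rfl
  have hrec : S.rev e ∉ S.cluster := by
    rintro (h | ⟨g, hg, h⟩)
    · exact hcan.rev_self h
    · exact hcan.rev_grey g hg h.symm
  refine ⟨S, e, hSz, htipS, SameVertex.rfl, hrec, ?_, ?_⟩
  · rcases htarget with h | h
    · have h1 : U.SameVertex (ε (Sum.inr true)) (ε (Sum.inl S.target)) :=
        (htx'.symm.trans h).trans hεtarget.symm
      have h2 := fold_sameVertex (hSne e) hcor.sameVertex (hiso.sameVertex_iff.1 h1)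
      exact fun h3 => hrec (cluster_congr (SameVertex.symm h2) h3)
    · intro h1
      have h2 := (mem_cluster_unzipWith hSz hcan hcor htipS hec S.target).2 (Or.inl h1)
      apply h
      rcases h2 with h2 | ⟨y, hy, h2⟩
      · refine Or.inl ((htx'.trans ?_).trans hεtarget)
        exact hiso.sameVertex_iff.2 h2
      · exact Or.inr ⟨ε y, (hiso.grey y).2 hy, SameVertex.trans (hiso.sameVertex_iff.2 h2) hεtarget⟩
  · obtain ⟨c', hc', e1⟩ := hSz.exists_isCorner hcan
    rw [e1, ← hcor.unique hSz hc']
    exact Quotient.sound ⟨ε, hiso⟩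

end MarkedMap

/-! ### Maps that agree away from the cluster -/

namespace MarkedMap

/-- The map `ψ` of darts identifies the parts of the two maps away from the sets of vertices
`C` and `C'`. -/
structure Away (S S' : MarkedMap) (C : Set S.Dart) (C' : Set S'.Dart) (ψ : S.Dart → S'.Dart) :
    Prop where
  injective : Function.Injective ψ
  mem_iff : ∀ {d}, ψ d ∈ C' ↔ d ∈ C
  sameVertex_iff : ∀ {d d'}, d ∉ C → (S'.SameVertex (ψ d) (ψ d') ↔ S.SameVertex d d')
  rev : ∀ {d}, d ∉ C → S'.rev (ψ d) = ψ (S.rev d)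
  mem_range : ∀ d' ∉ C', ∃ d, ψ d = d'
  saturated : ∀ {a b}, S'.SameVertex a b → a ∈ C' → b ∈ C'

variable {S S' S'' : MarkedMap} {C : Set S.Dart} {C' : Set S'.Dart} {C'' : Set S''.Dart}
  {ψ : S.Dart → S'.Dart} {ψ' : S'.Dart → S''.Dart}

theorem Away.notMem_iff (h : Away S S' C C' ψ) {d : S.Dart} : ψ d ∉ C' ↔ d ∉ C :=
  not_congr h.mem_iff

theorem Away.saturated_left (h : Away S S' C C' ψ) {a b : S.Dart} (hab : S.SameVertex a b)
    (ha : a ∈ C) : b ∈ C := by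
  by_contra hb
  exact hb (h.mem_iff.1 (h.saturated ((h.sameVertex_iff hb).2 hab.symm).symm (h.mem_iff.2 ha)))

theorem Away.trans (h : Away S S' C C' ψ) (h' : Away S' S'' C' C'' ψ') :
    Away S S'' C C'' (ψ' ∘ ψ) where
  injective := h'.injective.comp h.injective
  mem_iff := h'.mem_iff.trans h.mem_iff
  sameVertex_iff hd := (h'.sameVertex_iff (h.notMem_iff.2 hd)).trans (h.sameVertex_iff hd)
  rev hd := (h'.rev (h.notMem_iff.2 hd)).trans (congrArg ψ' (h.rev hd))
  mem_range d' hd' := by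
    obtain ⟨b, rfl⟩ := h'.mem_range d' hd'
    obtain ⟨a, rfl⟩ := h.mem_range b (h'.notMem_iff.1 hd')
    exact ⟨a, rfl⟩
  saturated := h'.saturated

theorem away_id (hC : ∀ {a b}, S.SameVertex a b → a ∈ C → b ∈ C) : Away S S C C id where
  injective := Function.injective_id
  mem_iff := Iff.rfl
  sameVertex_iff _ := Iff.rfl
  rev _ := rfl
  mem_range d _ := ⟨d, rfl⟩
  saturated := hC

theorem IsIso.mem_cluster_iff {φ : S.Dart ≃ S'.Dart} (h : IsIso S S' φ) {d : S.Dart} :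
    φ d ∈ S'.cluster ↔ d ∈ S.cluster := by
  rw [mem_cluster, mem_cluster, ← h.image_grey]
  refine or_congr ⟨fun h1 => ?_, fun h1 => ?_⟩ ⟨?_, ?_⟩
  · exact h.sameVertex_iff.1 (h.tip.trans h1)
  · exact h.tip.symm.trans (h.sameVertex_iff.2 h1)
  · rintro ⟨_, ⟨g, hg, rfl⟩, h1⟩
    exact ⟨g, hg, h.sameVertex_iff.1 h1⟩
  · rintro ⟨g, hg, h1⟩
    exact ⟨_, ⟨g, hg, rfl⟩, h.sameVertex_iff.2 h1⟩

theorem IsIso.away {φ : S.Dart ≃ S'.Dart} (h : IsIso S S' φ) :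
    Away S S' S.cluster S'.cluster φ where
  injective := φ.injective
  mem_iff := h.mem_cluster_iff
  sameVertex_iff _ := h.sameVertex_iff
  rev _ := (h.rev _).symm
  mem_range d' _ := φ.surjective d'
  saturated := cluster_congr

/-- Enlarging the sets by a vertex. -/
theorem Away.union (h : Away S S' C C' ψ) {u : S.Dart} (hu : u ∉ C) :
    Away S S' (C ∪ {d | S.SameVertex u d}) (C' ∪ {d | S'.SameVertex (ψ u) d}) ψ where
  injective := h.injective
  mem_iff := or_congr h.mem_iff (h.sameVertex_iff hu)
  sameVertex_iff hd := h.sameVertex_iff fun h' => hd (Or.inl h')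
  rev hd := h.rev fun h' => hd (Or.inl h')
  mem_range d' hd' := h.mem_range d' fun h' => hd' (Or.inl h')
  saturated hab := Or.imp (h.saturated hab) fun h' => SameVertex.trans h' hab

/-- All changes made by unzipping happen at the two ends of the edge, and both belong to the new
cluster. -/
theorem IsZipped.away_unzip {n m j : ℕ} {e : S.Dart} (hS : S.IsZipped n m j)
    (ht : S.TipOnGrey j) (he : e ∈ S.cluster) (he' : S.rev e ∉ S.cluster) :
    Away S (S.unzip e) (S.cluster ∪ {d | S.SameVertex (S.rev e) d}) (S.unzip e).cluster
      Sum.inl := by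
  have := hS.finite
  have hcan := canUnzip_of_mem_cluster ht he he'
  obtain ⟨c, hc, e1⟩ := hS.exists_isCorner hcan
  have hne := hS.rev_ne e
  have key : ∀ {d}, d ∉ S.cluster → ¬ S.SameVertex e d := fun hd h => hd (cluster_congr h he)
  have hrot : (S.unzip e).rot = S.unzipRot e c := by
    unfold MarkedMap.unzip MarkedMap.unzipWith at e1
    injection e1
  -- The two maps have the same dart type and differ only in the expression for `rot`. With `rot` as
  -- a variable, no darts need to be transported along an equality of maps.
  suffices h : ∀ r : Perm (S.Dart ⊕ Bool), r = S.unzipRot e c →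
      Away S { S.unzipWith e c with rot := r } (S.cluster ∪ {d | S.SameVertex (S.rev e) d})
        (cluster { S.unzipWith e c with rot := r }) Sum.inl from h _ hrot
  rintro _ rfl
  refine ⟨Sum.inl_injective, mem_cluster_unzipWith hS hcan hc ht he _, fun {d d'} hd =>
    ⟨fold_sameVertex hne hc.sameVertex, unzipRot_sameVertex_of_not hne hc.sameVertex hc.ne_true
      (key fun h => hd (Or.inl h))⟩, fun {d} hd => unzipRev_inl ?_ ?_, ?_, cluster_congr⟩
  · rintro rfl
    exact hd (Or.inl he)
  · rintro rfl
    exact hd (Or.inr SameVertex.rfl)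
  · rintro (d | b) hd
    · exact ⟨d, rfl⟩
    · refine absurd (Or.inr ⟨_, mem_unzipWith_grey.2 (Or.inr ?_), SameVertex.rfl⟩) hd
      cases b
      · exact Or.inl rfl
      · exact Or.inr rfl

theorem Away.isStoppedWalk_iff (h : Away S S' C C' ψ) {a : S.Dart} {ω : List S.Dart} :
    S'.IsStoppedWalk C' (ψ a) (ω.map ψ) ↔ S.IsStoppedWalk C a ω := by
  induction ω generalizing a with
  | nil => exact h.mem_iff
  | cons d ω ih =>
    simp only [List.map_cons, IsStoppedWalk]
    rw [h.mem_iff]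
    refine and_congr_right fun ha => ?_
    rw [h.sameVertex_iff ha]
    refine and_congr_right fun had => ?_
    rw [h.rev fun hd => ha (h.saturated_left had.symm hd), ih]

theorem Away.mem_range_map (h : Away S S' C C' ψ) {a : S.Dart} {ω' : List S'.Dart}
    (hω : S'.IsStoppedWalk C' (ψ a) ω') : ω' ∈ Set.range (List.map ψ) := by
  induction ω' generalizing a with
  | nil => exact ⟨[], rfl⟩
  | cons d' ω' ih =>
    obtain ⟨ha, had, hω⟩ := hω
    obtain ⟨d, rfl⟩ := h.mem_range d' fun hd => ha (h.saturated had.symm hd)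
    rw [h.sameVertex_iff (h.notMem_iff.1 ha)] at had
    rw [h.rev fun hd => h.notMem_iff.1 ha (h.saturated_left had.symm hd)] at hω
    obtain ⟨ω, rfl⟩ := ih hω
    exact ⟨d :: ω, rfl⟩

theorem Away.deg_eq (h : Away S S' C C' ψ) {d : S.Dart} (hd : d ∉ C) :
    S'.deg (ψ d) = S.deg d := by
  refine (Nat.card_congr (Equiv.ofBijective
    (fun d' : {d' // S.SameVertex d d'} => (⟨ψ d'.1, (h.sameVertex_iff hd).2 d'.2⟩ :
      {d' // S'.SameVertex (ψ d) d'})) ⟨fun a b hab => ?_, ?_⟩)).symm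
  · exact Subtype.ext (h.injective (congrArg Subtype.val hab))
  · rintro ⟨b, hb⟩
    obtain ⟨b, rfl⟩ := h.mem_range b fun h' => hd (h.mem_iff.1 (h.saturated hb.symm h'))
    exact ⟨⟨b, (h.sameVertex_iff hd).1 hb⟩, rfl⟩

theorem Away.walkWeight_map (h : Away S S' C C' ψ) {a : S.Dart} {ω : List S.Dart}
    (hω : S.IsStoppedWalk C a ω) : S'.walkWeight (ω.map ψ) = S.walkWeight ω := by
  induction ω generalizing a with
  | nil => simp
  | cons d ω ih =>
    obtain ⟨ha, had, hω⟩ := hω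
    rw [List.map_cons, walkWeight_cons, walkWeight_cons, ih hω,
      h.deg_eq fun hd => ha (h.saturated_left had.symm hd)]

theorem Away.endDart_map (h : Away S S' C C' ψ) {a : S.Dart} {ω : List S.Dart}
    (hω : S.IsStoppedWalk C a ω) : S'.endDart (ψ a) (ω.map ψ) = ψ (S.endDart a ω) := by
  induction ω generalizing a with
  | nil => rfl
  | cons d ω ih =>
    obtain ⟨ha, had, hω⟩ := hω
    rw [List.map_cons, endDart_cons, endDart_cons,
      h.rev fun hd => ha (h.saturated_left had.symm hd), ih hω]

/-- A stopped walk only traverses darts that start outside the stopping set, where the two maps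
agree in rotation, reversal and degree. -/
theorem Away.walkSum_eq (h : Away S S' C C' ψ) (a : S.Dart) (f : S'.Dart → ℝ≥0∞) :
    S'.walkSum C' (ψ a) f = S.walkSum C a (f ∘ ψ) := by
  classical
  rw [walkSum, walkSum, ← (List.map_injective_iff.2 h.injective).tsum_eq]
  · refine tsum_congr fun ω => ?_
    by_cases hω : S.IsStoppedWalk C a ω
    · rw [if_pos hω, if_pos (h.isStoppedWalk_iff.2 hω), h.walkWeight_map hω, h.endDart_map hω]
      rfl
    · rw [if_neg hω, if_neg (mt h.isStoppedWalk_iff.1 hω)]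
  · intro ω' hω'
    rw [Function.mem_support] at hω'
    exact h.mem_range_map (by_contra fun h' => hω' (if_neg h'))

theorem Away.leadsTo (h : Away S S' C C' ψ) {T : Set S.Dart} (hT : ∀ d ∈ T, d ∉ C) {a : S.Dart}
    (ha : S.LeadsTo C T a) : S'.LeadsTo C' (ψ '' T) (ψ a) := by
  induction ha with
  | base ha => exact .base (h.mem_iff.2 ha)
  | step had hd _ ih =>
    refine .step ((h.sameVertex_iff (hT _ hd)).2 had.symm).symm ⟨_, hd, rfl⟩ ?_
    rwa [h.rev (hT _ hd)]

theorem Away.leadsTo_of_image (h : Away S S' C C' ψ) {T : Set S.Dart} (hT : ∀ d ∈ T, d ∉ C)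
    {a' : S'.Dart} (ha : S'.LeadsTo C' (ψ '' T) a') :
    ∀ a, ψ a = a' → S.LeadsTo C T a := by
  induction ha with
  | base ha =>
    rintro a rfl
    exact .base (h.mem_iff.1 ha)
  | step had hd _ ih =>
    rintro a rfl
    obtain ⟨d, hd, rfl⟩ := hd
    exact .step ((h.sameVertex_iff (hT _ hd)).1 had.symm).symm hd
      (ih _ (h.rev (hT _ hd)).symm)

theorem Away.isRootedForest_image (h : Away S S' C C' ψ) {T : Set S.Dart} :
    S'.IsRootedForest C' (ψ '' T) ↔ S.IsRootedForest C T := by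
  constructor
  · intro hT
    have hT0 : ∀ d ∈ T, d ∉ C := fun d hd =>
      h.notMem_iff.1 (hT.notMem _ ⟨d, hd, rfl⟩)
    refine ⟨hT0, fun a ha => ?_, fun a => h.leadsTo_of_image hT0 (hT.leadsTo (ψ a)) a rfl⟩
    obtain ⟨_, ⟨⟨d, hd, rfl⟩, had⟩, huniq⟩ := hT.existsUnique (ψ a) (h.notMem_iff.2 ha)
    refine ⟨d, ⟨hd, (h.sameVertex_iff ha).1 had⟩, fun b hb => h.injective ?_⟩
    exact huniq _ ⟨⟨b, hb.1, rfl⟩, (h.sameVertex_iff ha).2 hb.2⟩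
  · intro hT
    refine ⟨?_, fun a' ha' => ?_, fun a' => ?_⟩
    · rintro _ ⟨d, hd, rfl⟩
      exact h.notMem_iff.2 (hT.notMem d hd)
    · obtain ⟨a, rfl⟩ := h.mem_range a' ha'
      have ha := h.notMem_iff.1 ha'
      obtain ⟨d, ⟨hd, had⟩, huniq⟩ := hT.existsUnique a ha
      refine ⟨ψ d, ⟨⟨d, hd, rfl⟩, (h.sameVertex_iff ha).2 had⟩, ?_⟩
      rintro _ ⟨⟨b, hb, rfl⟩, hab⟩
      rw [huniq b ⟨hb, (h.sameVertex_iff ha).1 hab⟩]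
    · by_cases ha' : a' ∈ C'
      · exact .base ha'
      · obtain ⟨a, rfl⟩ := h.mem_range a' ha'
        exact h.leadsTo hT.notMem (hT.leadsTo a)

/-- A rooted forest consists of darts that start outside the roots, so it is not affected by what
happens at the roots. -/
theorem Away.forestCount_eq (h : Away S S' C C' ψ) : S'.forestCount C' = S.forestCount C := by
  refine (Nat.card_congr (Equiv.ofBijective
    (fun T : {T // S.IsRootedForest C T} => (⟨ψ '' T.1, h.isRootedForest_image.2 T.2⟩ :
      {T // S'.IsRootedForest C' T})) ⟨fun a b hab => ?_, ?_⟩)).symm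
  · exact Subtype.ext (h.injective.image_injective (congrArg Subtype.val hab))
  · rintro ⟨T', hT'⟩
    have : ψ '' (ψ ⁻¹' T') = T' := by
      rw [Set.image_preimage_eq_iff]
      intro d hd
      exact h.mem_range d (hT'.notMem d hd)
    exact ⟨⟨ψ ⁻¹' T', h.isRootedForest_image.1 (by rwa [this])⟩, Subtype.ext this⟩

end MarkedMap

/-! ### Harmonic measure and the weight of a partially unzipped map -/

namespace MarkedMap

variable {S S' : MarkedMap} {n m j : ℕ}

theorem walkSum_congr_start {C : Set S.Dart} (hC : ∀ {a b}, S.SameVertex a b → a ∈ C → b ∈ C)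
    {a b : S.Dart} (hab : S.SameVertex a b) {f : S.Dart → ℝ≥0∞} (hf : f a = f b) :
    S.walkSum C a f = S.walkSum C b f := by
  by_cases ha : a ∈ C
  · rw [walkSum_of_mem ha, walkSum_of_mem (hC hab ha), hf]
  · exact walkSum_congr_of_sameVertex hab ha fun hb => ha (hC hab.symm hb)

theorem cluster_eq_dartsAt (S : MarkedMap) : S.cluster = S.dartsAt (S.org '' S.cluster) := by
  ext d
  refine ⟨fun h => ⟨d, h, rfl⟩, ?_⟩
  rintro ⟨a, ha, had⟩
  exact cluster_congr (org_eq_org.1 had) ha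

theorem dartsAt_insert {C : Set S.Vert} (u : S.Dart) :
    S.dartsAt (insert (S.org u) C) = S.dartsAt C ∪ {d | S.SameVertex u d} := by
  ext d
  rw [mem_dartsAt, Set.mem_insert_iff, org_eq_org, or_comm]
  exact or_congr Iff.rfl ⟨SameVertex.symm, SameVertex.symm⟩

theorem tip_mem_cluster (S : MarkedMap) : S.tip ∈ S.cluster := Or.inl SameVertex.rfl

open Classical in
theorem harmonicMeasure_eq {C : Set S.Dart} (h : S.target ∉ C) (e : S.Dart) :
    S.harmonicMeasure C e = S.walkSum C S.target fun d => if d = e then 1 else 0 := by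
  rw [harmonicMeasure, walkSum]
  refine tsum_congr fun ω => ?_
  by_cases hω : S.IsStoppedWalk C S.target ω
  · have : ω.getLast?.map S.rev = some e ↔ S.endDart S.target ω = e := by
      rw [endDart]
      rcases hl : ω.getLast?.map S.rev with _ | b
      · rw [Option.map_eq_none_iff, List.getLast?_eq_none_iff] at hl
        subst hl
        exact absurd hω h
      · simp
    simp [hω, this]
  · simp [hω]

theorem harmonicMeasure_of_notMem {C : Set S.Dart} {e : S.Dart} (h : S.target ∉ C) (he : e ∉ C) :
    S.harmonicMeasure C e = 0 := by
  classical
  rw [harmonicMeasure_eq h, walkSum, ENNReal.tsum_eq_zero]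
  intro ω
  split_ifs with h1 h2
  · exact absurd (endDart_mem h1) (h2 ▸ he)
  · simp
  · rfl

theorem last_notMem {C : Set S.Dart} (hC : ∀ {a b}, S.SameVertex a b → a ∈ C → b ∈ C)
    {ω : List S.Dart} {a : S.Dart} (hω : S.IsStoppedWalk C a ω) :
    ∀ d ∈ ω, d ∉ C := by
  induction ω generalizing a with
  | nil => simp
  | cons d ω ih =>
    rw [List.forall_mem_cons]
    exact ⟨fun hd => hω.1 (hC hω.2.1.symm hd), ih hω.2.2⟩

/-- Every step of a stopped walk starts outside `C`, so an edge with both ends in `C` is never used.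
-/
theorem harmonicMeasure_of_rev_mem {C : Set S.Dart}
    (hC : ∀ {a b}, S.SameVertex a b → a ∈ C → b ∈ C) (hrev : ∀ d, S.rev (S.rev d) = d)
    {e : S.Dart} (he : S.rev e ∈ C) : S.harmonicMeasure C e = 0 := by
  classical
  rw [harmonicMeasure, ENNReal.tsum_eq_zero]
  intro ω
  rw [if_neg]
  rintro ⟨h1, h2⟩
  obtain ⟨b, hb, rfl⟩ := Option.map_eq_some_iff.1 h2
  rw [hrev] at he
  exact last_notMem hC h1 b (List.mem_of_getLast? hb) he

open Classical in
theorem Away.harmonicMeasure_eq {C : Set S.Dart} {C' : Set S'.Dart} {ψ : S.Dart → S'.Dart}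
    (h : Away S S' C C' ψ) (htarget : S'.SameVertex (ψ S.target) S'.target)
    (ht : S.target ∉ C) (e : S.Dart) :
    S'.harmonicMeasure C' (ψ e) = S.harmonicMeasure C e := by
  have ht1 := h.notMem_iff.2 ht
  have ht' : S'.target ∉ C' := fun h' => ht1 (h.saturated htarget.symm h')
  rw [MarkedMap.harmonicMeasure_eq ht, MarkedMap.harmonicMeasure_eq ht',
    ← walkSum_congr_of_sameVertex htarget ht1 ht', h.walkSum_eq]
  congr 1
  funext d
  simp [h.injective.eq_iff]

open Classical in
/-- The number of spanning forests rooted at the cluster, times the probability that random walk from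
the target hits the cluster at the tip. -/
noncomputable def tipWeight (S : MarkedMap) : ℝ≥0∞ :=
  S.forestCount S.cluster *
    S.walkSum S.cluster S.target fun d => if S.SameVertex S.tip d then 1 else 0

/-- The weight can be computed with the forests and walks of another map that agrees away from the
cluster, in particular on the original map before any unzipping. -/
theorem Away.tipWeight_eq {C : Set S.Dart} {ψ : S.Dart → S'.Dart} {w t : S.Dart}
    (h : Away S S' C S'.cluster ψ) (htip : ∀ d ∈ C, S'.SameVertex S'.tip (ψ d) ↔ S.SameVertex w d)
    (htarget : S'.SameVertex (ψ t) S'.target) :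
    open Classical in
    S'.tipWeight = S.forestCount C * S.walkSum C t fun d => if S.SameVertex w d then 1 else 0 := by
  classical
  rw [tipWeight, h.forestCount_eq, ← walkSum_congr_start cluster_congr htarget, h.walkSum_eq]
  · congr 1
    refine walkSum_congr fun d hd => ?_
    simp only [Function.comp_apply, htip d hd]
  · have : S'.SameVertex S'.tip (ψ t) ↔ S'.SameVertex S'.tip S'.target :=
      ⟨fun h => h.trans htarget, fun h => h.trans htarget.symm⟩
    simp only [this]

theorem IsIso.tipWeight_eq {φ : S.Dart ≃ S'.Dart} (h : IsIso S S' φ) :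
    S'.tipWeight = S.tipWeight :=
  h.away.tipWeight_eq (fun _ _ => ⟨fun h1 => h.sameVertex_iff.1 (h.tip.trans h1),
    fun h1 => h.tip.symm.trans (h.sameVertex_iff.2 h1)⟩) h.target

theorem IsZipped.exists_unzip_rot {e : S.Dart} (hS : S.IsZipped n m j) (he : S.CanUnzip j e) :
    ∃ c, S.IsCorner j e c ∧ (S.unzip e).rot = S.unzipRot e c := by
  obtain ⟨c, hc, e1⟩ := hS.exists_isCorner he
  refine ⟨c, hc, ?_⟩
  unfold MarkedMap.unzip MarkedMap.unzipWith at e1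
  injection e1

theorem IsZipped.unzip_tip_sameVertex_iff {e : S.Dart} (hS : S.IsZipped n m j)
    (he : S.CanUnzip j e) {d : S.Dart} :
    (S.unzip e).SameVertex (S.unzip e).tip (Sum.inl d : S.Dart ⊕ Bool) ↔
      S.SameVertex (S.rev e) d := by
  have := hS.finite
  obtain ⟨c, hc, hrot⟩ := hS.exists_unzip_rot he
  have h1 : ((S.unzip e).rot : Perm (S.Dart ⊕ Bool)).SameCycle (Sum.inr true) (Sum.inl d) ↔
      S.SameVertex (S.rev e) d := by
    rw [hrot]
    have hne := hS.rev_ne e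
    exact ⟨fun h => fold_sameVertex hne hc.sameVertex h, fun h =>
      (unzipRot_true_rev hc.ne_true).trans
        (unzipRot_sameVertex_of_not hne hc.sameVertex hc.ne_true he.rev_self h)⟩
  exact h1

/-- The harmonic measure of an edge at the cluster and the weight of the map in which the edge has been
unzipped. -/
theorem IsZipped.forestCount_mul_harmonicMeasure (hS : S.IsZipped n m j) (ht : S.TipOnGrey j)
    {e : S.Dart} (he : e ∈ S.cluster) (he' : S.rev e ∉ S.cluster) (htarget : S.target ∉ S.cluster) :
    S.forestCount S.cluster * S.harmonicMeasure S.cluster e = (S.unzip e).tipWeight := by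
  classical
  have := hS.finite
  have hcan := canUnzip_of_mem_cluster ht he he'
  rw [(hS.away_unzip ht he he').tipWeight_eq (w := S.rev e) (t := S.target)
    (fun d _ => hS.unzip_tip_sameVertex_iff hcan) SameVertex.rfl, harmonicMeasure_eq htarget]
  have hmem : ∀ {d}, S.org d ∈ S.org '' S.cluster ↔ d ∈ S.cluster := fun {d} => by
    conv_rhs => rw [cluster_eq_dartsAt]
    rfl
  have key := forestCount_mul_walkSum (C := S.org '' S.cluster) hS.rev_rev hS.connected
    (e := e) (a := S.target) (hmem.2 he) (mt hmem.1 he') (mt hmem.1 htarget)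
  rwa [dartsAt_insert, ← cluster_eq_dartsAt] at key

theorem IsZipped.tipOnGrey_unzip {e : S.Dart} : (S.unzip e).TipOnGrey (j + 1) := fun _ =>
  ⟨_, Or.inr (Or.inr rfl), SameVertex.rfl⟩

theorem out_isIso (S : MarkedMap) : ∃ φ, IsIso (⟦S⟧ : IsoClass).out S φ := by
  have h : (⟦S⟧ : IsoClass).out ≈ S := Quotient.exact (Quotient.out_eq _)
  exact h

theorem IsIso.mk_eq {φ : S.Dart ≃ S'.Dart} (h : IsIso S S' φ) : (⟦S⟧ : IsoClass) = ⟦S'⟧ :=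
  Quotient.sound ⟨φ, h⟩

theorem IsIso.tipOnGrey {φ : S.Dart ≃ S'.Dart} (h : IsIso S S' φ) (ht : S.TipOnGrey j) :
    S'.TipOnGrey j := fun hj => by
  obtain ⟨g, hg, h1⟩ := ht hj
  exact ⟨φ g, (h.grey g).2 hg, h.tip.symm.trans (h.sameVertex_iff.2 h1)⟩

theorem IsIso.tip_target_iff {φ : S.Dart ≃ S'.Dart} (h : IsIso S S' φ) :
    S'.SameVertex S'.tip S'.target ↔ S.SameVertex S.tip S.target :=
  ⟨fun h1 => h.sameVertex_iff.1 ((h.tip.trans h1).trans h.target.symm),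
    fun h1 => (h.tip.symm.trans (h.sameVertex_iff.2 h1)).trans h.target⟩

theorem IsIso.target_mem_cluster_iff {φ : S.Dart ≃ S'.Dart} (h : IsIso S S' φ) :
    S'.target ∈ S'.cluster ↔ S.target ∈ S.cluster := by
  rw [← h.mem_cluster_iff]
  exact ⟨cluster_congr h.target.symm, cluster_congr h.target⟩

/-! ### Peeling at the tip and DLA growth as operators -/

open Classical in
/-- The sum of a function over the maps that arise from unzipping an edge at the tip. -/
noncomputable def peelStep (S : MarkedMap) (G : IsoClass → ℝ≥0∞) : ℝ≥0∞ :=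
  if S.target ∈ S.cluster then G ⟦S⟧
  else ∑' e, if S.SameVertex S.tip e ∧ S.rev e ∉ S.cluster then G ⟦S.unzip e⟧ else 0

open Classical in
/-- The expectation of a function of the map after one step of edge-based DLA. -/
noncomputable def growStep (S : MarkedMap) (F : IsoClass → ℝ≥0∞) : ℝ≥0∞ :=
  if S.target ∈ S.cluster then F ⟦S⟧
  else ∑' e, S.harmonicMeasure S.cluster e * F ⟦S.unzip e⟧

/-- Invariance under isomorphism makes the operator on classes independent of the representative
chosen by `Quotient.out`. -/
theorem IsIso.peelStep_eq {φ : S.Dart ≃ S'.Dart} (h : IsIso S S' φ) (hS : S.IsZipped n m j)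
    (ht : S.TipOnGrey j) (G : IsoClass → ℝ≥0∞) : S'.peelStep G = S.peelStep G := by
  classical
  rw [peelStep, peelStep]
  by_cases hc : S.target ∈ S.cluster
  · rw [if_pos hc, if_pos (h.target_mem_cluster_iff.2 hc)]
    exact congrArg G h.mk_eq.symm
  rw [if_neg hc, if_neg (mt h.target_mem_cluster_iff.1 hc), ← φ.tsum_eq]
  refine tsum_congr fun e => ?_
  have h1 : S'.SameVertex S'.tip (φ e) ↔ S.SameVertex S.tip e :=
    ⟨fun h1 => h.sameVertex_iff.1 (h.tip.trans h1),
      fun h1 => h.tip.symm.trans (h.sameVertex_iff.2 h1)⟩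
  rw [h1, ← h.rev, h.mem_cluster_iff]
  by_cases he : S.SameVertex S.tip e ∧ S.rev e ∉ S.cluster
  · have hec : e ∈ S.cluster := Or.inl he.1
    rw [if_pos he, if_pos he, h.unzip hS (canUnzip_of_mem_cluster ht hec he.2)
      fun h' => hc (cluster_congr h' hec)]
  · rw [if_neg he, if_neg he]

theorem IsIso.growStep_eq {φ : S.Dart ≃ S'.Dart} (h : IsIso S S' φ) (hS : S.IsZipped n m j)
    (ht : S.TipOnGrey j) (F : IsoClass → ℝ≥0∞) : S'.growStep F = S.growStep F := by
  classical
  rw [growStep, growStep]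
  by_cases hc : S.target ∈ S.cluster
  · rw [if_pos hc, if_pos (h.target_mem_cluster_iff.2 hc)]
    exact congrArg F h.mk_eq.symm
  rw [if_neg hc, if_neg (mt h.target_mem_cluster_iff.1 hc), ← φ.tsum_eq]
  refine tsum_congr fun e => ?_
  rw [h.away.harmonicMeasure_eq h.target hc]
  by_cases he : e ∈ S.cluster
  · by_cases he' : S.rev e ∈ S.cluster
    · rw [harmonicMeasure_of_rev_mem cluster_congr hS.rev_rev he', zero_mul, zero_mul]
    · rw [h.unzip hS (canUnzip_of_mem_cluster ht he he') fun h' => hc (cluster_congr h' he)]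
  · rw [harmonicMeasure_of_notMem hc he, zero_mul, zero_mul]

/-- `peelStep` as an operator on functions of isomorphism classes. -/
noncomputable def peel (G : IsoClass → ℝ≥0∞) (z : IsoClass) : ℝ≥0∞ := z.out.peelStep G

/-- `growStep` as an operator on functions of isomorphism classes. -/
noncomputable def grow (F : IsoClass → ℝ≥0∞) (z : IsoClass) : ℝ≥0∞ := z.out.growStep F

/-- `tipWeight` as a function of isomorphism classes. -/
noncomputable def classWeight (z : IsoClass) : ℝ≥0∞ := z.out.tipWeight

theorem peel_mk (hS : S.IsZipped n m j) (ht : S.TipOnGrey j) (G : IsoClass → ℝ≥0∞) :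
    peel G ⟦S⟧ = S.peelStep G := by
  obtain ⟨φ, h⟩ := out_isIso S
  exact h.symm.peelStep_eq hS ht G

theorem grow_mk (hS : S.IsZipped n m j) (ht : S.TipOnGrey j) (F : IsoClass → ℝ≥0∞) :
    grow F ⟦S⟧ = S.growStep F := by
  obtain ⟨φ, h⟩ := out_isIso S
  exact h.symm.growStep_eq hS ht F

theorem classWeight_mk (S : MarkedMap) : classWeight ⟦S⟧ = S.tipWeight := by
  obtain ⟨φ, h⟩ := out_isIso S
  exact h.tipWeight_eq.symm

end MarkedMap

theorem ENNReal.tsum_ite_eq_tsum_subtype {α : Type*} (P : α → Prop) [DecidablePred P] (f : α → ℝ≥0∞) :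
    ∑' x, (if P x then f x else 0) = ∑' x : {x // P x}, f x := by
  refine Eq.trans (tsum_congr fun x => ?_) (tsum_subtype {x | P x} f).symm
  by_cases h : P x <;> simp [h]

/-! ### Sums over isomorphism classes and the bijection given by unzipping -/

namespace MarkedMap

variable {S S' : MarkedMap} {n m j : ℕ} {distinct : Prop}

/-- The maps that can arise after `j` edges have been unzipped. -/
structure IsLevel (n m : ℕ) (distinct : Prop) (j : ℕ) (S : MarkedMap) : Prop where
  zipped : S.IsZipped n m j
  tipOnGrey : S.TipOnGrey j
  target : S.SameVertex S.tip S.target ∨ S.target ∉ S.cluster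
  distinct : j = 0 → distinct → ¬ S.SameVertex S.tip S.target

theorem IsLevel.of_isIso {φ : S.Dart ≃ S'.Dart} (h : IsIso S S' φ)
    (hS : S.IsLevel n m distinct j) : S'.IsLevel n m distinct j :=
  ⟨hS.zipped.of_isIso h, h.tipOnGrey hS.tipOnGrey,
    hS.target.imp h.tip_target_iff.2 (mt h.target_mem_cluster_iff.1),
    fun h0 hd => mt h.tip_target_iff.1 (hS.distinct h0 hd)⟩

/-- A map in which the target has not been reached yet. -/
def IsActive (n m : ℕ) (distinct : Prop) (j : ℕ) (S : MarkedMap) : Prop :=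
  S.IsLevel n m distinct j ∧ S.target ∉ S.cluster

theorem IsActive.of_isIso {φ : S.Dart ≃ S'.Dart} (h : IsIso S S' φ)
    (hS : S.IsActive n m distinct j) : S'.IsActive n m distinct j :=
  ⟨hS.1.of_isIso h, mt h.target_mem_cluster_iff.1 hS.2⟩

open Classical in
/-- The sum of a function of isomorphism classes over the classes with a property. -/
noncomputable def classSum (P : MarkedMap → Prop) (G : IsoClass → ℝ≥0∞) : ℝ≥0∞ :=
  ∑' z : IsoClass, if P z.out then G z else 0

theorem IsActive.isLevel_unzip {e : S.Dart} (hS : S.IsActive n m distinct j)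
    (he : S.SameVertex S.tip e ∧ S.rev e ∉ S.cluster) :
    (S.unzip e).IsLevel n m distinct (j + 1) := by
  have hec : e ∈ S.cluster := Or.inl he.1
  have hcan := canUnzip_of_mem_cluster hS.1.tipOnGrey hec he.2
  refine ⟨hS.1.zipped.unzip hcan, IsZipped.tipOnGrey_unzip, ?_, fun h => absurd h (by omega)⟩
  by_contra! h
  have h1 := (hS.1.zipped.away_unzip hS.1.tipOnGrey hec he.2).mem_iff.1 h.2
  rcases h1 with h1 | h1
  · exact hS.2 h1
  · exact h.1 ((hS.1.zipped.unzip_tip_sameVertex_iff hcan).2 h1)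

/-- Pairs of an active map and an edge from its tip to a new vertex are in bijection with the maps
of the next level. Surjectivity is zipping up; injectivity is its uniqueness together with the
absence of automorphisms. -/
theorem classSum_isActive_peel (G : IsoClass → ℝ≥0∞) :
    classSum (IsActive n m distinct j) (peel G) = classSum (IsLevel n m distinct (j + 1)) G := by
  classical
  let P : (Σ z : IsoClass, z.out.Dart) → Prop := fun p => p.1.out.IsActive n m distinct j ∧
    p.1.out.SameVertex p.1.out.tip p.2 ∧ p.1.out.rev p.2 ∉ p.1.out.cluster
  have h1 : classSum (IsActive n m distinct j) (peel G) =
      ∑' p : Σ z : IsoClass, z.out.Dart, if P p then G ⟦p.1.out.unzip p.2⟧ else 0 := by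
    rw [ENNReal.tsum_sigma', classSum]
    refine tsum_congr fun z => ?_
    by_cases hz : z.out.IsActive n m distinct j
    · rw [if_pos hz, peel, peelStep, if_neg hz.2]
      refine tsum_congr fun e => ?_
      simp only [P, hz, true_and]
    · rw [if_neg hz, eq_comm, ENNReal.tsum_eq_zero]
      intro e
      rw [if_neg]
      exact fun h => hz h.1
  have h2 : ∀ p : {p // P p}, (⟦p.1.1.out.unzip p.1.2⟧ : IsoClass).out.IsLevel
      n m distinct (j + 1) := by
    rintro ⟨p, hp⟩
    obtain ⟨φ, hφ⟩ := out_isIso (p.1.out.unzip p.2)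
    exact (hp.1.isLevel_unzip hp.2).of_isIso hφ.symm
  have hbij : Function.Bijective (fun p : {p // P p} =>
      (⟨⟦p.1.1.out.unzip p.1.2⟧, h2 p⟩ :
        {z : IsoClass // z.out.IsLevel n m distinct (j + 1)})) := by
    constructor
    · rintro ⟨⟨z, e⟩, hz, he⟩ ⟨⟨z', e'⟩, hz', he'⟩ h
      have h3 := congrArg Subtype.val h
      dsimp only at hz he hz' he' h3
      have can := canUnzip_of_mem_cluster hz.1.tipOnGrey (Or.inl he.1) he.2
      have can' := canUnzip_of_mem_cluster hz'.1.tipOnGrey (Or.inl he'.1) he'.2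
      obtain ⟨φ, hφ, hφe⟩ := exists_isIso_of_unzip hz.1.zipped hz'.1.zipped can can' he.1.symm
        he'.1.symm h3
      have h4 := hφ.mk_eq
      rw [Quotient.out_eq, Quotient.out_eq] at h4
      subst h4
      -- Zipping up determines the edge only up to an automorphism, and rooted maps have none.
      have h5 : φ = Equiv.refl _ := eq_of_isIso hz.1.zipped.connected hφ (IsIso.refl _)
      rw [h5] at hφe
      subst hφe
      rfl
    · rintro ⟨z', hz'⟩
      obtain ⟨S, e, hS, htip, hte, hre, htarget, h3⟩ :=
        exists_unzip_eq hz'.zipped hz'.tipOnGrey hz'.target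
      obtain ⟨φ, hφ⟩ := out_isIso S
      have hact : S.IsActive n m distinct j := ⟨⟨hS, htip, Or.inr htarget,
        fun _ _ h => htarget (Or.inl h)⟩, htarget⟩
      have hact' := hact.of_isIso hφ.symm
      have he1 : (⟦S⟧ : IsoClass).out.SameVertex (⟦S⟧ : IsoClass).out.tip (φ.symm e) :=
        hφ.symm.tip.symm.trans (hφ.symm.sameVertex_iff.2 hte)
      have he2 : (⟦S⟧ : IsoClass).out.rev (φ.symm e) ∉ (⟦S⟧ : IsoClass).out.cluster := by
        rw [← hφ.symm.rev, hφ.symm.mem_cluster_iff]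
        exact hre
      refine ⟨⟨⟨⟦S⟧, φ.symm e⟩, hact', he1, he2⟩, Subtype.ext ?_⟩
      have h4 := hφ.unzip hact'.1.zipped
        (canUnzip_of_mem_cluster hact'.1.tipOnGrey (Or.inl he1) he2)
        (fun h => hact'.2 (Or.inl (SameVertex.trans he1 h)))
      rw [Equiv.apply_symm_apply, h3, Quotient.out_eq] at h4
      exact h4
  rw [h1, classSum, ENNReal.tsum_ite_eq_tsum_subtype P fun p => G ⟦p.1.out.unzip p.2⟧,
    ENNReal.tsum_ite_eq_tsum_subtype, ← (Equiv.ofBijective _ hbij).tsum_eq]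
  rfl

/-- A map in which the target has been reached. -/
def IsStopped (n m : ℕ) (distinct : Prop) (j : ℕ) (S : MarkedMap) : Prop :=
  S.IsLevel n m distinct j ∧ S.target ∈ S.cluster

theorem classSum_isLevel (G : IsoClass → ℝ≥0∞) :
    classSum (IsLevel n m distinct j) G =
      classSum (IsActive n m distinct j) G + classSum (IsStopped n m distinct j) G := by
  classical
  rw [classSum, classSum, classSum, ← ENNReal.tsum_add]
  refine tsum_congr fun z => ?_
  by_cases h : z.out.IsLevel n m distinct j <;> by_cases h' : z.out.target ∈ z.out.cluster <;>
    simp [IsActive, IsStopped, h, h']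

/-- The sum over the maps in which `k` edges have been unzipped, or fewer if the target has been reached. -/
noncomputable def reachSum (n m : ℕ) (distinct : Prop) (k : ℕ) (G : IsoClass → ℝ≥0∞) : ℝ≥0∞ :=
  classSum (IsLevel n m distinct k) G +
    ∑ j ∈ Finset.range k, classSum (IsStopped n m distinct j) G

theorem classSum_congr_of_out {P : MarkedMap → Prop} {G G' : IsoClass → ℝ≥0∞}
    (h : ∀ z : IsoClass, P z.out → G z = G' z) : classSum P G = classSum P G' := by
  refine tsum_congr fun z => ?_
  split_ifs with hz
  · exact h z hz
  · rfl

theorem reachSum_congr {k : ℕ} {G G' : IsoClass → ℝ≥0∞}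
    (h : ∀ j, classSum (IsStopped n m distinct j) G = classSum (IsStopped n m distinct j) G')
    (h' : classSum (IsActive n m distinct k) G = classSum (IsActive n m distinct k) G') :
    reachSum n m distinct k G = reachSum n m distinct k G' := by
  simp only [reachSum, classSum_isLevel, h, h']

/-- Active maps of level `k` are peeled to level `k + 1`, while stopped ones stay put and move into
the finite sum. -/
theorem reachSum_peel (k : ℕ) (G : IsoClass → ℝ≥0∞) :
    reachSum n m distinct k (peel G) = reachSum n m distinct (k + 1) G := by
  have h : ∀ j, classSum (IsStopped n m distinct j) (peel G) =
      classSum (IsStopped n m distinct j) G := fun j => classSum_congr_of_out fun z hz => by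
    rw [peel, peelStep, if_pos hz.2, Quotient.out_eq]
  rw [reachSum, reachSum, Finset.sum_range_succ, classSum_isLevel, classSum_isActive_peel, h]
  simp only [h]
  ring

end MarkedMap

namespace MarkedMap

variable {S S' : MarkedMap} {n m j : ℕ} {distinct : Prop}

/-! ### Moving the tip along the grey polygon -/

theorem IsIso.withTip {φ : S.Dart ≃ S'.Dart} (h : IsIso S S' φ) (p : S.Dart) :
    IsIso (S.withTip p) (S'.withTip (φ p)) φ :=
  ⟨h.rot, h.rev, h.root, h.grey, SameVertex.rfl, h.target⟩

theorem mk_withTip_congr {p q : S.Dart} (h : S.SameVertex p q) :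
    (⟦S.withTip p⟧ : IsoClass) = ⟦S.withTip q⟧ :=
  IsIso.mk_eq (φ := Equiv.refl _) ⟨fun _ => rfl, fun _ => rfl, rfl, fun _ => Iff.rfl, h,
    SameVertex.rfl⟩

theorem cluster_withTip (ht : S.TipOnGrey j) (hj : 0 < j) {p : S.Dart} (hp : p ∈ S.grey) :
    (S.withTip p).cluster = S.cluster := by
  obtain ⟨g, hg, htg⟩ := ht hj
  ext d
  constructor
  · rintro (h | h)
    · exact Or.inr ⟨p, hp, h⟩
    · exact Or.inr h
  · rintro (h | h)
    · exact Or.inr ⟨g, hg, SameVertex.trans htg.symm h⟩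
    · exact Or.inr h

theorem away_withTip {C : Set S.Dart} (hC : ∀ {a b}, S.SameVertex a b → a ∈ C → b ∈ C)
    (p : S.Dart) : Away S (S.withTip p) C C id :=
  ⟨Function.injective_id, Iff.rfl, fun _ => Iff.rfl, fun _ => rfl, fun d _ => ⟨d, rfl⟩, hC⟩

theorem IsZipped.withTip (h : S.IsZipped n m j) (p : S.Dart) : (S.withTip p).IsZipped n m j :=
  ⟨h.finite, h.rev_rev, h.rev_ne, h.connected, h.edges, h.vertices, h.faces, h.grey_card,
    h.grey_faceRot, h.grey_cycle, h.grey_unique, h.root_notMem⟩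

theorem IsActive.withTip (h : S.IsActive n m distinct j) (hj : 0 < j) {p : S.Dart}
    (hp : p ∈ S.grey) : (S.withTip p).IsActive n m distinct j := by
  have h1 : (S.withTip p).target ∉ (S.withTip p).cluster := by
    rw [cluster_withTip h.1.tipOnGrey hj hp]
    exact h.2
  exact ⟨⟨h.1.zipped.withTip p, fun _ => ⟨p, hp, SameVertex.rfl⟩, Or.inr h1,
    fun h0 => absurd h0 hj.ne'⟩, h1⟩

/-- Different positions of the tip give different classes, again because rooted maps have no
automorphisms. -/
theorem IsActive.withTip_injOn (h : S.IsActive n m distinct j) {p q : S.Dart} (hp : p ∈ S.grey)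
    (hq : q ∈ S.grey) (hpq : (⟦S.withTip p⟧ : IsoClass) = ⟦S.withTip q⟧) : p = q := by
  obtain ⟨φ, hφ⟩ : ∃ φ, IsIso (S.withTip p) (S.withTip q) φ := by
    have h1 : S.withTip p ≈ S.withTip q := Quotient.exact hpq
    exact h1
  -- Moving both tips to the fixed dart `S.root` turns the isomorphism into an automorphism of a
  -- single map.
  have h1 : IsIso (S.withTip S.root) (S.withTip S.root) φ := by
    have := hφ.withTip S.root
    rw [show φ S.root = S.root from hφ.root] at this
    exact this
  have h2 : φ = Equiv.refl _ :=
    eq_of_isIso (S := S.withTip S.root) (S' := S.withTip S.root) h.1.zipped.connected h1 (IsIso.refl _)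
  have h3 : S.SameVertex (φ p) q := hφ.tip
  rw [h2] at h3
  exact h.1.zipped.grey_unique p hp q hq h3

/-- The second class arises from the first by moving the tip along the grey polygon. -/
def Retip (z z' : IsoClass) : Prop := ∃ p ∈ z.out.grey, z' = ⟦z.out.withTip p⟧

theorem retip_mk (S : MarkedMap) (z' : IsoClass) :
    Retip ⟦S⟧ z' ↔ ∃ p ∈ S.grey, z' = ⟦S.withTip p⟧ := by
  obtain ⟨φ, hφ⟩ := out_isIso S
  constructor
  · rintro ⟨p, hp, rfl⟩
    exact ⟨φ p, (hφ.grey p).2 hp, (hφ.withTip p).mk_eq⟩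
  · rintro ⟨p, hp, rfl⟩
    exact ⟨φ.symm p, (hφ.symm.grey p).2 hp, (hφ.symm.withTip p).mk_eq⟩

theorem IsActive.retip (hj : 0 < j) {z z' : IsoClass} (hz : z.out.IsActive n m distinct j)
    (h : Retip z z') : Retip z' z ∧ z'.out.IsActive n m distinct j := by
  obtain ⟨p, hp, rfl⟩ := h
  obtain ⟨g, hg, htg⟩ := hz.1.tipOnGrey hj
  obtain ⟨φ, hφ⟩ := out_isIso (z.out.withTip p)
  refine ⟨(retip_mk _ _).2 ⟨g, hg, ?_⟩, (hz.withTip hj hp).of_isIso hφ.symm⟩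
  have h1 := mk_withTip_congr htg
  have h2 : (⟦z.out.withTip z.out.tip⟧ : IsoClass) = z := Quotient.out_eq z
  rw [h2] at h1
  exact h1

open Classical in
theorem IsActive.tsum_retip {z : IsoClass} (hz : z.out.IsActive n m distinct j)
    (f : IsoClass → ℝ≥0∞) :
    ∑' z', (if Retip z z' then f z' else 0) = ∑' p : z.out.grey, f ⟦z.out.withTip p⟧ := by
  have hinj : Function.Injective fun p : z.out.grey => (⟦z.out.withTip p⟧ : IsoClass) :=
    fun p q hpq => Subtype.ext (hz.withTip_injOn p.2 q.2 hpq)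
  rw [← hinj.tsum_eq]
  · refine tsum_congr fun p => ?_
    rw [if_pos ⟨p, p.2, rfl⟩]
  · intro z' hz'
    rw [Function.mem_support] at hz'
    obtain ⟨p, hp, h⟩ : Retip z z' := by_contra fun h => hz' (if_neg h)
    exact ⟨⟨p, hp⟩, h.symm⟩

/-- Double counting of pairs of classes that differ in the position of the tip: the relation is
symmetric, and each class has `2 * j` partners, one for each corner of the polygon. -/
theorem mul_classSum_isActive (hj : 0 < j) (B : IsoClass → ℝ≥0∞) :
    (2 * j : ℕ) * classSum (IsActive n m distinct j) B = classSum (IsActive n m distinct j)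
      fun z => ∑' p : z.out.grey, B ⟦z.out.withTip p⟧ := by
  classical
  have h1 : ∀ z : IsoClass, z.out.IsActive n m distinct j →
      ∑' z', (if Retip z z' then (1 : ℝ≥0∞) else 0) = (2 * j : ℕ) := by
    intro z hz
    have := hz.1.zipped.finite
    rw [hz.tsum_retip, ENNReal.tsum_const, mul_one, ← hz.1.zipped.grey_card,
      ENat.card_eq_coe_natCard]
    rfl
  calc _ = ∑' z, ∑' z', if z.out.IsActive n m distinct j ∧ Retip z z' then B z else 0 := by
        rw [classSum, ← ENNReal.tsum_mul_left]
        refine tsum_congr fun z => ?_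
        by_cases hz : z.out.IsActive n m distinct j
        · rw [if_pos hz, ← h1 z hz, ← ENNReal.tsum_mul_right]
          refine tsum_congr fun z' => ?_
          by_cases hr : Retip z z' <;> simp [hr, hz]
        · simp [hz]
    _ = ∑' z', ∑' z, if z.out.IsActive n m distinct j ∧ Retip z z' then B z else 0 :=
        ENNReal.tsum_comm
    _ = _ := by
        rw [classSum]
        refine tsum_congr fun z' => ?_
        by_cases hz' : z'.out.IsActive n m distinct j
        · rw [if_pos hz', ← hz'.tsum_retip]
          refine tsum_congr fun z => ?_
          have : (z.out.IsActive n m distinct j ∧ Retip z z') ↔ Retip z' z :=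
            ⟨fun h => (IsActive.retip hj h.1 h.2).1, fun h => (IsActive.retip hj hz' h).symm⟩
          simp only [this]
        · rw [if_neg hz', ENNReal.tsum_eq_zero]
          intro z
          rw [if_neg]
          exact fun h => hz' (IsActive.retip hj h.1 h.2).2

/-- Two functions have the same sum over the active maps if they have the same averages with respect to the
position of the tip. -/
theorem classSum_isActive_congr (hj : 0 < j) {B B' : IsoClass → ℝ≥0∞}
    (h : ∀ S : MarkedMap, S.IsActive n m distinct j →
      ∑' p : S.grey, B ⟦S.withTip p⟧ = ∑' p : S.grey, B' ⟦S.withTip p⟧) :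
    classSum (IsActive n m distinct j) B = classSum (IsActive n m distinct j) B' := by
  have h1 : ((2 * j : ℕ) : ℝ≥0∞) ≠ 0 := by
    have : 2 * j ≠ 0 := by omega
    exact_mod_cast this
  have h2 : ((2 * j : ℕ) : ℝ≥0∞) * classSum (IsActive n m distinct j) B =
      (2 * j : ℕ) * classSum (IsActive n m distinct j) B' := by
    rw [mul_classSum_isActive hj, mul_classSum_isActive hj]
    exact classSum_congr_of_out fun z hz => h _ hz
  exact (ENNReal.mul_right_inj h1 (ENNReal.natCast_ne_top _)).1 h2

open Classical in
/-- The probability that random walk from the target hits the cluster at the origin of `p`. -/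
noncomputable def hitProb (S : MarkedMap) (p : S.Dart) : ℝ≥0∞ :=
  S.walkSum S.cluster S.target fun d => if S.SameVertex p d then 1 else 0

-- The polygon is simple, so each vertex of the cluster has exactly one grey corner.
open Classical in
theorem IsLevel.tsum_grey_ite (hS : S.IsLevel n m distinct j) (hj : 0 < j) {d : S.Dart}
    (hd : d ∈ S.cluster) :
    ∑' p : S.grey, (if S.SameVertex p d then (1 : ℝ≥0∞) else 0) = 1 := by
  obtain ⟨g, hg, hgd⟩ : ∃ g ∈ S.grey, S.SameVertex g d := by
    rcases hd with hd | hd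
    · obtain ⟨g, hg, htg⟩ := hS.tipOnGrey hj
      exact ⟨g, hg, htg.symm.trans hd⟩
    · exact hd
  rw [tsum_eq_single ⟨g, hg⟩, if_pos hgd]
  rintro ⟨p, hp⟩ hpg
  rw [if_neg]
  exact fun h => hpg (Subtype.ext (hS.zipped.grey_unique p hp g hg (SameVertex.trans h hgd.symm)))

theorem tsum_walkSum {ι : Type*} (C : Set S.Dart) (a : S.Dart) (f : ι → S.Dart → ℝ≥0∞) :
    ∑' i, S.walkSum C a (f i) = S.walkSum C a fun d => ∑' i, f i d := by
  classical
  simp only [walkSum]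
  rw [ENNReal.tsum_comm]
  refine tsum_congr fun ω => ?_
  split_ifs
  · rw [ENNReal.tsum_mul_left]
  · simp

theorem IsLevel.walkSum_cluster_one (hS : S.IsLevel n m distinct j) (a : S.Dart) :
    S.walkSum S.cluster a (fun _ => 1) = 1 := by
  have := hS.zipped.finite
  rw [cluster_eq_dartsAt]
  exact walkSum_one (C := S.org '' S.cluster) ⟨_, _, S.tip_mem_cluster, rfl⟩ hS.zipped.connected a

theorem IsLevel.tsum_hitProb (hS : S.IsLevel n m distinct j) (hj : 0 < j) :
    ∑' p : S.grey, S.hitProb p = 1 := by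
  classical
  simp only [hitProb]
  rw [tsum_walkSum]
  refine Eq.trans ?_ (hS.walkSum_cluster_one S.target)
  exact walkSum_congr fun d hd => hS.tsum_grey_ite hj hd

/-- As a function of the tip alone, the weight is proportional to harmonic measure. This is why a
weighted random map has its tip distributed according to harmonic measure, given the rest. -/
theorem IsLevel.classWeight_withTip (hS : S.IsLevel n m distinct j) (hj : 0 < j) {p : S.Dart}
    (hp : p ∈ S.grey) :
    classWeight ⟦S.withTip p⟧ = S.forestCount S.cluster * S.hitProb p := by
  classical
  have h := away_withTip (S := S) (C := S.cluster) cluster_congr p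
  rw [classWeight_mk, tipWeight, cluster_withTip hS.tipOnGrey hj hp, h.forestCount_eq]
  exact congrArg _ (h.walkSum_eq S.target _)

-- The weight of the map in which `e` has been unzipped is the forest count of the old map times the
-- harmonic measure of `e`. Peeling the weighted function therefore samples the edge from harmonic
-- measure, restricted to edges at the tip.
open Classical in
theorem IsActive.peel_eq (hS : S.IsActive n m distinct j) (F : IsoClass → ℝ≥0∞) :
    peel (fun z => classWeight z * F z) ⟦S⟧ = S.forestCount S.cluster *
      ∑' e, if S.SameVertex S.tip e then S.harmonicMeasure S.cluster e * F ⟦S.unzip e⟧ else 0 := by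
  rw [peel_mk hS.1.zipped hS.1.tipOnGrey, peelStep, if_neg hS.2, ← ENNReal.tsum_mul_left]
  refine tsum_congr fun e => ?_
  by_cases he : S.SameVertex S.tip e
  · by_cases he' : S.rev e ∈ S.cluster
    · rw [harmonicMeasure_of_rev_mem cluster_congr hS.1.zipped.rev_rev he']
      simp [he']
    · rw [if_pos ⟨he, he'⟩, if_pos he, classWeight_mk,
        ← hS.1.zipped.forestCount_mul_harmonicMeasure hS.1.tipOnGrey (Or.inl he) he' hS.2, mul_assoc]
  · simp [he]

theorem IsActive.grow_eq (hS : S.IsActive n m distinct j) (F : IsoClass → ℝ≥0∞) :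
    grow F ⟦S⟧ = ∑' e, S.harmonicMeasure S.cluster e * F ⟦S.unzip e⟧ := by
  rw [grow_mk hS.1.zipped hS.1.tipOnGrey, growStep, if_neg hS.2]

theorem IsLevel.mem_cluster_iff_of_zero (hS : S.IsLevel n m distinct 0) {d : S.Dart} :
    d ∈ S.cluster ↔ S.SameVertex S.tip d := by
  rw [mem_cluster, hS.zipped.grey_eq_empty]
  simp

theorem IsLevel.tipWeight_of_zero (hS : S.IsLevel n m distinct 0) :
    S.tipWeight = S.forestCount S.cluster := by
  classical
  rw [tipWeight, walkSum_congr (g := fun _ => 1), hS.walkSum_cluster_one, mul_one]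
  intro d hd
  rw [if_pos (hS.mem_cluster_iff_of_zero.1 hd)]

/-- Summed over the position of the tip, the left-hand side loses the hitting probabilities, which
add up to one. On the right-hand side the restriction to edges at the tip disappears, since each
edge starts at one position. Both become the forest count times the expectation after one step of
DLA. -/
theorem classSum_isActive_grow (F : IsoClass → ℝ≥0∞) :
    classSum (IsActive n m distinct j) (fun z => classWeight z * grow F z) =
      classSum (IsActive n m distinct j) (peel fun z => classWeight z * F z) := by
  classical
  rcases Nat.eq_zero_or_pos j with rfl | hj
  -- Without a polygon the seed is the whole cluster, so every edge that can be added starts at the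
  -- tip and no averaging is needed.
  · refine classSum_congr_of_out fun z hz => ?_
    rw [← Quotient.out_eq z, hz.peel_eq, hz.grow_eq, classWeight_mk, hz.1.tipWeight_of_zero]
    congr 1
    refine tsum_congr fun e => ?_
    split_ifs with h
    · rfl
    · rw [harmonicMeasure_of_notMem hz.2 (mt hz.1.mem_cluster_iff_of_zero.1 h), zero_mul]
  refine classSum_isActive_congr hj fun S hS => ?_
  have hharm : ∀ (p e : S.Dart), (S.withTip p).harmonicMeasure S.cluster e =
      S.harmonicMeasure S.cluster e := fun p e =>
    (away_withTip cluster_congr p).harmonicMeasure_eq SameVertex.rfl hS.2 e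
  have h1 : ∀ p : S.grey, classWeight ⟦S.withTip p⟧ * grow F ⟦S.withTip p⟧ =
      S.hitProb p * (S.forestCount S.cluster *
        ∑' e, S.harmonicMeasure S.cluster e * F ⟦S.unzip e⟧) := fun p => by
    rw [(hS.withTip hj p.2).grow_eq, hS.1.classWeight_withTip hj p.2,
      cluster_withTip hS.1.tipOnGrey hj p.2, mul_comm (S.forestCount _ : ℝ≥0∞), mul_assoc]
    -- Unzipping sets a new tip, so `(S.withTip p).unzip e` and `S.unzip e` agree by definition;
    -- only the harmonic measure has to be compared.
    exact congrArg _ (congrArg _ (tsum_congr fun e => congrArg (· * _) (hharm p e)))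
  have h2 : ∀ p : S.grey, peel (fun z => classWeight z * F z) ⟦S.withTip p⟧ =
      S.forestCount S.cluster * ∑' e, if S.SameVertex p e then
        S.harmonicMeasure S.cluster e * F ⟦S.unzip e⟧ else 0 := fun p => by
    rw [(hS.withTip hj p.2).peel_eq, cluster_withTip hS.1.tipOnGrey hj p.2,
      (away_withTip (S := S) (C := S.cluster) cluster_congr p).forestCount_eq]
    refine congrArg _ (tsum_congr fun e => ?_)
    exact congrArg (fun u => if S.SameVertex p e then u * F ⟦S.unzip e⟧ else 0) (hharm p e)
  simp only [h1, h2]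
  rw [ENNReal.tsum_mul_right, hS.1.tsum_hitProb hj, one_mul, ENNReal.tsum_mul_left,
    ENNReal.tsum_comm]
  congr 1
  refine tsum_congr fun e => ?_
  by_cases he : e ∈ S.cluster
  · have h3 : ∀ p : S.grey, (if S.SameVertex p e then
        S.harmonicMeasure S.cluster e * F ⟦S.unzip e⟧ else 0) =
        (if S.SameVertex p e then 1 else 0) * (S.harmonicMeasure S.cluster e * F ⟦S.unzip e⟧) :=
      fun p => by rw [ite_mul, one_mul, zero_mul]
    simp only [h3]
    rw [ENNReal.tsum_mul_right, hS.1.tsum_grey_ite hj he, one_mul]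
  · rw [harmonicMeasure_of_notMem hS.2 he]
    simp

/-- One step of DLA carries the weighted sum over maps to the weighted sum one level further, just
as peeling does. -/
theorem reachSum_grow (k : ℕ) (F : IsoClass → ℝ≥0∞) :
    reachSum n m distinct k (fun z => classWeight z * grow F z) =
      reachSum n m distinct (k + 1) fun z => classWeight z * F z := by
  rw [← reachSum_peel]
  refine reachSum_congr (fun j => classSum_congr_of_out fun z hz => ?_) (classSum_isActive_grow F)
  rw [grow, growStep, peel, peelStep, if_pos hz.2, if_pos hz.2, Quotient.out_eq]

end MarkedMap

namespace MarkedMap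

variable {S S' : MarkedMap} {n m j : ℕ} {distinct : Prop}

/-! ### Resampling the tip -/

open Classical in
theorem resampleTip_eq (S : MarkedMap) (z : IsoClass) : S.resampleTip z =
    S.walkSum S.cluster S.target fun d => if (⟦S.withTip d⟧ : IsoClass) = z then 1 else 0 := by
  rw [resampleTip, walkSum]
  refine tsum_congr fun ω => ?_
  by_cases h : S.IsStoppedWalk S.cluster S.target ω
  · simp only [h, true_and, if_true, mul_ite, mul_one, mul_zero]
    rfl
  · simp [h]

theorem IsIso.resampleTip_eq {φ : S.Dart ≃ S'.Dart} (h : IsIso S S' φ) (z : IsoClass) :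
    S'.resampleTip z = S.resampleTip z := by
  classical
  rw [MarkedMap.resampleTip_eq, MarkedMap.resampleTip_eq,
    ← walkSum_congr_start cluster_congr h.target, h.away.walkSum_eq]
  · refine walkSum_congr fun d _ => ?_
    rw [Function.comp_apply, (h.withTip d).mk_eq]
  · rw [mk_withTip_congr h.target]

/-- `resampleTip` as a function of isomorphism classes. -/
noncomputable def resampleClass (z z' : IsoClass) : ℝ≥0∞ := z'.out.resampleTip z

theorem resampleClass_mk (z : IsoClass) (S : MarkedMap) :
    resampleClass z ⟦S⟧ = S.resampleTip z := by
  obtain ⟨φ, h⟩ := out_isIso S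
  exact (h.resampleTip_eq z).symm

open Classical in
theorem IsLevel.resampleTip_of_forall (hS : S.IsLevel n m distinct j)
    (h : ∀ d ∈ S.cluster, S.SameVertex S.tip d) (z : IsoClass) :
    S.resampleTip z = if (⟦S⟧ : IsoClass) = z then 1 else 0 := by
  have h1 : ∀ d ∈ S.cluster, (if (⟦S.withTip d⟧ : IsoClass) = z then (1 : ℝ≥0∞) else 0) =
      if (⟦S⟧ : IsoClass) = z then 1 else 0 := fun d hd => by
    rw [← mk_withTip_congr (h d hd)]
    rfl
  rw [resampleTip_eq, walkSum_congr (g := fun _ => if (⟦S⟧ : IsoClass) = z then 1 else 0) h1]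
  split_ifs
  · exact hS.walkSum_cluster_one _
  · simp [walkSum]

open Classical in
theorem IsLevel.resampleTip_of_target_mem (hS : S.IsLevel n m distinct j)
    (h : S.target ∈ S.cluster) (z : IsoClass) :
    S.resampleTip z = if (⟦S⟧ : IsoClass) = z then 1 else 0 := by
  rw [resampleTip_eq, walkSum_of_mem h, ← mk_withTip_congr (hS.target.resolve_right (not_not.2 h))]
  rfl

-- Averaged over its old position, the tip is resampled from a distribution that it already has. On
-- stopped maps the walk has length zero and resampling is trivial.
open Classical in
theorem classSum_isActive_resample (z : IsoClass) :
    classSum (IsActive n m distinct j) (fun z' => classWeight z' * resampleClass z z') =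
      classSum (IsActive n m distinct j) fun z' => classWeight z' * if z' = z then 1 else 0 := by
  rcases Nat.eq_zero_or_pos j with rfl | hj
  · refine classSum_congr_of_out fun z' hz' => ?_
    rw [resampleClass, hz'.1.resampleTip_of_forall
      (fun d hd => hz'.1.mem_cluster_iff_of_zero.1 hd), Quotient.out_eq]
  refine classSum_isActive_congr hj fun S hS => ?_
  have h1 : ∀ p : S.grey, resampleClass z ⟦S.withTip p⟧ = S.resampleTip z := fun p => by
    rw [resampleClass_mk, resampleTip_eq, resampleTip_eq,
      cluster_withTip hS.1.tipOnGrey hj p.2]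
    exact (away_withTip (S := S) (C := S.cluster) cluster_congr p).walkSum_eq S.target _
  have h2 : ∀ p : S.grey, classWeight ⟦S.withTip p⟧ = S.forestCount S.cluster * S.hitProb p :=
    fun p => hS.1.classWeight_withTip hj p.2
  simp only [h1, h2, mul_assoc]
  rw [ENNReal.tsum_mul_left, ENNReal.tsum_mul_left, ENNReal.tsum_mul_right, hS.1.tsum_hitProb hj,
    one_mul]
  congr 1
  have h3 : ∀ p : S.grey, (S.hitProb p * if (⟦S.withTip p⟧ : IsoClass) = z then 1 else 0) =
      S.walkSum S.cluster S.target fun d => (if S.SameVertex p d then 1 else 0) *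
        if (⟦S.withTip d⟧ : IsoClass) = z then 1 else 0 := fun p => by
    rw [hitProb, walkSum, walkSum, ← ENNReal.tsum_mul_right]
    refine tsum_congr fun ω => ?_
    by_cases hω : S.IsStoppedWalk S.cluster S.target ω
    · rw [if_pos hω, if_pos hω, mul_assoc]
      congr 1
      by_cases hp : S.SameVertex p (S.endDart S.target ω)
      · rw [mk_withTip_congr hp]
      · simp [hp]
    · simp [hω]
  simp only [h3]
  rw [tsum_walkSum, resampleTip_eq]
  refine walkSum_congr fun d hd => ?_
  rw [ENNReal.tsum_mul_right, hS.1.tsum_grey_ite hj hd, one_mul]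

open Classical in
theorem reachSum_resample (k : ℕ) (z : IsoClass) :
    reachSum n m distinct k (fun z' => classWeight z' * resampleClass z z') =
      reachSum n m distinct k fun z' => classWeight z' * if z' = z then 1 else 0 := by
  refine reachSum_congr (fun j => classSum_congr_of_out fun z' hz' => ?_)
    (classSum_isActive_resample z)
  rw [resampleClass, hz'.1.resampleTip_of_target_mem hz'.2, Quotient.out_eq]

/-! ### Several steps -/

theorem reachSum_peel_iterate (i k : ℕ) (G : IsoClass → ℝ≥0∞) :
    reachSum n m distinct i (peel^[k] G) = reachSum n m distinct (i + k) G := by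
  induction k generalizing i with
  | zero => rfl
  | succ k ih => rw [Function.iterate_succ_apply', reachSum_peel, ih, add_right_comm, add_assoc]

theorem reachSum_grow_iterate (i k : ℕ) (F : IsoClass → ℝ≥0∞) :
    reachSum n m distinct i (fun z => classWeight z * grow^[k] F z) =
      reachSum n m distinct (i + k) fun z => classWeight z * F z := by
  induction k generalizing i with
  | zero => rfl
  | succ k ih =>
    simp only [Function.iterate_succ_apply']
    rw [reachSum_grow, ih, add_right_comm, add_assoc]

theorem peel_iterate_mk_of_target_mem (hS : S.IsZipped n m j) (ht : S.TipOnGrey j)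
    (h : S.target ∈ S.cluster) (G : IsoClass → ℝ≥0∞) (k : ℕ) : peel^[k] G ⟦S⟧ = G ⟦S⟧ := by
  induction k with
  | zero => rfl
  | succ k ih => rw [Function.iterate_succ_apply', peel_mk hS ht, peelStep, if_pos h, ih]

theorem grow_iterate_mk_of_target_mem (hS : S.IsZipped n m j) (ht : S.TipOnGrey j)
    (h : S.target ∈ S.cluster) (F : IsoClass → ℝ≥0∞) (k : ℕ) : grow^[k] F ⟦S⟧ = F ⟦S⟧ := by
  induction k with
  | zero => rfl
  | succ k ih => rw [Function.iterate_succ_apply', grow_mk hS ht, growStep, if_pos h, ih]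

end MarkedMap

/-! ### Following the darts of the original map through the unzipping -/

namespace MarkedMap

variable {M S : MarkedMap} {n m j : ℕ} {distinct : Prop} {C : Set M.Dart} {ι : M.Dart → S.Dart}

/-- The map `S` arises from `M` by changes at the set of vertices `C`, which becomes the cluster. -/
structure Tracks (M S : MarkedMap) (C : Set M.Dart) (ι : M.Dart → S.Dart) : Prop where
  away : Away M S C S.cluster ι
  target : S.SameVertex (ι M.target) S.target

theorem Tracks.target_mem_iff (h : Tracks M S C ι) : S.target ∈ S.cluster ↔ M.target ∈ C := by
  rw [← h.away.mem_iff]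
  exact ⟨cluster_congr h.target.symm, cluster_congr h.target⟩

theorem Tracks.rev_eq (h : Tracks M S C ι) (hM : ∀ d, M.rev (M.rev d) = d)
    (hS : ∀ d, S.rev (S.rev d) = d) {e : M.Dart} (he : M.rev e ∉ C) :
    S.rev (ι e) = ι (M.rev e) := by
  have h1 := h.away.rev he
  rw [hM] at h1
  rw [← h1, hS]

theorem Tracks.exists_eq_of_rev_notMem (h : Tracks M S C ι) (hM : ∀ d, M.rev (M.rev d) = d)
    (hS : ∀ d, S.rev (S.rev d) = d) {e' : S.Dart} (he : S.rev e' ∉ S.cluster) :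
    ∃ e, M.rev e ∉ C ∧ ι e = e' := by
  obtain ⟨d, hd⟩ := h.away.mem_range _ he
  have hdC : d ∉ C := by
    rw [← hd] at he
    exact h.away.notMem_iff.1 he
  refine ⟨M.rev d, by rwa [hM], ?_⟩
  rw [← h.away.rev hdC, hd, hS]

theorem IsZipped.unzip_sameVertex_inl_iff {e a b : S.Dart} (hS : S.IsZipped n m j)
    (he : S.CanUnzip j e) (ha : ¬ S.SameVertex e a) :
    (S.unzip e).SameVertex (Sum.inl a : S.Dart ⊕ Bool) (Sum.inl b : S.Dart ⊕ Bool) ↔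
      S.SameVertex a b := by
  have := hS.finite
  obtain ⟨c, hc, hrot⟩ := hS.exists_unzip_rot he
  have h1 : ((S.unzip e).rot : Perm (S.Dart ⊕ Bool)).SameCycle (Sum.inl a) (Sum.inl b) ↔
      S.SameVertex a b := by
    rw [hrot]
    have hne := hS.rev_ne e
    exact ⟨fun h => fold_sameVertex hne hc.sameVertex h,
      unzipRot_sameVertex_of_not hne hc.sameVertex hc.ne_true ha⟩
  exact h1

theorem Tracks.unzip (h : Tracks M S C ι) (hM : ∀ d, M.rev (M.rev d) = d)
    (hS : S.IsZipped n m j) (ht : S.TipOnGrey j) {e : M.Dart} (he : e ∈ C) (he' : M.rev e ∉ C)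
    (htarget : M.target ∉ C) :
    Tracks M (S.unzip (ι e)) (C ∪ {d | M.SameVertex (M.rev e) d}) fun d => Sum.inl (ι d) := by
  have hrev := h.rev_eq hM hS.rev_rev he'
  have he1 : ι e ∈ S.cluster := h.away.mem_iff.2 he
  have he2 : S.rev (ι e) ∉ S.cluster := hrev ▸ h.away.notMem_iff.2 he'
  refine ⟨?_, ?_⟩
  · have h1 := h.away.union he'
    rw [← hrev] at h1
    exact h1.trans (hS.away_unzip ht he1 he2)
  · refine (hS.unzip_sameVertex_inl_iff (canUnzip_of_mem_cluster ht he1 he2) fun h' => ?_).2 h.target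
    exact h.away.notMem_iff.2 htarget (cluster_congr h' he1)

/-! ### Edge-based DLA and unzipping -/

theorem dlaAux_of_mem {C : Set M.Dart} (h : M.target ∈ C) (γ : List M.Dart) :
    open Classical in M.dlaAux C γ = if γ = [] then 1 else 0 := by
  rcases γ with _ | ⟨e, γ⟩ <;> simp [dlaAux, h]

theorem tsum_dlaAux_of_notMem {C : Set M.Dart} (h : M.target ∉ C) (H : List M.Dart → ℝ≥0∞) :
    ∑' γ, M.dlaAux C γ * H γ = ∑' e, M.harmonicMeasure C e *
      ∑' γ, M.dlaAux (C ∪ {d | M.SameVertex (M.rev e) d}) γ * H (e :: γ) := by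
  rw [ENNReal.tsum_list]
  simp only [dlaAux, h, if_false, zero_mul, zero_add, mul_assoc, ENNReal.tsum_mul_left]

/-- Induction on the number of vertices outside the cluster. Each step adds a new vertex, and the
total harmonic measure is one because the walk hits the cluster almost surely. -/
theorem tsum_dlaAux [Finite M.Dart] (hrev : ∀ d, M.rev (M.rev d) = d)
    (hM : ∀ a b, M.Joined Set.univ a b) {A : Set M.Vert} (hA : A.Nonempty) :
    ∑' γ, M.dlaAux (M.dartsAt A) γ = 1 := by
  classical
  obtain ⟨N, hN⟩ : ∃ N, Aᶜ.ncard ≤ N := ⟨_, le_rfl⟩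
  induction N generalizing A with
  | zero =>
    have h0 : Aᶜ = ∅ := (Set.ncard_eq_zero (Set.toFinite _)).1 (by omega)
    have h1 : M.target ∈ M.dartsAt A := by
      rw [Set.compl_empty_iff.1 h0]
      trivial
    simp only [dlaAux_of_mem h1, tsum_ite_eq]
  | succ N ih =>
    by_cases h1 : M.target ∈ M.dartsAt A
    · simp only [dlaAux_of_mem h1, tsum_ite_eq]
    have h2 := tsum_dlaAux_of_notMem h1 fun _ => 1
    simp only [mul_one] at h2
    rw [h2]
    have h3 : ∀ e, M.harmonicMeasure (M.dartsAt A) e * ∑' γ, M.dlaAux (M.dartsAt A ∪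
        {d | M.SameVertex (M.rev e) d}) γ = M.harmonicMeasure (M.dartsAt A) e := by
      intro e
      by_cases he : M.rev e ∈ M.dartsAt A
      · rw [harmonicMeasure_of_rev_mem (dartsAt_saturated A _ _) hrev he, zero_mul]
      · rw [← dartsAt_insert, ih ⟨_, Set.mem_insert _ _⟩, mul_one]
        have h4 : (insert (M.org (M.rev e)) A)ᶜ ⊂ Aᶜ :=
          compl_lt_compl_iff_lt.2 (Set.ssubset_insert he)
        have := Set.ncard_lt_ncard h4
        omega
    simp only [h3]
    simp only [harmonicMeasure_eq h1]
    rw [tsum_walkSum]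
    refine Eq.trans ?_ (walkSum_one hA hM M.target)
    simp

/-- Growth on the fixed map `M` with cluster `A` has the same harmonic measures as growth on the
unzipped map `S`, whose cluster is the polygon. The whole history thus becomes a Markov chain on
unzipped maps. -/
theorem tsum_dlaAux_mul_unzipAux (hM : M.IsZipped n m 0) (F : IsoClass → ℝ≥0∞) (k : ℕ)
    {A : Set M.Vert} (hA : A.Nonempty) (h : Tracks M S (M.dartsAt A) ι) (hS : S.IsZipped n m j)
    (ht : S.TipOnGrey j) :
    ∑' γ, M.dlaAux (M.dartsAt A) γ * F ⟦unzipAux (γ.take k) S ι⟧ = grow^[k] F ⟦S⟧ := by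
  classical
  have := hM.finite
  induction k generalizing A S j with
  | zero =>
    simp only [List.take_zero, unzipAux]
    rw [ENNReal.tsum_mul_right, tsum_dlaAux hM.rev_rev hM.connected hA, one_mul]
    rfl
  | succ k ih =>
    by_cases h1 : M.target ∈ M.dartsAt A
    · rw [grow_iterate_mk_of_target_mem hS ht (h.target_mem_iff.2 h1)]
      simp only [dlaAux_of_mem h1]
      rw [tsum_eq_single []]
      · simp [unzipAux]
      · intro γ hγ
        simp [hγ]
    rw [tsum_dlaAux_of_notMem h1, Function.iterate_succ_apply', grow_mk hS ht, growStep,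
      if_neg (mt h.target_mem_iff.1 h1), ← h.away.injective.tsum_eq]
    · refine tsum_congr fun e => ?_
      rw [h.away.harmonicMeasure_eq h.target h1]
      by_cases he : e ∈ M.dartsAt A
      · by_cases he' : M.rev e ∈ M.dartsAt A
        · rw [harmonicMeasure_of_rev_mem (dartsAt_saturated A _ _) hM.rev_rev he', zero_mul,
            zero_mul]
        · have hu := h.unzip hM.rev_rev hS ht he he' h1
          have he2 : S.rev (ι e) ∉ S.cluster := by
            rw [h.rev_eq hM.rev_rev hS.rev_rev he']
            exact h.away.notMem_iff.2 he'
          rw [← dartsAt_insert] at hu ⊢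
          rw [← ih ⟨_, Set.mem_insert _ _⟩ hu
            (hS.unzip (canUnzip_of_mem_cluster ht (h.away.mem_iff.2 he) he2))
            IsZipped.tipOnGrey_unzip]
          rfl
      · rw [harmonicMeasure_of_notMem h1 he, zero_mul, zero_mul]
    -- Darts that do not come from `M` lie on edges with both ends at the polygon and have harmonic
    -- measure zero.
    · intro e' he'
      by_contra hr
      apply he'
      dsimp only
      by_cases h2 : S.rev e' ∈ S.cluster
      · rw [harmonicMeasure_of_rev_mem cluster_congr hS.rev_rev h2, zero_mul]
      · obtain ⟨e, -, rfl⟩ := h.exists_eq_of_rev_notMem hM.rev_rev hS.rev_rev h2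
        exact absurd ⟨e, rfl⟩ hr

/-! ### Loop-erased random walk and unzipping -/

/-- Summation over the first edge of the loop erasure. Edges that lead back to visited vertices drop
out, since the remaining walk is killed at once. -/
theorem mul_tsum_lerwSum [Finite M.Dart] {A : Set M.Vert} {t : M.Vert} {w : M.Dart} (ht : t ∉ A)
    (hw : M.org w ∉ A) (hwt : M.org w ≠ t) (H : List M.Dart → ℝ≥0∞) :
    open Classical in
    M.forestCount (M.dartsAt (insert t A)) * ∑' γ, M.lerwSum A t w γ * H γ =
      ∑' e, if M.SameVertex w e ∧ M.rev e ∉ M.dartsAt (insert (M.org w) A) then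
        M.forestCount (M.dartsAt (insert t (insert (M.org w) A))) *
          ∑' γ, M.lerwSum (insert (M.org w) A) t (M.rev e) γ * H (e :: γ) else 0 := by
  classical
  rw [ENNReal.tsum_list, lerwSum_nil hwt, zero_mul, zero_add, ← ENNReal.tsum_mul_left]
  refine tsum_congr fun e => ?_
  by_cases he : M.SameVertex w e
  · have h1 : ∀ γ, M.forestCount (M.dartsAt (insert t A)) * (M.lerwSum A t w (e :: γ) * H (e :: γ)) =
        M.forestCount (M.dartsAt (insert t (insert (M.org w) A))) *
          (M.lerwSum (insert (M.org w) A) t (M.rev e) γ * H (e :: γ)) := fun γ => by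
      rw [← mul_assoc, forestCount_mul_lerwSum_cons he (by simp [hwt, hw]), mul_assoc]
    rw [← ENNReal.tsum_mul_left]
    simp only [h1]
    rw [ENNReal.tsum_mul_left]
    by_cases he' : M.rev e ∈ M.dartsAt (insert (M.org w) A)
    · have h2 : ∀ γ, M.lerwSum (insert (M.org w) A) t (M.rev e) γ = 0 := fun γ =>
        lerwSum_of_mem (by simp [hwt.symm, ht]) he'
      simp [h2]
    · rw [if_pos ⟨he, he'⟩]
  · rw [if_neg (fun h => he h.1)]
    simp [lerwSum_cons_of_not_sameVertex he]

-- Reversibility: the summed left-hand side is the probability that a walk from `w` reaches the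
-- target before `A`, and on the right the walk runs from the target to `w`. Stripping off the first
-- edge of the erased path gives, by induction, the harmonic measures of the edges at `w`, which add
-- up to the probability of arriving at `w`.
open Classical in
theorem forestCount_mul_tsum_lerwSum [Finite M.Dart] (hrev : ∀ d, M.rev (M.rev d) = d)
    (hM : ∀ a b, M.Joined Set.univ a b) {A : Set M.Vert} {w : M.Dart} (ht : M.org M.target ∉ A)
    (hw : M.org w ∉ A) :
    M.forestCount (M.dartsAt (insert (M.org M.target) A)) *
        ∑' γ, M.lerwSum A (M.org M.target) w γ =
      M.forestCount (M.dartsAt (insert (M.org w) A)) *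
        M.walkSum (M.dartsAt (insert (M.org w) A)) M.target
          fun d => if M.SameVertex w d then 1 else 0 := by
  obtain ⟨N, hN⟩ : ∃ N, Aᶜ.ncard ≤ N := ⟨_, le_rfl⟩
  induction N generalizing A w with
  | zero =>
    have h0 : Aᶜ = ∅ := (Set.ncard_eq_zero (Set.toFinite _)).1 (by omega)
    exact absurd (Set.compl_empty_iff.1 h0 ▸ Set.mem_univ _) ht
  | succ N ih =>
    by_cases hwt : M.org w = M.org M.target
    · simp only [lerwSum_of_eq hwt, tsum_ite_eq]
      rw [walkSum_of_mem (by simp [hwt]), if_pos (org_eq_org.1 hwt), hwt]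
    have h2 := mul_tsum_lerwSum ht hw hwt fun _ => 1
    simp only [mul_one] at h2
    have htC : M.target ∉ M.dartsAt (insert (M.org w) A) := fun h =>
      h.elim (fun h => hwt h.symm) ht
    have h3 : ∀ e, (if M.SameVertex w e ∧ M.rev e ∉ M.dartsAt (insert (M.org w) A) then
        M.forestCount (M.dartsAt (insert (M.org M.target) (insert (M.org w) A))) *
          ∑' γ, M.lerwSum (insert (M.org w) A) (M.org M.target) (M.rev e) γ else 0) =
        M.forestCount (M.dartsAt (insert (M.org w) A)) *
          M.walkSum (M.dartsAt (insert (M.org w) A)) M.target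
            fun d => if M.SameVertex w e ∧ d = e then 1 else 0 := by
      intro e
      by_cases he : M.SameVertex w e
      · by_cases he' : M.rev e ∈ M.dartsAt (insert (M.org w) A)
        · have h4 := harmonicMeasure_of_rev_mem (dartsAt_saturated _ _ _) hrev he'
          rw [harmonicMeasure_eq htC] at h4
          simp only [he, true_and, h4, mul_zero, he', not_true_eq_false, and_false, if_false]
        · rw [if_pos ⟨he, he'⟩, ih (A := insert (M.org w) A) htC he']
          · rw [← forestCount_mul_walkSum (C := insert (M.org w) A) hrev hM
              (by simp [org_eq_org.2 he]) he' htC]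
            simp only [he, true_and]
          · have h4 : (insert (M.org w) A)ᶜ ⊂ Aᶜ :=
              compl_lt_compl_iff_lt.2 (Set.ssubset_insert hw)
            have := Set.ncard_lt_ncard h4
            omega
      · simp [he, walkSum]
    rw [h2]
    simp only [h3]
    rw [ENNReal.tsum_mul_left, tsum_walkSum]
    congr 1
    refine walkSum_congr fun d _ => ?_
    rw [tsum_eq_single d]
    · simp
    · intro e he
      rw [if_neg]
      exact fun h => he h.2.symm

/-- The forest counts telescope along the erased path: each edge enlarges the set of killed vertices
by one, and `peel` sums over the possible edges without further weights. The remaining path sums up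
to the weight of the current map. -/
theorem mul_tsum_lerwSum_mul_unzipAux (hM : M.IsZipped n m 0) (F : IsoClass → ℝ≥0∞) (k : ℕ)
    {A : Set M.Vert} {w : M.Dart} (htA : M.org M.target ∉ A) (hw : M.org w ∉ A)
    (h : Tracks M S (M.dartsAt (insert (M.org w) A)) ι)
    (htip : ∀ d, S.SameVertex S.tip (ι d) ↔ M.SameVertex w d) (hS : S.IsZipped n m j)
    (ht : S.TipOnGrey j) :
    M.forestCount (M.dartsAt (insert (M.org M.target) A)) *
        ∑' γ, M.lerwSum A (M.org M.target) w γ * F ⟦unzipAux (γ.take k) S ι⟧ =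
      peel^[k] (fun z => classWeight z * F z) ⟦S⟧ := by
  classical
  have := hM.finite
  have hweight := h.away.tipWeight_eq (fun d _ => htip d) h.target
  induction k generalizing A w S j with
  | zero =>
    simp only [List.take_zero, unzipAux]
    rw [ENNReal.tsum_mul_right, ← mul_assoc,
      forestCount_mul_tsum_lerwSum hM.rev_rev hM.connected htA hw, ← hweight, ← classWeight_mk]
    rfl
  | succ k ih =>
    by_cases hwt : M.org w = M.org M.target
    · have h1 : M.target ∈ M.dartsAt (insert (M.org w) A) := by simp [hwt]
      rw [peel_iterate_mk_of_target_mem hS ht (h.target_mem_iff.2 h1), classWeight_mk, hweight,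
        walkSum_of_mem h1, if_pos (org_eq_org.1 hwt), mul_one, tsum_eq_single [], hwt,
        lerwSum_of_eq hwt]
      · simp [unzipAux]
      · intro γ hγ
        simp [lerwSum_of_eq hwt, hγ]
    have h1 : M.target ∉ M.dartsAt (insert (M.org w) A) := fun h =>
      h.elim (fun h => hwt h.symm) htA
    rw [mul_tsum_lerwSum htA hw hwt, Function.iterate_succ_apply', peel_mk hS ht, peelStep,
      if_neg (mt h.target_mem_iff.1 h1), ← h.away.injective.tsum_eq]
    · refine tsum_congr fun e => ?_
      by_cases he' : M.rev e ∈ M.dartsAt (insert (M.org w) A)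
      · rw [if_neg (fun h => h.2 he'), if_neg]
        rintro ⟨h2, h3⟩
        obtain ⟨e1, he1, h4⟩ := h.exists_eq_of_rev_notMem hM.rev_rev hS.rev_rev h3
        rw [h.away.injective h4] at he1
        exact he1 he'
      have hrev := h.rev_eq hM.rev_rev hS.rev_rev he'
      have he2 : S.rev (ι e) ∉ S.cluster := by
        rw [hrev]
        exact h.away.notMem_iff.2 he'
      simp only [htip, he', he2, not_false_eq_true, and_true]
      split_ifs with he
      · have hec : e ∈ M.dartsAt (insert (M.org w) A) := by simp [org_eq_org.2 he]
        have hu := h.unzip hM.rev_rev hS ht hec he' h1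
        have hcan := canUnzip_of_mem_cluster ht (h.away.mem_iff.2 hec) he2
        rw [← dartsAt_insert] at hu
        have htip' : ∀ d, (S.unzip (ι e)).SameVertex (S.unzip (ι e)).tip (Sum.inl (ι d)) ↔
            M.SameVertex (M.rev e) d := fun d => by
          refine (hS.unzip_tip_sameVertex_iff hcan).trans ?_
          rw [hrev]
          exact h.away.sameVertex_iff he'
        exact ih (A := insert (M.org w) A) h1 he' hu htip' (hS.unzip hcan) IsZipped.tipOnGrey_unzip
          (hu.away.tipWeight_eq (fun d _ => htip' d) hu.target)
      · rfl
    · intro e' he'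
      rw [Function.mem_support] at he'
      obtain ⟨-, h3⟩ : S.SameVertex S.tip e' ∧ S.rev e' ∉ S.cluster :=
        by_contra fun h2 => he' (if_neg h2)
      obtain ⟨e, -, rfl⟩ := h.exists_eq_of_rev_notMem hM.rev_rev hS.rev_rev h3
      exact ⟨e, rfl⟩

end MarkedMap

/-! ### Expectations under the random map -/

namespace MarkedMap

variable {M S : MarkedMap} {n m : ℕ} {distinct : Prop}

theorem isLevel_zero_iff : M.IsLevel n m distinct 0 ↔
    M.IsRootedPlanarMap n m ∧ (distinct → ¬ M.SameVertex M.tip M.target) := by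
  refine ⟨fun h => ⟨h.zipped.isRootedPlanarMap, h.distinct rfl⟩, fun h => ⟨h.1.isZipped,
    fun h0 => absurd h0 (lt_irrefl 0), ?_, fun _ => h.2⟩⟩
  rw [mem_cluster, h.1.grey]
  simpa using em _

theorem mapWeight_eq (c : IsoClass) [Decidable (c.out.IsLevel n m distinct 0)] :
    mapWeight n m distinct c =
      if c.out.IsLevel n m distinct 0 then (c.out.numSpanningTrees : ℝ≥0∞) else 0 := by
  rw [mapWeight]
  congr 1
  exact propext isLevel_zero_iff.symm

theorem IsLevel.cluster_of_zero (hM : M.IsLevel n m distinct 0) :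
    M.cluster = M.dartsAt {M.org M.tip} := by
  ext d
  rw [hM.mem_cluster_iff_of_zero, mem_dartsAt, Set.mem_singleton_iff, org_eq_org]
  exact ⟨SameVertex.symm, SameVertex.symm⟩

/-- Before any unzipping the cluster is the seed alone, and the walk from the target hits it with
probability one. -/
theorem IsLevel.numSpanningTrees_of_zero (hM : M.IsLevel n m distinct 0) :
    (M.numSpanningTrees : ℝ≥0∞) = M.tipWeight := by
  have := hM.zipped.finite
  rw [hM.tipWeight_of_zero, hM.cluster_of_zero, numSpanningTrees_eq hM.zipped.rev_rev]

theorem tracks_id (M : MarkedMap) : Tracks M M M.cluster id :=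
  ⟨away_id cluster_congr, SameVertex.rfl⟩

theorem IsLevel.tsum_lerwProb (hM : M.IsLevel n m distinct 0) (F : IsoClass → ℝ≥0∞) (k : ℕ) :
    M.numSpanningTrees * ∑' γ, M.lerwProb γ * F ⟦M.unzipList (γ.take k)⟧ =
      peel^[k] (fun z => classWeight z * F z) ⟦M⟧ := by
  have := hM.zipped.finite
  have h := tracks_id M
  rw [hM.cluster_of_zero, ← insert_empty_eq] at h
  have key := mul_tsum_lerwSum_mul_unzipAux hM.zipped F k (A := ∅) (Set.notMem_empty _)
    (Set.notMem_empty _) h (fun _ => Iff.rfl) hM.zipped hM.tipOnGrey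
  rw [insert_empty_eq, ← numSpanningTrees_eq hM.zipped.rev_rev] at key
  simp only [lerwProb_eq]
  exact key

theorem tipVertex_eq (M : MarkedMap) : M.tipVertex = M.dartsAt {M.org M.tip} := by
  ext d
  exact ⟨fun h => (org_eq_org.2 h).symm, fun h => org_eq_org.1 (Eq.symm h)⟩

theorem IsLevel.tsum_dlaProb (hM : M.IsLevel n m distinct 0) (F : IsoClass → ℝ≥0∞) (k : ℕ) :
    ∑' γ, M.dlaProb γ * F ⟦M.unzipList (γ.take k)⟧ = grow^[k] F ⟦M⟧ := by
  have h := tracks_id M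
  rw [hM.cluster_of_zero] at h
  simp only [dlaProb, tipVertex_eq]
  exact tsum_dlaAux_mul_unzipAux hM.zipped F k (Set.singleton_nonempty _) h hM.zipped hM.tipOnGrey

theorem reachSum_zero (G : IsoClass → ℝ≥0∞) :
    reachSum n m distinct 0 G = classSum (IsLevel n m distinct 0) G := by
  simp [reachSum]

/-- The expectation of a function of the map and of a random list of its darts. -/
noncomputable def expect (n m : ℕ) (distinct : Prop) (P : (S : MarkedMap) → List S.Dart → ℝ≥0∞)
    (X : (S : MarkedMap) → List S.Dart → ℝ≥0∞) : ℝ≥0∞ :=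
  ∑' c : IsoClass, mapLaw n m distinct c * ∑' γ, P c.out γ * X c.out γ

/-- The number of spanning trees in the map law is the factor with which the path probabilities
telescope; only the normalisation remains in front. -/
theorem expect_eq (P X : (S : MarkedMap) → List S.Dart → ℝ≥0∞) (G : IsoClass → ℝ≥0∞)
    (h : ∀ c : IsoClass, c.out.IsLevel n m distinct 0 →
      c.out.numSpanningTrees * ∑' γ, P c.out γ * X c.out γ = G c) :
    expect n m distinct P X =
      (∑' c, mapWeight n m distinct c)⁻¹ * classSum (IsLevel n m distinct 0) G := by
  classical
  rw [expect, classSum, ← ENNReal.tsum_mul_left]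
  refine tsum_congr fun c => ?_
  rw [mapLaw, mapWeight_eq, ENNReal.div_eq_inv_mul, mul_assoc]
  congr 1
  split_ifs with hc
  · exact h c hc
  · exact zero_mul _

/-- Applied to indicator functions, this says that each map occurs after `k` steps with probability
proportional to its weight. -/
theorem expect_lerwProb (F : IsoClass → ℝ≥0∞) (k : ℕ) :
    expect n m distinct lerwProb (fun S γ => F ⟦S.unzipList (γ.take k)⟧) =
      (∑' c, mapWeight n m distinct c)⁻¹ *
        reachSum n m distinct k fun z => classWeight z * F z := by
  rw [expect_eq _ _ (peel^[k] fun z => classWeight z * F z), ← reachSum_zero,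
    reachSum_peel_iterate, zero_add]
  intro c hc
  rw [hc.tsum_lerwProb F k, Quotient.out_eq]

/-- The right-hand side is the same as for loop-erased walk, which is the heart of the proposition.
-/
theorem expect_dlaProb (F : IsoClass → ℝ≥0∞) (k : ℕ) :
    expect n m distinct dlaProb (fun S γ => F ⟦S.unzipList (γ.take k)⟧) =
      (∑' c, mapWeight n m distinct c)⁻¹ *
        reachSum n m distinct k fun z => classWeight z * F z := by
  rw [expect_eq _ _ (fun z => classWeight z * grow^[k] F z), ← reachSum_zero,
    reachSum_grow_iterate, zero_add]
  intro c hc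
  rw [hc.tsum_dlaProb F k, hc.numSpanningTrees_of_zero, classWeight, Quotient.out_eq]

theorem expect_congr {P X X' : (S : MarkedMap) → List S.Dart → ℝ≥0∞}
    (h : ∀ c : IsoClass, c.out.IsLevel n m distinct 0 → ∀ γ, P c.out γ ≠ 0 →
      X c.out γ = X' c.out γ) :
    expect n m distinct P X = expect n m distinct P X' := by
  classical
  refine tsum_congr fun c => ?_
  by_cases hc : c.out.IsLevel n m distinct 0
  · congr 1
    refine tsum_congr fun γ => ?_
    by_cases hγ : P c.out γ = 0
    · rw [hγ, zero_mul, zero_mul]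
    · rw [h c hc γ hγ]
  · rw [mapLaw, mapWeight_eq, if_neg hc, ENNReal.zero_div, zero_mul, zero_mul]

/-! ### The number of steps -/

/-- Each edge of the loop erasure leaves a new vertex, so the set of killed vertices grows strictly.
-/
theorem length_le_of_lerwSum_ne_zero [Finite M.Dart] (hM : ∀ a b, M.Joined Set.univ a b)
    {A : Set M.Vert} {w : M.Dart} {t : M.Vert} (ht : t ∉ A) {γ : List M.Dart}
    (h : M.lerwSum A t w γ ≠ 0) : γ.length ≤ Aᶜ.ncard := by
  induction γ generalizing A w with
  | nil => exact Nat.zero_le _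
  | cons e γ ih =>
    have hw : M.org w ∉ A := fun hw => h (lerwSum_of_mem ht hw)
    have hwe : M.SameVertex w e := by_contra fun h' => h (lerwSum_cons_of_not_sameVertex h')
    have hwt : M.org w ≠ t := by
      intro hwt
      classical
      rw [lerwSum_of_eq hwt] at h
      simp at h
    have h1 := forestCount_mul_lerwSum_cons (γ := γ) hwe (A := A) (t := t) (by simp [hw, hwt])
    have h2 : (M.forestCount (M.dartsAt (insert t A)) : ℝ≥0∞) ≠ 0 := by
      exact_mod_cast (forestCount_pos (Set.insert_nonempty t A) hM).ne'
    have h3 : M.lerwSum (insert (M.org w) A) t (M.rev e) γ ≠ 0 := by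
      intro h3
      rw [h3, mul_zero] at h1
      exact (mul_ne_zero h2 h) h1
    have h4 := ih (A := insert (M.org w) A) (by simp [ht, hwt.symm]) h3
    have h5 : (insert (M.org w) A)ᶜ ⊂ Aᶜ := compl_lt_compl_iff_lt.2 (Set.ssubset_insert hw)
    have := Set.ncard_lt_ncard h5
    rw [List.length_cons]
    omega

theorem length_le_of_dlaAux_ne_zero [Finite M.Dart] (hrev : ∀ d, M.rev (M.rev d) = d)
    {A : Set M.Vert} {γ : List M.Dart} (h : M.dlaAux (M.dartsAt A) γ ≠ 0) :
    γ.length ≤ Aᶜ.ncard := by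
  induction γ generalizing A with
  | nil => exact Nat.zero_le _
  | cons e γ ih =>
    have ht : M.target ∉ M.dartsAt A := by
      intro ht
      classical
      rw [dlaAux_of_mem ht] at h
      simp at h
    rw [dlaAux, if_neg ht] at h
    have he : M.rev e ∉ M.dartsAt A := fun he => left_ne_zero_of_mul h
      (harmonicMeasure_of_rev_mem (dartsAt_saturated A _ _) hrev he)
    have h3 := right_ne_zero_of_mul h
    rw [← dartsAt_insert] at h3
    have h4 := ih h3
    have h5 : (insert (M.org (M.rev e)) A)ᶜ ⊂ Aᶜ :=
      compl_lt_compl_iff_lt.2 (Set.ssubset_insert he)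
    have := Set.ncard_lt_ncard h5
    rw [List.length_cons]
    omega

theorem IsZipped.ncard_compl_le (hM : M.IsZipped n m 0) (A : Set M.Vert) :
    Aᶜ.ncard ≤ m + 1 := by
  have := hM.finite
  refine (Set.ncard_le_card _).trans ?_
  have := hM.vertices
  rw [numCycles] at this
  exact this.le

theorem ncard_unzipAux_grey {D : Type} (γ : List D) (S : MarkedMap) (ι : D → S.Dart)
    (hS : Finite S.Dart) : (unzipAux γ S ι).grey.ncard = S.grey.ncard + 2 * γ.length := by
  induction γ generalizing S with
  | nil => rfl
  | cons e γ ih =>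
    have h1 : Finite (S.unzip (ι e)).Dart := inferInstanceAs (Finite (S.Dart ⊕ Bool))
    have h2 : (S.unzip (ι e)).grey.ncard = S.grey.ncard + 2 :=
      ncard_unzipWith_grey (S := S) (e := ι e) (c := Sum.inr false)
    refine (ih _ _ h1).trans ?_
    rw [h2, List.length_cons]
    ring

/-- Each unzipping adds two corners to the polygon. The number of edges can be read off from the
final map, so equality of the laws of the final maps settles the lengths too. -/
theorem IsLevel.ncard_grey_unzipList (hM : M.IsLevel n m distinct 0) (γ : List M.Dart) :
    (⟦M.unzipList γ⟧ : IsoClass).out.grey.ncard = 2 * γ.length := by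
  obtain ⟨φ, hφ⟩ := out_isIso (M.unzipList γ)
  have h1 := ncard_unzipAux_grey γ M id hM.zipped.finite
  rw [hM.zipped.grey_card, mul_zero, zero_add] at h1
  rw [← h1, ← unzipList, ← hφ.image_grey, Set.ncard_image_of_injective _ φ.injective]

theorem IsLevel.length_le_of_lerwProb_ne_zero (hM : M.IsLevel n m distinct 0)
    {γ : List M.Dart} (h : M.lerwProb γ ≠ 0) : γ.length ≤ m + 1 := by
  have := hM.zipped.finite
  rw [lerwProb_eq] at h
  exact (length_le_of_lerwSum_ne_zero hM.zipped.connected (Set.notMem_empty _) h).trans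
    (hM.zipped.ncard_compl_le _)

theorem IsLevel.length_le_of_dlaProb_ne_zero (hM : M.IsLevel n m distinct 0)
    {γ : List M.Dart} (h : M.dlaProb γ ≠ 0) : γ.length ≤ m + 1 := by
  have := hM.zipped.finite
  rw [dlaProb, tipVertex_eq] at h
  exact (length_le_of_dlaAux_ne_zero hM.zipped.rev_rev h).trans (hM.zipped.ncard_compl_le _)

/-- Neither process takes more than `m + 1` steps, so unzipping everything is unzipping the first `m
+ 1` edges. -/
theorem expect_unzipList_lerwProb_eq_dlaProb (F : IsoClass → ℝ≥0∞) :
    expect n m distinct lerwProb (fun S γ => F ⟦S.unzipList γ⟧) =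
      expect n m distinct dlaProb (fun S γ => F ⟦S.unzipList γ⟧) := by
  have h1 : expect n m distinct lerwProb (fun S γ => F ⟦S.unzipList γ⟧) =
      expect n m distinct lerwProb (fun S γ => F ⟦S.unzipList (γ.take (m + 1))⟧) :=
    expect_congr fun c hc γ hγ => by
      rw [List.take_of_length_le (hc.length_le_of_lerwProb_ne_zero hγ)]
  have h2 : expect n m distinct dlaProb (fun S γ => F ⟦S.unzipList γ⟧) =
      expect n m distinct dlaProb (fun S γ => F ⟦S.unzipList (γ.take (m + 1))⟧) :=
    expect_congr fun c hc γ hγ => by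
      rw [List.take_of_length_le (hc.length_le_of_dlaProb_ne_zero hγ)]
  rw [h1, h2, expect_lerwProb, expect_dlaProb]

open Classical in
theorem lawOf_length_eq_expect (P : (S : MarkedMap) → List S.Dart → ℝ≥0∞) (ℓ : ℕ) :
    lawOf n m distinct P (fun _ γ => γ.length) ℓ = expect n m distinct P fun S γ =>
      if (⟦S.unzipList γ⟧ : IsoClass).out.grey.ncard = 2 * ℓ then 1 else 0 := by
  refine expect_congr (X := fun S γ => @ite _ (γ.length = ℓ) (Classical.propDecidable _) 1 0)
    fun c hc γ _ => ?_
  rw [hc.ncard_grey_unzipList]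
  by_cases h : γ.length = ℓ
  · rw [if_pos h, if_pos (by rw [h])]
  · rw [if_neg h, if_neg (by omega)]

theorem tsum_lawOf_length_eq_expect (P : (S : MarkedMap) → List S.Dart → ℝ≥0∞) :
    ∑' ℓ, lawOf n m distinct P (fun _ γ => γ.length) ℓ = expect n m distinct P fun _ _ => 1 := by
  simp only [lawOf, jointLaw, expect]
  rw [ENNReal.tsum_comm]
  refine tsum_congr fun c => ?_
  rw [ENNReal.tsum_mul_left, ENNReal.tsum_comm]
  congr 1
  refine tsum_congr fun γ => ?_
  rw [ENNReal.tsum_mul_left, tsum_eq_single γ.length, if_pos rfl]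
  exact fun ℓ hℓ => if_neg hℓ.symm

theorem classSum_classWeight :
    classSum (IsLevel n m distinct 0) classWeight = ∑' c, mapWeight n m distinct c := by
  classical
  refine tsum_congr fun c => ?_
  rw [mapWeight_eq]
  split_ifs with hc
  · rw [hc.numSpanningTrees_of_zero, classWeight]
  · rfl

end MarkedMap

namespace MarkedMap

variable {n m : ℕ} {distinct : Prop}

/-! ### The partition function -/

/-- The decorated maps with darts `Fin N` and without grey polygon. -/
def finMap (N : ℕ) (q : Perm (Fin N) × Perm (Fin N) × Fin N × Fin N × Fin N) : MarkedMap where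
  Dart := Fin N
  rot := q.1
  rev := q.2.1
  root := q.2.2.1
  grey := ∅
  tip := q.2.2.2.1
  target := q.2.2.2.2

theorem IsRootedPlanarMap.mem_range_finMap {M : MarkedMap} (hM : M.IsRootedPlanarMap n m) :
    (⟦M⟧ : IsoClass) ∈ Set.range fun q => (⟦finMap (2 * n) q⟧ : IsoClass) := by
  have := hM.finite
  let ε : M.Dart ≃ Fin (2 * n) := (Finite.equivFin M.Dart).trans (finCongr hM.edges)
  refine ⟨(ε.permCongr M.rot, ε.permCongr M.rev, ε M.root, ε M.tip, ε M.target), ?_⟩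
  refine (IsIso.mk_eq (φ := ε) ⟨fun d => ?_, fun d => ?_, rfl, fun d => ?_, SameVertex.rfl,
    SameVertex.rfl⟩).symm
  · exact (congrArg (fun x => ε (M.rot x)) (ε.symm_apply_apply d)).symm
  · exact (congrArg (fun x => ε (M.rev x)) (ε.symm_apply_apply d)).symm
  · rw [hM.grey]
    exact Iff.rfl

/-- Every class of positive weight is represented by a map on `Fin (2 * n)`, so only finitely many
classes contribute. -/
theorem tsum_mapWeight_ne_top : ∑' c, mapWeight n m distinct c ≠ ∞ := by
  classical
  have hfin : (Set.range fun q => (⟦finMap (2 * n) q⟧ : IsoClass)).Finite := Set.finite_range _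
  rw [tsum_eq_sum (s := hfin.toFinset)]
  · refine ENNReal.sum_ne_top.2 fun c _ => ?_
    rw [mapWeight_eq]
    split_ifs
    · exact ENNReal.natCast_ne_top _
    · exact ENNReal.zero_ne_top
  · intro c hc
    rw [mapWeight_eq, if_neg]
    intro h
    apply hc
    rw [Set.Finite.mem_toFinset, ← Quotient.out_eq c]
    exact h.zipped.isRootedPlanarMap.mem_range_finMap

/-- The map with a single edge, which is a loop if `rot` is a transposition. -/
def edgeMap (rot : Perm Bool) : MarkedMap where
  Dart := Bool
  rot := rot
  rev := Equiv.swap false true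
  root := true
  grey := ∅
  tip := true
  target := true

theorem isRootedPlanarMap_edgeMap {rot : Perm Bool} (hv : numCycles rot = m + 1)
    (hf : numCycles (rot⁻¹ * Equiv.swap false true) + m = 2) :
    (edgeMap rot).IsRootedPlanarMap 1 m where
  finite := inferInstanceAs (Finite Bool)
  rev_rev := by
    have h : ∀ b : Bool, Equiv.swap false true (Equiv.swap false true b) = b := by decide
    exact h
  rev_ne := by
    have h : ∀ b : Bool, Equiv.swap false true b ≠ b := by decide
    exact h
  connected := by
    have h : ∀ a b : Bool, a = b ∨ b = Equiv.swap false true a := by decide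
    intro a b
    rcases h a b with h | h
    · rw [h]
      exact .refl
    · exact .single (Or.inr ⟨trivial, h⟩)
  edges := Nat.card_eq_fintype_card (α := Bool)
  vertices := hv
  faces := hf
  grey := rfl

/-- Splitting an edge into two parallel edges, and possibly also its origin. -/
theorem IsRootedPlanarMap.unzipWith {M : MarkedMap} {e : M.Dart} {c : M.Dart ⊕ Bool} {m' : ℕ}
    (hM : M.IsRootedPlanarMap n m) (hc : c ≠ Sum.inr true)
    (hv : numCycles (M.unzipWith e c).rot = m' + 1)
    (hf : numCycles (M.unzipWith e c).faceRot + m' = n + 1 + 1) :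
    IsRootedPlanarMap (n + 1) m' { M.unzipWith e c with grey := ∅ } where
  finite := by
    have := hM.finite
    exact inferInstanceAs (Finite (M.Dart ⊕ Bool))
  rev_rev := unzipRev_unzipRev hM.rev_rev
  rev_ne := unzipRev_ne hM.rev_ne
  connected :=
    have := hM.finite
    unzipWith_joined hM.rev_rev (hM.rev_ne e) hc hM.connected
  edges := by
    have := hM.finite
    have h : Nat.card (M.Dart ⊕ Bool) = 2 * (n + 1) := by
      rw [Nat.card_sum, hM.edges, Nat.card_eq_fintype_card (α := Bool), Fintype.card_bool]
      ring
    exact h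
  vertices := hv
  faces := hf
  grey := rfl

/-- Starting from a loop or a single edge, doubling an edge adds a face, and splitting its origin in
addition adds a vertex instead. -/
theorem exists_isRootedPlanarMap (hn : 1 ≤ n) (hmn : m ≤ n) :
    ∃ M : MarkedMap, M.IsRootedPlanarMap n m := by
  induction n, hn using Nat.le_induction generalizing m with
  | base =>
    have h1 : numCycles (1 : Perm Bool) = 2 := by simp [numCycles_one]
    have h2 : numCycles (Equiv.swap false true) = 1 := numCycles_swap_false_true
    interval_cases m
    · refine ⟨_, isRootedPlanarMap_edgeMap (rot := Equiv.swap false true) h2 ?_⟩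
      rw [inv_mul_cancel, h1]
    · refine ⟨_, isRootedPlanarMap_edgeMap (rot := 1) h1 ?_⟩
      rw [inv_one, one_mul, h2]
  | succ n hn ih =>
    by_cases h : m ≤ n
    · obtain ⟨M, hM⟩ := ih h
      have := hM.finite
      refine ⟨_, hM.unzipWith (e := M.root) (c := Sum.inr false) (by simp) ?_ ?_⟩
      · exact (numCycles_unzipRot_false (S := M)).trans hM.vertices
      · rw [numCycles_unzipWith_faceRot_false hM.rev_rev (hM.rev_ne _), add_right_comm, hM.faces]
    · obtain ⟨M, hM⟩ := ih (m := m - 1) (by omega)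
      have := hM.finite
      have hf := hM.faces
      -- Splitting at the corner of the doubled dart itself merges the new 2-gon with an existing
      -- face and increases only the number of vertices.
      refine ⟨_, hM.unzipWith (e := M.root) (c := Sum.inl M.root) (by simp) ?_ ?_⟩
      · refine (numCycles_unzipRot (hM.rev_ne _) SameVertex.rfl).trans ?_
        rw [hM.vertices]
        omega
      · rw [numCycles_unzipWith_faceRot hM.rev_rev (hM.rev_ne _)]
        omega

theorem exists_isLevel_zero (hn : 1 ≤ n) (hmn : m ≤ n) (hm : distinct → 1 ≤ m) :
    ∃ M : MarkedMap, M.IsLevel n m distinct 0 := by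
  obtain ⟨M, hM⟩ := exists_isRootedPlanarMap hn hmn
  have := hM.finite
  obtain ⟨a, b, hab⟩ : ∃ a b, distinct → ¬ M.SameVertex a b := by
    by_cases hd : distinct
    · have h1 : 1 < Nat.card M.Vert := by
        have h2 : Nat.card M.Vert = m + 1 := hM.vertices
        have := hm hd
        omega
      have : Nontrivial M.Vert := Finite.one_lt_card_iff_nontrivial.1 h1
      obtain ⟨v, w, hvw⟩ := exists_pair_ne M.Vert
      refine ⟨v.out, w.out, fun _ h => hvw ?_⟩
      rw [← org_out v, ← org_out w, org_eq_org.2 h]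
    · exact ⟨M.root, M.root, fun h => absurd h hd⟩
  exact ⟨{ M with tip := a, target := b }, isLevel_zero_iff.2 ⟨⟨hM.finite, hM.rev_rev, hM.rev_ne,
    hM.connected, hM.edges, hM.vertices, hM.faces, hM.grey⟩, hab⟩⟩

theorem tsum_mapWeight_ne_zero (hn : 1 ≤ n) (hmn : m ≤ n) (hm : distinct → 1 ≤ m) :
    ∑' c, mapWeight n m distinct c ≠ 0 := by
  classical
  obtain ⟨M, hM⟩ := exists_isLevel_zero hn hmn hm
  obtain ⟨φ, hφ⟩ := out_isIso M
  have h1 := hM.of_isIso hφ.symm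
  have := h1.zipped.finite
  intro h
  have h2 := ENNReal.tsum_eq_zero.1 h ⟦M⟧
  rw [mapWeight_eq, if_pos h1, numSpanningTrees_eq h1.zipped.rev_rev ((⟦M⟧ : IsoClass).out.org (⟦M⟧ : IsoClass).out.tip)] at h2
  have h3 := forestCount_pos (C := {(⟦M⟧ : IsoClass).out.org (⟦M⟧ : IsoClass).out.tip}) (Set.singleton_nonempty _) h1.zipped.connected
  exact h3.ne' (by exact_mod_cast h2)

theorem expect_lerwProb_one (h0 : ∑' c, mapWeight n m distinct c ≠ 0) :
    expect n m distinct lerwProb (fun _ _ => 1) = 1 := by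
  have h := expect_lerwProb (n := n) (m := m) (distinct := distinct) (fun _ => 1) 0
  simp only [mul_one] at h
  rw [h, reachSum_zero]
  exact (congrArg _ classSum_classWeight).trans
    (ENNReal.inv_mul_cancel h0 tsum_mapWeight_ne_top)

theorem expect_dlaProb_one (h0 : ∑' c, mapWeight n m distinct c ≠ 0) :
    expect n m distinct dlaProb (fun _ _ => 1) = 1 := by
  have h := expect_dlaProb (n := n) (m := m) (distinct := distinct) (fun _ => 1) 0
  have h' := expect_lerwProb (n := n) (m := m) (distinct := distinct) (fun _ => 1) 0
  rw [h, ← h', expect_lerwProb_one h0]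

theorem lawOf_eq_expect {β : Type*} (P : (S : MarkedMap) → List S.Dart → ℝ≥0∞)
    (f : (S : MarkedMap) → List S.Dart → β) (b : β) [∀ b', Decidable (b' = b)] :
    lawOf n m distinct P f b = expect n m distinct P fun S γ => if f S γ = b then 1 else 0 := by
  simp only [lawOf, jointLaw, expect]
  congr!

end MarkedMap

/-! ### The proposition -/

theorem proposition2p3 (n m : ℕ) (distinct : Prop) (hn : 1 ≤ n) (hmn : m ≤ n)
    (hm : distinct → 1 ≤ m) :
    -- the random map, the walk and the growth process are well defined: the laws have total mass one
    (∑' ℓ : ℕ, MarkedMap.lawOf n m distinct MarkedMap.lerwProb (fun _ γ => γ.length) ℓ = 1) ∧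
    (∑' ℓ : ℕ, MarkedMap.lawOf n m distinct MarkedMap.dlaProb (fun _ γ => γ.length) ℓ = 1) ∧
    -- the number of edges
    (∀ ℓ : ℕ,
      MarkedMap.lawOf n m distinct MarkedMap.dlaProb (fun _ γ => γ.length) ℓ =
        MarkedMap.lawOf n m distinct MarkedMap.lerwProb (fun _ γ => γ.length) ℓ) ∧
    -- the map after unzipping the first `k` steps, with its tip where the zipper has stopped
    (∀ (k : ℕ) (z : MarkedMap.IsoClass),
      MarkedMap.lawOf n m distinct MarkedMap.lerwProb (fun S γ => ⟦S.unzipList (γ.take k)⟧) z =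
        MarkedMap.lawOf n m distinct MarkedMap.dlaProb
          (fun S γ => ⟦S.unzipList (γ.take k)⟧) z) ∧
    -- the same, with the tip on the side of DLA resampled from harmonic measure
    (∀ (k : ℕ) (z : MarkedMap.IsoClass),
      MarkedMap.lawOf n m distinct MarkedMap.lerwProb (fun S γ => ⟦S.unzipList (γ.take k)⟧) z =
        MarkedMap.jointLaw n m distinct MarkedMap.dlaProb
          (fun S γ => (S.unzipList (γ.take k)).resampleTip) z) ∧
    -- the map after unzipping all edges
    (∀ z : MarkedMap.IsoClass,
      MarkedMap.lawOf n m distinct MarkedMap.lerwProb (fun S γ => ⟦S.unzipList γ⟧) z =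
        MarkedMap.lawOf n m distinct MarkedMap.dlaProb (fun S γ => ⟦S.unzipList γ⟧) z) := by
  classical
  have h0 := MarkedMap.tsum_mapWeight_ne_zero hn hmn hm
  refine ⟨?_, ?_, fun ℓ => ?_, fun k z => ?_, fun k z => ?_, fun z => ?_⟩
  · rw [MarkedMap.tsum_lawOf_length_eq_expect, MarkedMap.expect_lerwProb_one h0]
  · rw [MarkedMap.tsum_lawOf_length_eq_expect, MarkedMap.expect_dlaProb_one h0]
  · rw [MarkedMap.lawOf_length_eq_expect, MarkedMap.lawOf_length_eq_expect]
    -- The length is a function of the fully unzipped map, namely half the number of its grey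
    -- corners.
    exact (MarkedMap.expect_unzipList_lerwProb_eq_dlaProb fun z =>
      if z.out.grey.ncard = 2 * ℓ then 1 else 0).symm
  · rw [MarkedMap.lawOf_eq_expect, MarkedMap.lawOf_eq_expect]
    exact (MarkedMap.expect_lerwProb (fun z' => if z' = z then 1 else 0) k).trans
      (MarkedMap.expect_dlaProb (fun z' => if z' = z then 1 else 0) k).symm
  -- The resampling kernel is used as the test function; under the weights it may be replaced by the
  -- indicator function of `z`, which leads back to the loop-erased side.
  · have h1 := MarkedMap.expect_dlaProb (n := n) (m := m) (distinct := distinct)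
      (MarkedMap.resampleClass z) k
    rw [MarkedMap.reachSum_resample, ← MarkedMap.expect_lerwProb] at h1
    simp only [MarkedMap.resampleClass_mk] at h1
    rw [MarkedMap.lawOf_eq_expect]
    exact h1.symm
  · rw [MarkedMap.lawOf_eq_expect, MarkedMap.lawOf_eq_expect]
    exact MarkedMap.expect_unzipList_lerwProb_eq_dlaProb fun z' => if z' = z then 1 else 0
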